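/- Let $\mathbf{Gpd}$ be the category of small groupoids, $\mathbf{G}$ the one-object groupoid $\mathbf{B}(\mathbb{Z}/2\mathbb{Z})^{op}$, and $\mathbf{Gpd^G}$ the functor category, i.e. the category of groupoids with an involution and equivariant functors. A morphism of $\mathbf{Gpd^G}$ is an \emph{injective trivial cofibration} if its underlying functor is an equivalence that is injective on objects, and an \emph{injective fibration} if it has the right lifting property with respect to all injective trivial cofibrations; an object $A$ is \emph{injectively fibrant} if the map from $A$ to the terminal object is an injective fibration. Let $(\mathbf{Gpd^G})_{\mathbf f}$ be the full subcategory of injectively fibrant objects, with the injective fibrations between them. A \emph{type-theoretic fibration category} is a category $\mathscr{C}$ with (1) a terminal object $\mathbf 1$; (2) a subcategory of \emph{fibrations} containing all objects, all isomorphisms and all morphisms with codomain $\mathbf 1$; an \emph{acyclic cofibration} is a morphism with the left lifting property with respect to all fibrations; such that (3) all pullbacks of fibrations exist and are fibrations; (4) for every fibration $g:A\to B$ the pullback functor $g^*:\mathscr{C}/B\to\mathscr{C}/A$ has a partial right adjoint $\Pi_g$, defined at all fibrations over $A$, with values fibrations over $B$; (5) every morphism factors as an acyclic cofibration followed by a fibration;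 (6) if $B\to C$ and $A\to C$ are fibrations and $A\to B$ is an acyclic cofibration over $C$, then its pullback along any $Z\to C$ is an acyclic cofibration. This is the categorical structure that models type theory with $\Sigma$-, $\Pi$- and $\mathrm{Id}$-types. A fibration $p:\widetilde U\to U$ in it is a \emph{universe} if, calling \emph{small fibrations} the pullbacks of $p$, (i) small fibrations contain the identities and are closed under composition; (ii) if $f:B\to A$ and $g:A\to C$ are small fibrations, so is $\Pi_g f$; (iii) if $A\to C$ and $B\to C$ are small fibrations, every morphism $A\to B$ over $C$ factors as an acyclic cofibration followed by a small fibration. For an inaccessible cardinal $\kappa$, let $U_\Delta\in\mathbf{Gpd^G}$ be the groupoid of triples $(A_0,A_1,\varphi)$, with $A_0,A_1\in V_\kappa$ sets (discrete $\kappa$-small groupoids) and $\varphi:A_0\to A_1$ a bijection; a morphism $(A_0,A_1,\varphi)\to(B_0,B_1,\psi)$ is a pair of bijections $\rho_0:A_0\to B_0$, $\rho_1:A_1\to B_1$ with $\psi\rho_0=\rho_1\varphi$; the involution is $(A_0,A_1,\varphi)\mapsto(A_1,A_0,\varphi^{-1})$, $(\rho_0,\rho_1)\mapsto(\rho_1,\rho_0)$.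 Let $\widetilde U_\Delta$ be the groupoid of tuples $(A_0,A_1,a,\varphi)$ with $(A_0,A_1,\varphi)$ as before and $a\in A_0$; its morphisms to $(B_0,B_1,b,\psi)$ are the pairs $(\rho_0,\rho_1)$ as before with $\rho_0(a)=b$; the involution is $(A_0,A_1,a,\varphi)\mapsto(A_1,A_0,\varphi(a),\varphi^{-1})$, $(\rho_0,\rho_1)\mapsto(\rho_1,\rho_0)$. Let $p_\Delta:\widetilde U_\Delta\to U_\Delta$ be the functor that forgets the point $a$. \textbf{Theorem.} $(\mathbf{Gpd^G})_{\mathbf f}$ is a type-theoretic fibration category. For every inaccessible cardinal $\kappa$, the map $p_\Delta:\widetilde U_\Delta\to U_\Delta$ is an injective fibration between injectively fibrant objects, and it is a universe in $(\mathbf{Gpd^G})_{\mathbf f}$. So $(\mathbf{Gpd^G})_{\mathbf f}$ carries the categorical structure that models type theory with $\Sigma$-, $\Pi$-, $\mathrm{Id}$-types and a universe, one for each inaccessible $\kappa$. -/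

import Mathlib

open CategoryTheory CategoryTheory.Limits

universe u v w

/-! Type-theoretic fibration categories and their universes. -/

section FibrationCategories

variable {C : Type w} [Category.{v} C]

/-- `q : P ⟶ B` is (a choice of) the dependent product `Π_g f` of `f : X ⟶ A` along `g : A ⟶ B`,
that is, the value at `f` of the partial right adjoint of `g^* : C/B ⥤ C/A`: there is a bijection
`Hom_{C/B}(Y, q) ≃ Hom_{C/A}(g^* Y, f)`, natural in `Y : C/B`. -/
def IsDependentProduct {A B X P : C} (g : A ⟶ B) [HasPullbacksAlong g] (f : X ⟶ A) (q : P ⟶ B) :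
    Prop :=
  Nonempty (((Over.pullback g).op ⋙ yoneda.obj (Over.mk f)).RepresentableBy (Over.mk q))

/-- The category `C`, equipped with the class of morphisms `F` (the fibrations), is a
type-theoretic fibration category: this is the categorical structure that models type theory with
`Σ`-, `Π`- and `Id`-types. The acyclic cofibrations are the morphisms in `F.llp`, i.e. those with
the left lifting property with respect to all fibrations. -/
structure IsTypeTheoreticFibrationCategory (F : MorphismProperty C) : Prop where
  /-- (1) there is a terminal object -/
  hasTerminal : HasTerminal C
  /-- (2) the fibrations form a subcategory with all the objects, -/
  isMultiplicative : F.IsMultiplicative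
  /-- all the isomorphisms, -/
  of_isIso : ∀ {A B : C} (f : A ⟶ B), IsIso f → F f
  /-- and all the morphisms to a terminal object -/
  of_isTerminal : ∀ {A T : C} (f : A ⟶ T), IsTerminal T → F f
  /-- (3) all pullbacks of fibrations exist -/
  hasPullbacksAlong : ∀ {A B : C} (g : A ⟶ B), F g → HasPullbacksAlong g
  /-- and are fibrations -/
  isStableUnderBaseChange : F.IsStableUnderBaseChange
  /-- (4) for every fibration `g : A ⟶ B` the pullback functor `C/B ⥤ C/A` has a partial right
  adjoint, defined at all fibrations over `A`, whose values are fibrations over `B` -/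
  exists_dependentProduct : ∀ {A B X : C} (g : A ⟶ B) [HasPullbacksAlong g] (f : X ⟶ A),
    F g → F f → ∃ (P : C) (q : P ⟶ B), F q ∧ IsDependentProduct g f q
  /-- (5) every morphism factors as an acyclic cofibration followed by a fibration -/
  exists_factorization : ∀ {A B : C} (f : A ⟶ B),
    ∃ (E : C) (i : A ⟶ E) (p : E ⟶ B), F.llp i ∧ F p ∧ i ≫ p = f
  /-- (6) acyclic cofibrations between fibrations over a base `S` are stable under pullback along
  any morphism `Z ⟶ S` -/
  llp_of_isPullback : ∀ {X Y Z A B S : C} {j : X ⟶ Y} {k : Y ⟶ Z} {a : X ⟶ A} {b : Y ⟶ B}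
    {c : Z ⟶ S} {i : A ⟶ B} {p : B ⟶ S}, F p → F (i ≫ p) → F.llp i →
    IsPullback j a b i → IsPullback k b c p → F.llp j

/-- `f` is a pullback of `p`. -/
def IsSmallFibration {E U : C} (p : E ⟶ U) {A B : C} (f : A ⟶ B) : Prop :=
  ∃ (k : A ⟶ E) (l : B ⟶ U), IsPullback k f p l

/-- The fibration `p` is a universe in the type-theoretic fibration category `(C, F)`. -/
structure IsTypeTheoreticUniverse (F : MorphismProperty C) {E U : C} (p : E ⟶ U) : Prop where
  fibration : F p
  /-- (i) small fibrations contain the identities and are closed under composition -/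
  id : ∀ A : C, IsSmallFibration p (𝟙 A)
  comp : ∀ {X A B : C} (f : X ⟶ A) (g : A ⟶ B),
    IsSmallFibration p f → IsSmallFibration p g → IsSmallFibration p (f ≫ g)
  /-- (ii) small fibrations are closed under dependent products -/
  dependentProduct : ∀ {A B X P : C} (g : A ⟶ B) [HasPullbacksAlong g] (f : X ⟶ A) (q : P ⟶ B),
    IsSmallFibration p f → IsSmallFibration p g → IsDependentProduct g f q → IsSmallFibration p q
  /-- (iii) a morphism over `S` between small fibrations over `S` factors as an acyclic cofibration
  followed by a small fibration -/
  factorization : ∀ {A B S : C} (f : A ⟶ B) (b : B ⟶ S),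
    IsSmallFibration p (f ≫ b) → IsSmallFibration p b →
    ∃ (X : C) (i : A ⟶ X) (r : X ⟶ B), F.llp i ∧ IsSmallFibration p r ∧ i ≫ r = f

end FibrationCategories

/-! Groupoids with an action of `ℤ/2ℤ`, and the injective fibrations between them. -/

namespace GpdG

/-- The delooping `B(ℤ/2ℤ)`. -/
abbrev BG : Type := SingleObj (Multiplicative (ZMod 2))

end GpdG

/-- The category `[B(ℤ/2ℤ)ᵒᵖ, Gpd]`. -/
abbrev GpdG : Type (u + 1) := GpdG.BGᵒᵖ ⥤ Grpd.{u, u}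

namespace GpdG

/-- The weak equivalences of the natural model structure on groupoids: the equivalences. -/
def grpdWeakEquivalences : MorphismProperty Grpd.{u, u} :=
  fun A B f => Functor.IsEquivalence (show (A : Type u) ⥤ (B : Type u) from f)

/-- The cofibrations of the natural model structure on groupoids: the functors that are injective
on objects. -/
def grpdCofibrations : MorphismProperty Grpd.{u, u} :=
  fun A B f => Function.Injective (show (A : Type u) ⥤ (B : Type u) from f).obj

/-- The trivial cofibrations of the injective model structure, in which weak equivalences and
cofibrations are levelwise. -/
def injTrivialCofibrations : MorphismProperty GpdG.{u} :=
  grpdWeakEquivalences.functorCategory BGᵒᵖ ⊓ grpdCofibrations.functorCategory BGᵒᵖ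

/-- The injective fibrations. -/
def injFibrations : MorphismProperty GpdG.{u} :=
  injTrivialCofibrations.rlp

/-- The injectively fibrant objects. -/
def IsInjFibrant : ObjectProperty GpdG.{u} :=
  fun A => ∀ (T : GpdG.{u}) (f : A ⟶ T), IsTerminal T → injFibrations f

/-- The full subcategory `(Gpd^G)_f` of injectively fibrant objects. -/
abbrev Fibrant : Type (u + 1) := IsInjFibrant.{u}.FullSubcategory

/-- The injective fibrations between injectively fibrant objects. -/
def fibrantInjFibrations : MorphismProperty Fibrant.{u} :=
  injFibrations.inverseImage IsInjFibrant.ι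

/-- The action of `ℤ/2ℤ` generated by an involution `α`. -/
def involutionPow {A : Grpd.{u, u}} (α : A ⟶ A) (g : Multiplicative (ZMod 2)) : A ⟶ A :=
  if g = 1 then 𝟙 A else α

theorem involutionPow_mul {A : Grpd.{u, u}} (α : A ⟶ A) (hα : α ≫ α = 𝟙 A)
    (g h : Multiplicative (ZMod 2)) :
    involutionPow α (g * h) = involutionPow α g ≫ involutionPow α h := by
  have h1 : ∀ a b : Multiplicative (ZMod 2), a ≠ 1 → b ≠ 1 → a * b = 1 := by decide
  by_cases hg : g = 1 <;> by_cases hh : h = 1 <;> simp [involutionPow, hg, hh, h1, hα]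

/-- A groupoid with an involution, as an object of `Gpd^G`: the nontrivial element acts by the
involution. -/
def ofInvolution (A : Grpd.{u, u}) (α : A ⟶ A) (hα : α ≫ α = 𝟙 A) : GpdG.{u} where
  obj _ := A
  map g := involutionPow α g.unop
  map_id _ := if_pos rfl
  map_comp g h := involutionPow_mul α hα g.unop h.unop

/-- An equivariant functor, as a morphism of `Gpd^G`. -/
def homOfEquivariant {A B : Grpd.{u, u}} {α : A ⟶ A} {hα : α ≫ α = 𝟙 A} {β : B ⟶ B}
    {hβ : β ≫ β = 𝟙 B} (f : A ⟶ B) (hf : α ≫ f = f ≫ β) :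
    ofInvolution A α hα ⟶ ofInvolution B β hβ where
  app _ := f
  naturality _ _ g := by
    change involutionPow α g.unop ≫ f = f ≫ involutionPow β g.unop
    unfold involutionPow
    split_ifs <;> simp [hf]

/-! The universe `p_Δ : Ũ_Δ ⟶ U_Δ`. -/

noncomputable section

/-- The (small) type of sets in `V_κ`. For `κ` inaccessible, `V_κ` consists of the hereditarily
`κ`-small sets and contains a set of each cardinality `< κ`. A set `A` in `V_κ` is identified with
the discrete groupoid on `A`, and bijections with isomorphisms of discrete groupoids. -/
def SmallSet (κ : Cardinal.{u}) : Type u := Shrink.{u} (ZFSet.vonNeumann κ.ord)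

/-- The set of elements of a set in `V_κ`. -/
def SmallSet.El {κ : Cardinal.{u}} (A : SmallSet κ) : Type u :=
  Shrink.{u} ((equivShrink (ZFSet.vonNeumann κ.ord)).symm A : ZFSet.{u})

/-- The objects `(A₀, A₁, φ)` of `U_Δ`. -/
structure UObj (κ : Cardinal.{u}) : Type u where
  A₀ : SmallSet κ
  A₁ : SmallSet κ
  φ : A₀.El ≃ A₁.El

/-- The morphisms `(ρ₀, ρ₁, α) : (A₀, A₁, φ) ⟶ (B₀, B₁, ψ)` of `U_Δ`. As the groupoids are
discrete, the natural isomorphism `α : ψ ∘ ρ₀ ≅ ρ₁ ∘ φ` is an equality. -/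
@[ext]
structure UObj.Hom {κ : Cardinal.{u}} (A B : UObj κ) : Type u where
  ρ₀ : A.A₀.El ≃ B.A₀.El
  ρ₁ : A.A₁.El ≃ B.A₁.El
  comm : ∀ x, B.φ (ρ₀ x) = ρ₁ (A.φ x)

instance (κ : Cardinal.{u}) : Groupoid (UObj κ) where
  Hom := UObj.Hom
  id A := ⟨Equiv.refl _, Equiv.refl _, fun _ => rfl⟩
  comp f g := ⟨f.ρ₀.trans g.ρ₀, f.ρ₁.trans g.ρ₁, fun x => by simp [f.comm, g.comm]⟩
  inv {A B} f := ⟨f.ρ₀.symm, f.ρ₁.symm, fun x => by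
    rw [Equiv.eq_symm_apply, ← f.comm, Equiv.apply_symm_apply]⟩
  inv_comp f := UObj.Hom.ext (Equiv.symm_trans_self _) (Equiv.symm_trans_self _)
  comp_inv f := UObj.Hom.ext (Equiv.self_trans_symm _) (Equiv.self_trans_symm _)

/-- The objects `(A₀, A₁, a, φ)` of `Ũ_Δ`. -/
structure UTildeObj (κ : Cardinal.{u}) : Type u where
  A₀ : SmallSet κ
  A₁ : SmallSet κ
  a : A₀.El
  φ : A₀.El ≃ A₁.El

/-- The morphisms `(ρ₀, ρ₁, τ, α) : (A₀, A₁, a, φ) ⟶ (B₀, B₁, b, ψ)` of `Ũ_Δ`. As the groupoids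
are discrete, the isomorphisms `τ : ρ₀ a ≅ b` and `α : ψ ∘ ρ₀ ≅ ρ₁ ∘ φ` are equalities. -/
@[ext]
structure UTildeObj.Hom {κ : Cardinal.{u}} (A B : UTildeObj κ) : Type u where
  ρ₀ : A.A₀.El ≃ B.A₀.El
  ρ₁ : A.A₁.El ≃ B.A₁.El
  pt : ρ₀ A.a = B.a
  comm : ∀ x, B.φ (ρ₀ x) = ρ₁ (A.φ x)

instance (κ : Cardinal.{u}) : Groupoid (UTildeObj κ) where
  Hom := UTildeObj.Hom
  id A := ⟨Equiv.refl _, Equiv.refl _, rfl, fun _ => rfl⟩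
  comp f g := ⟨f.ρ₀.trans g.ρ₀, f.ρ₁.trans g.ρ₁, by simp [f.pt, g.pt],
    fun x => by simp [f.comm, g.comm]⟩
  inv {A B} f := ⟨f.ρ₀.symm, f.ρ₁.symm, by rw [Equiv.symm_apply_eq, f.pt], fun x => by
    rw [Equiv.eq_symm_apply, ← f.comm, Equiv.apply_symm_apply]⟩
  inv_comp f := UTildeObj.Hom.ext (Equiv.symm_trans_self _) (Equiv.symm_trans_self _)
  comp_inv f := UTildeObj.Hom.ext (Equiv.self_trans_symm _) (Equiv.self_trans_symm _)

/-- The involution `u` of `U_Δ`: `(A₀, A₁, φ) ↦ (A₁, A₀, φ⁻¹)` and `(ρ₀, ρ₁) ↦ (ρ₁, ρ₀)`. -/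
def uInvolution (κ : Cardinal.{u}) : UObj κ ⥤ UObj κ where
  obj A := ⟨A.A₁, A.A₀, A.φ.symm⟩
  map {A B} f := ⟨f.ρ₁, f.ρ₀, fun x => by
    rw [Equiv.symm_apply_eq, f.comm, Equiv.apply_symm_apply]⟩
  map_id _ := rfl
  map_comp _ _ := rfl

/-- The involution `ũ` of `Ũ_Δ`: `(A₀, A₁, a, φ) ↦ (A₁, A₀, φ a, φ⁻¹)` and
`(ρ₀, ρ₁) ↦ (ρ₁, ρ₀)`. -/
def uTildeInvolution (κ : Cardinal.{u}) : UTildeObj κ ⥤ UTildeObj κ where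
  obj A := ⟨A.A₁, A.A₀, A.φ A.a, A.φ.symm⟩
  map {A B} f := ⟨f.ρ₁, f.ρ₀, by rw [← f.comm, f.pt], fun x => by
    rw [Equiv.symm_apply_eq, f.comm, Equiv.apply_symm_apply]⟩
  map_id _ := rfl
  map_comp _ _ := rfl

theorem uInvolution_comp_self (κ : Cardinal.{u}) :
    uInvolution κ ⋙ uInvolution κ = 𝟭 (UObj κ) := rfl

theorem uTildeInvolution_comp_self (κ : Cardinal.{u}) :
    uTildeInvolution κ ⋙ uTildeInvolution κ = 𝟭 (UTildeObj κ) := by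
  have h : ∀ A : UTildeObj κ, (uTildeInvolution κ ⋙ uTildeInvolution κ).obj A = A := by
    rintro ⟨A₀, A₁, a, φ⟩
    simp [uTildeInvolution]
  have eq : ∀ {A B A' B' : UTildeObj κ} (hA : A' = A) (hB : B' = B) (f : A ⟶ B) (f' : A' ⟶ B'),
      HEq f'.ρ₀ f.ρ₀ → HEq f'.ρ₁ f.ρ₁ → f' = eqToHom hA ≫ f ≫ eqToHom hB.symm := by
    rintro _ _ _ _ rfl rfl f f' h₀ h₁
    simp only [eqToHom_refl, Category.id_comp, Category.comp_id]
    exact UTildeObj.Hom.ext (eq_of_heq h₀) (eq_of_heq h₁)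
  exact CategoryTheory.Functor.ext h (fun _ _ f => eq (h _) (h _) f _ HEq.rfl HEq.rfl)

/-- The forgetful functor `(A₀, A₁, a, φ) ↦ (A₀, A₁, φ)`. -/
def forgetPoint (κ : Cardinal.{u}) : UTildeObj κ ⥤ UObj κ where
  obj A := ⟨A.A₀, A.A₁, A.φ⟩
  map f := ⟨f.ρ₀, f.ρ₁, f.comm⟩
  map_id _ := rfl
  map_comp _ _ := rfl

/-- `U_Δ`, the groupoid of triples `(A₀, A₁, φ)` with its involution. -/
def UDelta (κ : Cardinal.{u}) : GpdG.{u} :=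
  ofInvolution (Grpd.of (UObj κ)) (uInvolution κ) (uInvolution_comp_self κ)

/-- `Ũ_Δ`, the groupoid of tuples `(A₀, A₁, a, φ)` with its involution. -/
def UTildeDelta (κ : Cardinal.{u}) : GpdG.{u} :=
  ofInvolution (Grpd.of (UTildeObj κ)) (uTildeInvolution κ) (uTildeInvolution_comp_self κ)

/-- The equivariant functor `p_Δ : Ũ_Δ ⟶ U_Δ` that forgets the point. -/
def pDelta (κ : Cardinal.{u}) : UTildeDelta κ ⟶ UDelta κ :=
  homOfEquivariant (A := Grpd.of (UTildeObj κ)) (B := Grpd.of (UObj κ)) (forgetPoint κ) rfl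

end

end GpdG

/-! One-sorted groupoids with an involution: the elements are the arrows, an object is identified
with its identity arrow, and `x * y` is the composite in diagrammatic order, meaningful if
`tgt x = src y`. -/

/-! The category `GpdG` is equivalent to `InvGpd`, where a groupoid with involution is just its set
of arrows. In that form pullbacks, sections and equality of functors are statements about elements,
without transport along equalities of objects. All constructions are made in `InvGpd` and then
carried back.

A map is an injective fibration as soon as it is an isofibration (`LiftsArrows`) and satisfies one
equivariant condition (`LiftsFixedPoints`): if the image of a homotopy fixed point is isomorphic to
a fixed point, that isomorphism lifts to one with a fixed target. Indeed a trivial cofibration `T ⟶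
T'` is a non-equivariant deformation retract; its deformation can be lifted orbit by orbit, freely
on the free orbits and by the second condition on fixed objects (`exists_lift`). Every map factors
as a trivial cofibration followed by such a fibration: the middle object is a mapping path object
built from arrows `φ : a ⟶ a'` of `A` with `φ ↦ bar φ⁻¹`, whose fixed points are the homotopy fixed
points of `A`. Retract arguments then show that injective fibrations are isofibrations and that
acyclic cofibrations between fibrant objects are exactly the trivial cofibrations.

Dependent products along isofibrations are groupoids of sections (`isPi_piMap`). They are fibrations
because trivial cofibrations are stable under pullback along isofibrations, so lifting problems
transpose (`fibrations_of_isPi`). The axioms pass to the fibrant objects since every object needed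
is a fibration over a fibrant one (`IsFibrantInclusion`).

For the universe, the pullbacks of `pDelta` are exactly the discrete fibrations with fibres smaller
than `κ` (`isSmallDiscrete_iff`): such a fibration is classified by its fibres, the transport
between them and the involution. This class is closed under composition because `κ` is regular, and
under dependent products because `κ` is a strong limit. It also has left cancellation, so a map over
`S` between small fibrations is itself small and the factorization axiom is trivial. Finally `U_Δ`
is fibrant because a homotopy fixed point `(ρ₀, ρ₁)` of it turns `ρ₁ ∘ φ` into an involution `ψ` of
`A₀`, and `(A₀, A₀, ψ)` is a strict fixed point. -/

class InvolutiveGroupoid (α : Type u) extends Mul α, Inv α where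
  src : α → α
  tgt : α → α
  bar : α → α
  src_src : ∀ x, src (src x) = src x
  src_tgt : ∀ x, src (tgt x) = tgt x
  tgt_src : ∀ x, tgt (src x) = src x
  tgt_tgt : ∀ x, tgt (tgt x) = tgt x
  src_mul : ∀ x y, tgt x = src y → src (x * y) = src x
  tgt_mul : ∀ x y, tgt x = src y → tgt (x * y) = tgt y
  comp_assoc : ∀ x y z, tgt x = src y → tgt y = src z → x * y * z = x * (y * z)
  src_mul_self : ∀ x, src x * x = x
  mul_tgt_self : ∀ x, x * tgt x = x
  src_inv : ∀ x, src x⁻¹ = tgt x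
  tgt_inv : ∀ x, tgt x⁻¹ = src x
  mul_inv_self : ∀ x, x * x⁻¹ = src x
  inv_mul_self : ∀ x, x⁻¹ * x = tgt x
  bar_bar : ∀ x, bar (bar x) = x
  src_bar : ∀ x, src (bar x) = bar (src x)
  tgt_bar : ∀ x, tgt (bar x) = bar (tgt x)
  bar_mul : ∀ x y, tgt x = src y → bar (x * y) = bar x * bar y

namespace InvolutiveGroupoid

attribute [simp] src_src src_tgt tgt_src tgt_tgt src_mul tgt_mul src_mul_self mul_tgt_self
  src_inv tgt_inv mul_inv_self inv_mul_self bar_bar src_bar tgt_bar bar_mul comp_assoc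
attribute [grind =] src_src src_tgt tgt_src tgt_tgt src_mul tgt_mul src_mul_self mul_tgt_self
  src_inv tgt_inv mul_inv_self inv_mul_self bar_bar src_bar tgt_bar bar_mul comp_assoc

/-- The involutive groupoid given by a composition that is only defined on composable arrows. -/
@[reducible]
noncomputable def ofPartial {α : Type u} (src tgt bar inv : α → α)
    (comp : ∀ x y, tgt x = src y → α)
    (src_src : ∀ x, src (src x) = src x) (src_tgt : ∀ x, src (tgt x) = tgt x)
    (tgt_src : ∀ x, tgt (src x) = src x) (tgt_tgt : ∀ x, tgt (tgt x) = tgt x)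
    (src_comp : ∀ x y h, src (comp x y h) = src x) (tgt_comp : ∀ x y h, tgt (comp x y h) = tgt y)
    (comp_assoc : ∀ x y z h h', comp (comp x y h) z ((tgt_comp x y h).trans h') =
      comp x (comp y z h') (h.trans (src_comp y z h').symm))
    (src_comp_self : ∀ x, comp (src x) x (tgt_src x) = x)
    (comp_tgt_self : ∀ x, comp x (tgt x) (src_tgt x).symm = x)
    (src_inv : ∀ x, src (inv x) = tgt x) (tgt_inv : ∀ x, tgt (inv x) = src x)
    (comp_inv_self : ∀ x, comp x (inv x) (src_inv x).symm = src x)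
    (inv_comp_self : ∀ x, comp (inv x) x (tgt_inv x) = tgt x)
    (bar_bar : ∀ x, bar (bar x) = x)
    (src_bar : ∀ x, src (bar x) = bar (src x)) (tgt_bar : ∀ x, tgt (bar x) = bar (tgt x))
    (bar_comp : ∀ x y h, bar (comp x y h) = comp (bar x) (bar y)
      ((tgt_bar x).trans ((congrArg bar h).trans (src_bar y).symm))) :
    InvolutiveGroupoid α :=
  -- On non-composable pairs the product takes the default value `x`; every axiom about products
  -- assumes composability.
  letI m : α → α → α := fun x y => open Classical in if h : tgt x = src y then comp x y h else x
  have hm : ∀ x y h, m x y = comp x y h := fun x y h => dif_pos h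
  { src := src, tgt := tgt, bar := bar, inv := inv, mul := m
    src_src := src_src, src_tgt := src_tgt, tgt_src := tgt_src, tgt_tgt := tgt_tgt
    src_mul := fun x y h => (congrArg src (hm x y h)).trans (src_comp x y h)
    tgt_mul := fun x y h => (congrArg tgt (hm x y h)).trans (tgt_comp x y h)
    comp_assoc := fun x y z h h' => by
      change m (m x y) z = m x (m y z)
      rw [hm x y h, hm y z h', hm _ _ ((tgt_comp x y h).trans h'),
        hm _ _ (h.trans (src_comp y z h').symm), comp_assoc x y z h h']
    src_mul_self := fun x => (hm _ _ (tgt_src x)).trans (src_comp_self x)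
    mul_tgt_self := fun x => (hm _ _ (src_tgt x).symm).trans (comp_tgt_self x)
    src_inv := src_inv, tgt_inv := tgt_inv
    mul_inv_self := fun x => (hm _ _ (src_inv x).symm).trans (comp_inv_self x)
    inv_mul_self := fun x => (hm _ _ (tgt_inv x)).trans (inv_comp_self x)
    bar_bar := bar_bar, src_bar := src_bar, tgt_bar := tgt_bar
    bar_mul := fun x y h => by
      change bar (m x y) = m (bar x) (bar y)
      rw [hm x y h, bar_comp x y h, ← hm] }

section

variable {α : Type u} [InvolutiveGroupoid α] {x y z : α}

@[simp, grind =]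
theorem inv_mul_mul (h : tgt x = src y) : x⁻¹ * (x * y) = y := by
  rw [← comp_assoc _ _ _ (tgt_inv x) h, inv_mul_self, h, src_mul_self]

@[simp, grind =]
theorem mul_inv_mul (h : src x = src y) : x * (x⁻¹ * y) = y := by
  rw [← comp_assoc _ _ _ (src_inv x).symm ((tgt_inv x).trans h), mul_inv_self, h, src_mul_self]

@[simp, grind =]
theorem mul_mul_inv (h : tgt x = src y) : x * y * y⁻¹ = x := by
  rw [comp_assoc _ _ _ h (src_inv y).symm, mul_inv_self, ← h, mul_tgt_self]

@[simp]
theorem mul_src (h : tgt x = src y) : x * src y = x := by rw [← h, mul_tgt_self]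

@[simp]
theorem mul_tgt (h : tgt x = tgt y) : x * tgt y = x := by rw [← h, mul_tgt_self]

@[simp]
theorem src_mul_of_src_eq (h : src x = src y) : src x * y = y := by rw [h, src_mul_self]

@[simp]
theorem tgt_mul_of_tgt_eq (h : tgt x = src y) : tgt x * y = y := by rw [h, src_mul_self]

@[simp, grind =]
theorem inverse_inverse (x : α) : x⁻¹⁻¹ = x := by
  have h := inv_mul_mul (x := x⁻¹) (y := x) (by simp)
  rwa [inv_mul_self, show tgt x = tgt x⁻¹⁻¹ by simp, mul_tgt_self] at h

theorem inv_eq_of_mul_eq (h : tgt x = src y) (e : x * y = src x) : x⁻¹ = y := by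
  rw [← inv_mul_mul h, e, ← tgt_inv, mul_tgt_self]

@[simp, grind =]
theorem inv_comp (h : tgt x = src y) : (x * y)⁻¹ = y⁻¹ * x⁻¹ := by
  apply inv_eq_of_mul_eq
  · simp [h]
  · rw [comp_assoc _ _ _ h (by simp [h]), mul_inv_mul (by simp [h]), mul_inv_self, src_mul _ _ h]

@[simp, grind =]
theorem bar_inv (x : α) : bar x⁻¹ = (bar x)⁻¹ := by
  symm
  apply inv_eq_of_mul_eq
  · simp
  · rw [← bar_mul _ _ (by simp), mul_inv_self, src_bar]

@[simp, grind =]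
theorem inv_src (x : α) : (src x)⁻¹ = src x :=
  inv_eq_of_mul_eq (by simp) (by simp)

@[simp, grind =]
theorem inv_tgt (x : α) : (tgt x)⁻¹ = tgt x := by
  rw [← src_tgt, inv_src]

theorem bar_injective : Function.Injective (bar : α → α) :=
  Function.LeftInverse.injective bar_bar

theorem tgt_eq_of_src_eq (h : src x = x) : tgt x = x := by rw [← h, tgt_src]

end

end InvolutiveGroupoid

/-! ### The category of involutive groupoids: isomorphisms, terminal object, pullbacks -/

open InvolutiveGroupoid

/-- The category of one-sorted groupoids with an involution. -/
structure InvGpd : Type (u + 1) where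
  carrier : Type u
  [str : InvolutiveGroupoid carrier]

namespace InvGpd

instance : CoeSort InvGpd.{u} (Type u) := ⟨carrier⟩

attribute [instance] str

@[ext]
structure Hom (A B : InvGpd.{u}) : Type u where
  toFun : A → B
  map_src : ∀ x, toFun (src x) = src (toFun x)
  map_tgt : ∀ x, toFun (tgt x) = tgt (toFun x)
  map_bar : ∀ x, toFun (bar x) = bar (toFun x)
  map_mul : ∀ x y, tgt x = src y → toFun (x * y) = toFun x * toFun y

instance : Category InvGpd.{u} where
  Hom := Hom
  id A := ⟨id, fun _ => rfl, fun _ => rfl, fun _ => rfl, fun _ _ _ => rfl⟩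
  comp f g := ⟨g.toFun ∘ f.toFun, fun x => by simp [f.map_src, g.map_src],
    fun x => by simp [f.map_tgt, g.map_tgt], fun x => by simp [f.map_bar, g.map_bar],
    fun x y h => by
      simp only [Function.comp_apply, f.map_mul x y h]
      exact g.map_mul _ _ (by rw [← f.map_tgt, ← f.map_src, h])⟩

instance {A B : InvGpd.{u}} : CoeFun (A ⟶ B) fun _ => A → B := ⟨Hom.toFun⟩

variable {A B C : InvGpd.{u}}

@[ext]
theorem hom_ext {f g : A ⟶ B} (h : ∀ x, f x = g x) : f = g := Hom.ext (funext h)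

@[simp, grind =] theorem id_apply (x : A) : (𝟙 A : A ⟶ A) x = x := rfl

@[simp, grind =] theorem comp_apply (f : A ⟶ B) (g : B ⟶ C) (x : A) : (f ≫ g) x = g (f x) := rfl

theorem congr_hom {f g : A ⟶ B} (h : f = g) (x : A) : f x = g x := h ▸ rfl

@[simp, grind =] theorem map_src (f : A ⟶ B) (x : A) : f (src x) = src (f x) := f.map_src x
@[simp, grind =] theorem map_tgt (f : A ⟶ B) (x : A) : f (tgt x) = tgt (f x) := f.map_tgt x
@[simp, grind =] theorem map_bar (f : A ⟶ B) (x : A) : f (bar x) = bar (f x) := f.map_bar x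
@[simp, grind =] theorem map_mul (f : A ⟶ B) {x y : A} (h : tgt x = src y) :
    f (x * y) = f x * f y :=
  f.map_mul x y h

theorem map_composable (f : A ⟶ B) {x y : A} (h : tgt x = src y) : tgt (f x) = src (f y) := by
  rw [← map_tgt, h, map_src]

@[simp, grind =] theorem map_inv (f : A ⟶ B) (x : A) : f x⁻¹ = (f x)⁻¹ := by
  symm
  apply inv_eq_of_mul_eq
  · rw [← map_src, src_inv, map_tgt]
  · rw [← map_mul f (by simp), mul_inv_self, map_src]

/-- A bijective morphism is an isomorphism. -/
noncomputable def isoOfBijective (f : A ⟶ B) (hf : Function.Bijective f) : A ≅ B :=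
  let e := Equiv.ofBijective f hf
  have he : ∀ y, f (e.symm y) = y := e.apply_symm_apply
  { hom := f
    inv :=
      { toFun := e.symm
        map_src := fun y => hf.1 (by rw [he, map_src, he])
        map_tgt := fun y => hf.1 (by rw [he, map_tgt, he])
        map_bar := fun y => hf.1 (by rw [he, map_bar, he])
        map_mul := fun x y h => hf.1 (by
          rw [he, map_mul f, he, he]
          apply hf.1
          rw [map_tgt, map_src, he, he, h]) }
    hom_inv_id := hom_ext fun x => e.symm_apply_apply x
    inv_hom_id := hom_ext he }

theorem bijective_of_isIso (f : A ⟶ B) [IsIso f] : Function.Bijective f := by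
  refine Function.bijective_iff_has_inverse.2 ⟨inv f, fun x => ?_, fun x => ?_⟩
  · rw [← comp_apply, IsIso.hom_inv_id, id_apply]
  · rw [← comp_apply, IsIso.inv_hom_id, id_apply]

/-! The terminal object. -/

instance : InvolutiveGroupoid PUnit.{u + 1} where
  mul _ _ := ⟨⟩
  inv _ := ⟨⟩
  src _ := ⟨⟩
  tgt _ := ⟨⟩
  bar _ := ⟨⟩
  src_src _ := rfl
  src_tgt _ := rfl
  tgt_src _ := rfl
  tgt_tgt _ := rfl
  src_mul _ _ _ := rfl
  tgt_mul _ _ _ := rfl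
  comp_assoc _ _ _ _ _ := rfl
  src_mul_self _ := rfl
  mul_tgt_self _ := rfl
  src_inv _ := rfl
  tgt_inv _ := rfl
  mul_inv_self _ := rfl
  inv_mul_self _ := rfl
  bar_bar _ := rfl
  src_bar _ := rfl
  tgt_bar _ := rfl
  bar_mul _ _ _ := rfl

def punit : InvGpd.{u} := ⟨PUnit⟩

def isTerminalPUnit : IsTerminal punit.{u} :=
  IsTerminal.ofUniqueHom (fun _ => ⟨fun _ => ⟨⟩, fun _ => rfl, fun _ => rfl, fun _ => rfl,
    fun _ _ _ => rfl⟩) (fun _ _ => rfl)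

/-! Pullbacks. -/

section Pullback

variable (f : A ⟶ C) (g : B ⟶ C)

def PullbackCarrier : Type u := {z : A × B // f z.1 = g z.2}

variable {f g}

@[ext]
theorem PullbackCarrier.ext {z w : PullbackCarrier f g} (h₁ : z.1.1 = w.1.1)
    (h₂ : z.1.2 = w.1.2) : z = w := Subtype.ext (Prod.ext h₁ h₂)

variable (f g)

noncomputable instance : InvolutiveGroupoid (PullbackCarrier f g) :=
  ofPartial
    (src := fun z => ⟨(src z.1.1, src z.1.2), by simp [z.2]⟩)
    (tgt := fun z => ⟨(tgt z.1.1, tgt z.1.2), by simp [z.2]⟩)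
    (bar := fun z => ⟨(bar z.1.1, bar z.1.2), by simp [z.2]⟩)
    (inv := fun z => ⟨(z.1.1⁻¹, z.1.2⁻¹), by simp [z.2]⟩)
    (comp := fun z w h => ⟨(z.1.1 * w.1.1, z.1.2 * w.1.2), by
      have h₁ : tgt z.1.1 = src w.1.1 := congrArg (fun x => x.1.1) h
      have h₂ : tgt z.1.2 = src w.1.2 := congrArg (fun x => x.1.2) h
      simp only [map_mul f h₁, map_mul g h₂, z.2, w.2]⟩)
    (src_src := fun _ => by ext <;> simp) (src_tgt := fun _ => by ext <;> simp)
    (tgt_src := fun _ => by ext <;> simp) (tgt_tgt := fun _ => by ext <;> simp)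
    (src_comp := fun x y h => by
      have h₁ : tgt x.1.1 = src y.1.1 := congrArg (fun x => x.1.1) h
      have h₂ : tgt x.1.2 = src y.1.2 := congrArg (fun x => x.1.2) h
      ext <;> simp [h₁, h₂])
    (tgt_comp := fun x y h => by
      have h₁ : tgt x.1.1 = src y.1.1 := congrArg (fun x => x.1.1) h
      have h₂ : tgt x.1.2 = src y.1.2 := congrArg (fun x => x.1.2) h
      ext <;> simp [h₁, h₂])
    (comp_assoc := fun x y z h h' => by
      have h₁ : tgt x.1.1 = src y.1.1 := congrArg (fun x => x.1.1) h
      have h₂ : tgt x.1.2 = src y.1.2 := congrArg (fun x => x.1.2) h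
      have h₁' : tgt y.1.1 = src z.1.1 := congrArg (fun x => x.1.1) h'
      have h₂' : tgt y.1.2 = src z.1.2 := congrArg (fun x => x.1.2) h'
      ext <;> simp [comp_assoc, *])
    (src_comp_self := fun _ => by ext <;> simp) (comp_tgt_self := fun _ => by ext <;> simp)
    (src_inv := fun _ => by ext <;> simp) (tgt_inv := fun _ => by ext <;> simp)
    (comp_inv_self := fun _ => by ext <;> simp) (inv_comp_self := fun _ => by ext <;> simp)
    (bar_bar := fun _ => by ext <;> simp)
    (src_bar := fun _ => by ext <;> simp) (tgt_bar := fun _ => by ext <;> simp)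
    (bar_comp := fun x y h => by
      have h₁ : tgt x.1.1 = src y.1.1 := congrArg (fun x => x.1.1) h
      have h₂ : tgt x.1.2 = src y.1.2 := congrArg (fun x => x.1.2) h
      ext <;> simp [bar_mul, *])

theorem PullbackCarrier.mul_val {z w : PullbackCarrier f g} (h : tgt z = src w) :
    (z * w).1 = (z.1.1 * w.1.1, z.1.2 * w.1.2) :=
  congrArg Subtype.val (dif_pos h)

noncomputable abbrev pullbackObj : InvGpd.{u} := ⟨PullbackCarrier f g⟩

def pullbackFst : pullbackObj f g ⟶ A :=
  Hom.mk (A := pullbackObj f g) (fun z => z.1.1) (fun _ => rfl) (fun _ => rfl) (fun _ => rfl)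
    fun _ _ h => congrArg Prod.fst (PullbackCarrier.mul_val f g h)

def pullbackSnd : pullbackObj f g ⟶ B :=
  Hom.mk (A := pullbackObj f g) (fun z => z.1.2) (fun _ => rfl) (fun _ => rfl) (fun _ => rfl)
    fun _ _ h => congrArg Prod.snd (PullbackCarrier.mul_val f g h)

variable {f g}

/-- A commutative square is a pullback if it is one on the sets of arrows. -/
theorem isPullback_of_existsUnique {P : InvGpd.{u}} {a : P ⟶ A} {b : P ⟶ B} (w : a ≫ f = b ≫ g)
    (h : ∀ x y, f x = g y → ∃! z, a z = x ∧ b z = y) : IsPullback a b f g := by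
  have joint : ∀ z z', a z = a z' → b z = b z' → z = z' := fun z z' ha hb =>
    (h (a z') (b z') (congr_hom w z')).unique ⟨ha, hb⟩ ⟨rfl, rfl⟩
  have lift : ∀ {Z : InvGpd.{u}} (p : Z ⟶ A) (q : Z ⟶ B), p ≫ f = q ≫ g →
      ∃ l : Z ⟶ P, ∀ x, a (l x) = p x ∧ b (l x) = q x := fun p q hpq => by
    choose l hl using fun x => (h (p x) (q x) (congr_hom hpq x)).exists
    refine ⟨⟨l, fun x => joint _ _ ?_ ?_, fun x => joint _ _ ?_ ?_, fun x => joint _ _ ?_ ?_,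
      fun x y e => ?_⟩, hl⟩
    iterate 6 simp [hl]
    -- Composability is itself an equation between arrows, so it too can be checked on the two
    -- projections.
    have e' : tgt (l x) = src (l y) := joint _ _
      (by simp only [map_tgt, map_src, hl]; exact map_composable p e)
      (by simp only [map_tgt, map_src, hl]; exact map_composable q e)
    refine joint _ _ ?_ ?_
    · rw [map_mul a e', (hl _).1, (hl _).1, (hl _).1, map_mul _ e]
    · rw [map_mul b e', (hl _).2, (hl _).2, (hl _).2, map_mul _ e]
  choose l hl using @lift
  exact ⟨⟨w⟩, ⟨PullbackCone.IsLimit.mk _ (fun s => l s.fst s.snd s.condition)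
    (fun s => hom_ext fun x => (hl _ _ _ x).1) (fun s => hom_ext fun x => (hl _ _ _ x).2)
    fun s m h₁ h₂ => hom_ext fun x => joint _ _
      ((congr_hom h₁ x).trans (hl _ _ _ x).1.symm) ((congr_hom h₂ x).trans (hl _ _ _ x).2.symm)⟩⟩

variable (f g) in
theorem isPullback_pullbackObj : IsPullback (pullbackFst f g) (pullbackSnd f g) f g :=
  isPullback_of_existsUnique (hom_ext fun z => z.2) fun x y h =>
    ⟨(⟨(x, y), h⟩ : PullbackCarrier f g), ⟨rfl, rfl⟩,
      fun _ hz => PullbackCarrier.ext hz.1 hz.2⟩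

instance : HasPullbacks InvGpd.{u} :=
  haveI : ∀ {A B C : InvGpd.{u}} {f : A ⟶ C} {g : B ⟶ C}, HasLimit (cospan f g) :=
    fun {_ _ _ f g} => (isPullback_pullbackObj f g).hasPullback
  hasPullbacks_of_hasLimit_cospan _

/-- Any pullback is isomorphic to the explicit one, and isomorphisms are bijective on arrows. -/
theorem existsUnique_of_isPullback {P : InvGpd.{u}} {a : P ⟶ A} {b : P ⟶ B}
    (h : IsPullback a b f g) {x : A} {y : B} (e : f x = g y) : ∃! z, a z = x ∧ b z = y := by
  let i := h.isoIsPullback _ _ (isPullback_pullbackObj f g)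
  have ha : ∀ z, (i.hom z).1.1 = a z :=
    congr_hom (h.isoIsPullback_hom_fst _ _ (isPullback_pullbackObj f g))
  have hb : ∀ z, (i.hom z).1.2 = b z :=
    congr_hom (h.isoIsPullback_hom_snd _ _ (isPullback_pullbackObj f g))
  obtain ⟨hi, hs⟩ := bijective_of_isIso i.hom
  obtain ⟨z, hz⟩ := hs (⟨(x, y), e⟩ : PullbackCarrier f g)
  refine ⟨z, ⟨by rw [← ha, hz], by rw [← hb, hz]⟩, fun w hw => hi ?_⟩
  rw [hz]
  exact PullbackCarrier.ext ((ha w).trans hw.1) ((hb w).trans hw.2)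

end Pullback

end InvGpd

/-! ### Trivial cofibrations and a lifting criterion for injective fibrations -/

namespace InvGpd

variable {A B C : InvGpd.{u}}

/-- The equivariant functors that are equivalences and injective on objects. -/
structure IsTrivialCofibration (i : A ⟶ B) : Prop where
  injective : Function.Injective i
  full : ∀ y, src y ∈ Set.range i → tgt y ∈ Set.range i → y ∈ Set.range i
  essSurj : ∀ y, ∃ x, src x ∈ Set.range i ∧ tgt x = src y

def trivialCofibrations : MorphismProperty InvGpd.{u} := fun _ _ i => IsTrivialCofibration i

/-- The injective fibrations. -/
abbrev fibrations : MorphismProperty InvGpd.{u} := trivialCofibrations.rlp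

/-- The isofibrations. -/
def LiftsArrows (p : A ⟶ B) : Prop :=
  ∀ (a : A) (β : B), src β = p (src a) → ∃ m, src m = src a ∧ p m = β

/-- A homotopy fixed point `θ` whose image is isomorphic to a fixed point is isomorphic to a fixed
point above it. -/
def LiftsFixedPoints (p : A ⟶ B) : Prop :=
  ∀ (θ : A) (β : B), bar θ = θ⁻¹ → src β = p (src θ) → p θ * bar β = β →
    ∃ m, src m = src θ ∧ p m = β ∧ θ * bar m = m

theorem LiftsArrows.exists_tgt {p : A ⟶ B} (hp : LiftsArrows p) (a : A) (β : B)
    (h : tgt β = p (src a)) : ∃ m, tgt m = src a ∧ p m = β := by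
  obtain ⟨m, h₁, h₂⟩ := hp a β⁻¹ (by simpa using h)
  exact ⟨m⁻¹, by simpa using h₁, by simp [h₂]⟩

section Lift

variable {T T' : InvGpd.{u}} {i : T ⟶ T'} {p : A ⟶ B} {f : T ⟶ A} {g : T' ⟶ B}

/-- Here `η` contracts the object `x` onto the image of `i`, and `k` lifts `g η`; the target of `k`
will be the value of the lift at `x`. The last clause makes this target a fixed point when `x` is
one. -/
theorem exists_cleavage_at (hi : IsTrivialCofibration i) (h₁ : LiftsArrows p)
    (h₂ : LiftsFixedPoints p) (sq : f ≫ p = i ≫ g) (x : T') (hx : src x = x) :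
    ∃ (η : T') (k : A), (∃ r, i r = src η ∧ tgt η = x ∧ src k = f r ∧ p k = g η) ∧
      (∀ t, i t = x → η = x ∧ k = f t) ∧
      (bar x = x → ∀ w, i w = η * bar η⁻¹ → k = f w * bar k) := by
  have inj := hi.injective
  have sq' := congr_hom sq
  simp only [comp_apply] at sq'
  have htx := tgt_eq_of_src_eq hx
  by_cases hr : x ∈ Set.range i
  · obtain ⟨t, rfl⟩ := hr
    have hst : src t = t := inj (by simpa using hx)
    refine ⟨i t, f t, ⟨t, hx.symm, htx, by rw [← map_src, hst], sq' t⟩,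
      fun t' ht' => ⟨rfl, by rw [inj ht']⟩, fun hb w hw => ?_⟩
    have hbt : bar t = t := inj (by simpa using hb)
    have : w = t := inj (by rw [hw]; grind)
    grind
  · obtain ⟨η, ⟨r, hr'⟩, hη⟩ := hi.essSurj x
    rw [hx] at hη
    have hsr : src r = r := inj (by simp [hr'])
    have base : ∃ k, src k = f r ∧ p k = g η := by
      obtain ⟨k, hk⟩ := h₁ (f r) (g η) (by rw [← map_src, ← map_src, hsr, ← hr', sq'])
      exact ⟨k, by rw [hk.1, ← map_src, hsr], hk.2⟩
    by_cases hb : bar x = x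
    · obtain ⟨w, hw⟩ : η * bar η⁻¹ ∈ Set.range i := hi.full _
        ⟨r, by grind⟩ ⟨bar r, by grind⟩
      have hsw : src w = r := inj (by grind)
      have hbw : bar w = w⁻¹ := inj (by grind)
      -- Since `x` is fixed, `w` satisfies `bar w = w⁻¹`, so `f w` is a homotopy fixed point, and `g
      -- η` joins its image to the fixed point `g x`.
      obtain ⟨k, hk, hk', hk''⟩ := h₂ (f w) (g η) (by rw [← map_bar, hbw, map_inv])
        (by rw [← map_src, ← map_src, hsw, sq', hr'])
        (by rw [sq', hw, ← map_bar, ← map_mul g (by simp [hη, hb])]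
            exact congrArg g (by simpa [hη, hb] using hη ▸ mul_tgt_self η))
      refine ⟨η, k, ⟨r, hr', hη, by rw [hk, ← map_src, hsw], hk'⟩,
        fun t ht => absurd ⟨t, ht⟩ hr, fun _ w' hw' => ?_⟩
      rw [inj (hw'.trans hw.symm), hk'']
    · obtain ⟨k, hk⟩ := base
      exact ⟨η, k, ⟨r, hr', hη, hk⟩, fun t ht => absurd ⟨t, ht⟩ hr, fun h => absurd h hb⟩

/-- The unordered pair of `x` and `bar x` depends only on the orbit, and `R` selects one of its
members. -/
theorem exists_orbit_representatives (T : InvGpd.{u}) :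
    ∃ R : T → T, (∀ x, R x = x ∨ R x = bar x) ∧ ∀ x, R (bar x) = R x := by
  refine ⟨fun x => (Quot.out s(x, bar x)).1, fun x => ?_, fun x => ?_⟩
  · have h : (Quot.out s(x, bar x)).1 ∈ s(x, bar x) := Sym2.out_fst_mem _
    simpa using h
  · simp only [bar_bar]
    rw [Sym2.eq_swap]

/-- The choices at orbit representatives are transported by `bar`. On a free orbit this makes `η
(bar x) = bar (η x)` and likewise for `k`, so `w` is an identity and the last clause is trivial. On
a fixed object it is the last clause of `exists_cleavage_at`. Full equivariance of `η` is impossible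
in general, as the image of `i` may contain no fixed point isomorphic to `x`. -/
theorem exists_cleavage (hi : IsTrivialCofibration i) (h₁ : LiftsArrows p)
    (h₂ : LiftsFixedPoints p) (sq : f ≫ p = i ≫ g) :
    ∃ (η : T' → T') (k : T' → A),
      (∀ x, src x = x →
        ∃ r, i r = src (η x) ∧ tgt (η x) = x ∧ src (k x) = f r ∧ p (k x) = g (η x)) ∧
      (∀ t, src t = t → η (i t) = i t ∧ k (i t) = f t) ∧
      (∀ x, src x = x → ∀ w, i w = η x * bar (η (bar x))⁻¹ → k x = f w * bar (k (bar x))) := by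
  classical
  have inj := hi.injective
  obtain ⟨R, hR, hR'⟩ := exists_orbit_representatives T'
  choose η k hG he hb using fun x => exists_cleavage_at hi h₁ h₂ sq (src x) (src_src x)
  replace hG : ∀ x, src x = x →
      ∃ r, i r = src (η x) ∧ tgt (η x) = x ∧ src (k x) = f r ∧ p (k x) = g (η x) := fun x hx => by
    have := hG x; rwa [hx] at this
  replace he : ∀ x, src x = x → ∀ t, i t = x → η x = x ∧ k x = f t := fun x hx => by
    have := he x; rwa [hx] at this
  replace hb : ∀ x, src x = x → bar x = x → ∀ w, i w = η x * bar (η x)⁻¹ →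
      k x = f w * bar (k x) := fun x hx => by
    have := hb x; rwa [hx] at this
  refine ⟨fun x => if R x = x then η x else bar (η (bar x)),
    fun x => if R x = x then k x else bar (k (bar x)), fun x hx => ?_, fun t ht => ?_,
    fun x hx w => ?_⟩
  · dsimp only
    split_ifs with h
    · exact hG x hx
    · obtain ⟨r, hr⟩ := hG (bar x) (by simp [hx])
      exact ⟨bar r, by grind⟩
  · dsimp only
    split_ifs with h
    · exact he (i t) (by grind) t rfl
    · have := he (bar (i t)) (by grind) (bar t) (by grind)
      grind
  · have hbx : src (bar x) = bar x := by simp [hx]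
    have hR1 := hR x
    have hR2 := hR' x
    have hb' := hb x hx
    obtain ⟨r, hr⟩ := hG x hx
    obtain ⟨r', hr'⟩ := hG (bar x) hbx
    dsimp only
    rw [hR2, bar_bar]
    by_cases h : R x = x
    · by_cases h' : bar x = x
      · simp only [h, h', if_true]
        exact hb' h' w
      · have h'' : x ≠ bar x := fun e => h' e.symm
        simp only [h, h'', if_true, if_false]
        intro hw
        have : w = r := inj (by grind)
        grind
    · have h' : R x = bar x := by tauto
      have h'' : bar x ≠ x := by rw [← h']; exact h
      simp only [h', h'', if_true, if_false]
      intro hw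
      have : w = bar r' := inj (by grind)
      grind

theorem exists_lift (hi : IsTrivialCofibration i) (h₁ : LiftsArrows p)
    (h₂ : LiftsFixedPoints p) (sq : f ≫ p = i ≫ g) :
    ∃ l : T' ⟶ A, i ≫ l = f ∧ l ≫ p = g := by
  have inj := hi.injective
  have sq' := congr_hom sq
  simp only [comp_apply] at sq'
  obtain ⟨η, k, hG, he, hb⟩ := exists_cleavage hi h₁ h₂ sq
  choose r hir htη hsk hpk using fun x => hG (src x) (src_src x)
  have hir₁ := fun x => hir (tgt x)
  have hir₂ := fun x => hir (bar x)
  have htη₁ := fun x => htη (tgt x)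
  have htη₂ := fun x => htη (bar x)
  have htη₃ := fun x => htη (tgt (bar x))
  simp only [src_tgt, src_bar, tgt_bar] at hir₁ hir₂ htη₁ htη₂ htη₃
  -- `W` is the retraction of `T'` onto `T` obtained by conjugating with `η`; `w` below measures its
  -- failure to be equivariant.
  have hW : ∀ x : T', ∃ w, i w = η (src x) * (x * (η (tgt x))⁻¹) := fun x =>
    hi.full _ ⟨r x, by simp [htη, htη₁, hir]⟩ ⟨r (tgt x), by simp [htη, htη₁, hir₁]⟩
  choose W hW using hW
  have hw : ∀ x, ∃ w, i w = η (src x) * bar (η (bar (src x)))⁻¹ := fun x =>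
    hi.full _ ⟨r x, by simp [htη, htη₂, hir]⟩ ⟨bar (r (bar x)), by simp [htη, htη₂, hir₂]⟩
  choose w hw using hw
  have hsW : ∀ x, src (W x) = r x := fun x => inj (by simp [hW, htη, htη₁, hir])
  have htW : ∀ x, tgt (W x) = r (tgt x) := fun x => inj (by simp [hW, htη, htη₁, hir₁])
  have hsfW : ∀ x, src (f (W x)) = f (r x) := fun x => by rw [← map_src, hsW]
  have htfW : ∀ x, tgt (f (W x)) = f (r (tgt x)) := fun x => by rw [← map_tgt, htW]
  have hsk₁ := fun x => hsk (tgt x)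
  simp only [src_tgt] at hsk₁
  have hrs : ∀ x, r (src x) = r x := fun x => inj (by simp [hir])
  have hWs : ∀ x, W (src x) = r x := fun x => inj (by simp [hW, htη, hir])
  have hWt : ∀ x, W (tgt x) = r (tgt x) := fun x => inj (by simp [hW, htη₁, hir₁])
  have hWm : ∀ x y, tgt x = src y → W (x * y) = W x * W y := fun x y h => inj (by
    rw [map_mul i (by rw [htW, hsW, h, hrs])]
    simp (maxDischargeDepth := 8) [hW, htη, htη₁, h])
  have hfk : ∀ x, f (r x) * k (src x) = k (src x) := fun x => by rw [← hsk, src_mul_self]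
  have hfk₁ : ∀ x, f (r (tgt x)) * k (tgt x) = k (tgt x) := fun x => by rw [← hsk₁, src_mul_self]
  have hsw : ∀ x, src (w x) = r x := fun x => inj (by simp [hw, htη, htη₂, hir])
  have htw : ∀ x, tgt (w x) = bar (r (bar x)) := fun x => inj (by simp [hw, htη, htη₂, hir₂])
  have htfw : ∀ x, tgt (f (w x)) = bar (f (r (bar x))) := fun x => by rw [← map_tgt, htw, map_bar]
  have hsfw : ∀ x, src (f (w x)) = f (r x) := fun x => by rw [← map_src, hsw]
  have hsk₂ := fun x => hsk (bar x)
  have hsk₃ := fun x => hsk (tgt (bar x))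
  simp only [src_tgt, src_bar, tgt_bar] at hsk₂ hsk₃
  have hwW : ∀ x, W (bar x) = (bar (w x))⁻¹ * (bar (W x) * bar (w (tgt x))) := fun x => inj (by
    have h₁ : tgt (W x) = src (w (tgt x)) := by rw [htW, hsw]
    have h₂ : src (w x) = src (W x) := by rw [hsw, hsW]
    simp (maxDischargeDepth := 8) [h₁, h₂, hW, hw, htη, htη₁, htη₂, htη₃])
  -- The defect `w` of `W` is also that of `k`, so the two cancel in the conjugate `k⁻¹ * (f W *
  -- k)`, which is therefore equivariant.
  have hk : ∀ x, bar (k (src x)) = bar (f (w x)) * k (bar (src x)) := fun x => by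
    conv_lhs => rw [hb _ (src_src x) _ (hw x)]
    simp [htfw, hsk₂]
  have hk₁ : ∀ x, bar (k (tgt x)) = bar (f (w (tgt x))) * k (bar (tgt x)) := fun x => by
    simpa using hk (tgt x)
  -- The lift retracts `x` to `T`, applies `f`, and undoes the retraction with the lifted
  -- deformation `k`.
  refine ⟨⟨fun x => (k (src x))⁻¹ * (f (W x) * k (tgt x)), fun x => ?_, fun x => ?_, fun x => ?_,
    fun x y h => ?_⟩, ?_, ?_⟩
  · simp (maxDischargeDepth := 8) [hWs, hsk, hsk₁, hsfW, htfW, hfk]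
  · simp (maxDischargeDepth := 8) [hWt, hsk, hsk₁, hsfW, htfW, hfk₁]
  · have h₁ : tgt (W x) = src (w (tgt x)) := by rw [htW, hsw]
    have h₂ : src (w x) = src (W x) := by rw [hsw, hsW]
    simp (maxDischargeDepth := 8) [hk, hk₁, hwW, h₁, h₂, hsk, hsk₁, hsk₂, hsk₃, hsfW, htfW, htfw,
      hsfw]
  · have hWc : tgt (W x) = src (W y) := by rw [htW, hsW, h, hrs]
    simp (maxDischargeDepth := 8) [hWm, hsk, hsk₁, hsfW, htfW, h, hrs, hWc]
  · ext t
    have h₁ := he (src t) (src_src t)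
    have h₂ := he (tgt t) (src_tgt t)
    rw [map_src] at h₁
    rw [map_tgt] at h₂
    have : W (i t) = t := inj (by simp [hW, h₁, h₂])
    simp [h₁, h₂, this]
  · ext x
    have hpk₁ := hpk (tgt x)
    rw [src_tgt] at hpk₁
    have e₁ : tgt (g (η (src x))) = g (src x) := by rw [← map_tgt, htη]
    have e₂ : tgt (g (η (tgt x))) = g (tgt x) := by rw [← map_tgt, htη₁]
    have e₃ : src (k (src x)) = src (f (W x)) := by rw [hsk, hsfW]
    have e₄ : tgt (f (W x)) = src (k (tgt x)) := by rw [hsk₁, htfW]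
    simp only [map_src, map_tgt] at e₁ e₂
    simp (maxDischargeDepth := 8) [hpk, hpk₁, e₃, e₄, sq', hW, htη, htη₁, e₁, e₂]

theorem fibrations_of_lifts (h₁ : LiftsArrows p) (h₂ : LiftsFixedPoints p) : fibrations p :=
  fun _ _ _ hi => ⟨fun {_ _} sq => by
    obtain ⟨l, hl, hl'⟩ := exists_lift hi h₁ h₂ sq.w
    exact ⟨⟨⟨l, hl, hl'⟩⟩⟩⟩

end Lift

end InvGpd

/-! ### Factorization, and stability of trivial cofibrations -/

namespace InvGpd

variable {A B C : InvGpd.{u}}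

section Factorization

/-! The factorization of `f : A ⟶ B` through the groupoid of the pairs `(φ, h)` of an arrow `φ` of
`A` and an arrow `h` of `B` whose source is the image of the source of `φ`. -/

variable (f : A ⟶ B)

@[ext]
structure PathObject : Type u where
  φ : A
  h : B
  src_h : src h = f (src φ)

attribute [simp] PathObject.src_h

variable {f} in
-- An arrow `φ : a ⟶ a'` is a functor to `A` from the contractible groupoid on two objects. The
-- involution swaps these two and acts on `A`, so `φ` is fixed exactly when it is a homotopy fixed
-- point. The path `h` starts at `f a` and is moved along `f φ` to start at `f a'` before `bar` is
-- applied.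
@[simps]
def PathObject.bar (o : PathObject f) : PathObject f where
  φ := InvolutiveGroupoid.bar o.φ⁻¹
  h := InvolutiveGroupoid.bar ((f o.φ)⁻¹ * o.h)
  src_h := by simp

-- A morphism from `φ` to `φ'` is a commutative square in `A`; only its component `m` on sources is
-- stored, as the other one is `φ⁻¹ * (m * φ')`.
@[ext]
structure PathArrow : Type u where
  o : PathObject f
  m : A
  o' : PathObject f
  src_m : src m = src o.φ
  tgt_m : tgt m = src o'.φ

attribute [simp] PathArrow.src_m PathArrow.tgt_m

variable {f} in
@[simp] theorem PathArrow.src_map_m (x : PathArrow f) : src (f x.m) = src (f x.o.φ) := by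
  rw [← map_src, x.src_m, map_src]

variable {f} in
@[simp] theorem PathArrow.tgt_map_m (x : PathArrow f) : tgt (f x.m) = src (f x.o'.φ) := by
  rw [← map_tgt, x.tgt_m, map_src]

variable {f} in
theorem PathArrow.composable {x y : PathArrow f}
    (h : (⟨x.o', src x.o'.φ, x.o', by simp, by simp⟩ : PathArrow f) =
      ⟨y.o, src y.o.φ, y.o, by simp, by simp⟩) : x.o' = y.o := by
  injection h

noncomputable instance : InvolutiveGroupoid (PathArrow f) :=
  ofPartial
    (src := fun x => ⟨x.o, src x.o.φ, x.o, by simp, by simp⟩)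
    (tgt := fun x => ⟨x.o', src x.o'.φ, x.o', by simp, by simp⟩)
    (bar := fun x => ⟨x.o.bar, bar (x.o.φ⁻¹ * (x.m * x.o'.φ)), x.o'.bar, by simp, by simp⟩)
    (inv := fun x => ⟨x.o', x.m⁻¹, x.o, by simp, by simp⟩)
    (comp := fun x y h => ⟨x.o, x.m * y.m, y.o', by simp [PathArrow.composable h],
      by simp [PathArrow.composable h]⟩)
    (src_src := fun _ => rfl) (src_tgt := fun _ => rfl)
    (tgt_src := fun _ => rfl) (tgt_tgt := fun _ => rfl)
    (src_comp := fun x y h => rfl)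
    (tgt_comp := fun x y h => rfl)
    (comp_assoc := fun x y z h h' => by
      ext <;> simp [PathArrow.composable h, PathArrow.composable h'])
    (src_comp_self := fun _ => by ext <;> simp) (comp_tgt_self := fun _ => by ext <;> simp)
    (src_inv := fun _ => rfl) (tgt_inv := fun _ => rfl)
    (comp_inv_self := fun _ => by ext <;> simp) (inv_comp_self := fun _ => by ext <;> simp)
    (bar_bar := fun _ => by ext <;> simp)
    (src_bar := fun _ => by ext <;> simp) (tgt_bar := fun _ => by ext <;> simp)
    (bar_comp := fun x y h => by

      ext <;> simp (maxDischargeDepth := 8) [PathArrow.composable h])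

noncomputable abbrev pathSpace : InvGpd.{u} := ⟨PathArrow f⟩

variable {f}

@[simp] theorem pathSpace_src (x : PathArrow f) : src x = ⟨x.o, src x.o.φ, x.o, by simp, by simp⟩ :=
  rfl

@[simp] theorem pathSpace_tgt (x : PathArrow f) :
    tgt x = ⟨x.o', src x.o'.φ, x.o', by simp, by simp⟩ := rfl

@[simp] theorem pathSpace_bar (x : PathArrow f) :
    bar x = ⟨x.o.bar, bar (x.o.φ⁻¹ * (x.m * x.o'.φ)), x.o'.bar, by simp, by simp⟩ := rfl

theorem pathSpace_mul {x y : PathArrow f} (h : tgt x = src y) :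
    x * y = ⟨x.o, x.m * y.m, y.o', by simp [PathArrow.composable h],
      by simp [PathArrow.composable h]⟩ :=
  dif_pos h

variable (f)

noncomputable def pathInclusion : A ⟶ pathSpace f :=
  Hom.mk (B := pathSpace f)
    (fun a => ⟨⟨src a, src (f a), by simp⟩, a, ⟨tgt a, tgt (f a), by simp⟩, by simp, by simp⟩)
    (fun a => PathArrow.ext (by simp) (by simp) (by simp))
    (fun a => PathArrow.ext (by simp) (by simp) (by simp))
    (fun a => PathArrow.ext (by ext <;> simp) (by simp) (by ext <;> simp))
    (fun a b h => by
      rw [pathSpace_mul (by simp [h, ← map_src, ← map_tgt])]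
      exact PathArrow.ext (by simp [h, ← map_src, ← map_tgt]) (by simp)
        (by simp [h, ← map_src, ← map_tgt]))

noncomputable def pathProjection : pathSpace f ⟶ B :=
  Hom.mk (A := pathSpace f) (fun x => x.o.h⁻¹ * (f x.m * x.o'.h))
    (fun x => by simp)
    (fun x => by simp)
    (fun x => by simp (maxDischargeDepth := 8))
    (fun x y h => by
      have h' := PathArrow.composable h
      rw [pathSpace_mul h]
      simp (maxDischargeDepth := 8) [h'])

theorem pathInclusion_comp_pathProjection : pathInclusion f ≫ pathProjection f = f := by
  ext a
  simp [pathInclusion, pathProjection]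

theorem isTrivialCofibration_pathInclusion : IsTrivialCofibration (pathInclusion f) where
  injective a b h := congrArg PathArrow.m h
  full := by
    rintro y ⟨a, ha⟩ ⟨b, hb⟩
    have ha' : y.o = ⟨src a, src (f a), by simp⟩ := (congrArg PathArrow.o ha).symm
    have hb' : y.o' = ⟨src b, src (f b), by simp⟩ := (congrArg PathArrow.o hb).symm
    have h₁ : src y.m = src a := by rw [y.src_m, ha', src_src]
    have h₂ : tgt y.m = src b := by rw [y.tgt_m, hb', src_src]
    refine ⟨y.m, PathArrow.ext (Eq.trans ?_ ha'.symm) rfl (Eq.trans ?_ hb'.symm)⟩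
    · exact PathObject.ext h₁ ((map_src f _).symm.trans ((congrArg f h₁).trans (map_src f a)))
    · exact PathObject.ext h₂ ((map_tgt f _).symm.trans ((congrArg f h₂).trans (map_src f b)))
  essSurj y := ⟨(⟨⟨src y.o.φ, src (f y.o.φ), by simp⟩, src y.o.φ, y.o, by simp, by simp⟩ :
    PathArrow f), ⟨src y.o.φ, PathArrow.ext (by ext <;> simp [pathInclusion])
      (by simp [pathInclusion]) (by ext <;> simp [pathInclusion])⟩, rfl⟩

theorem liftsArrows_pathProjection : LiftsArrows (pathProjection f) := by
  intro x β h
  have h' : src β = tgt x.o.h := by simpa [pathProjection] using h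
  -- The path `h` is extended by `β`, and nothing moves in `A`.
  refine ⟨(⟨x.o, src x.o.φ, ⟨x.o.φ, x.o.h * β, by simp [h']⟩, by simp, by simp⟩ : PathArrow f),
    by simp, ?_⟩
  simp [pathProjection, h']

/-- With `φ : a ⟶ a'` and `θ.m : a ⟶ bar a'`, the arrow `φ * (bar θ.m)⁻¹` goes from `a` to `bar a`.
By `key` it is a homotopy fixed point of `A`, hence the first component of a strict fixed point of
the path space. -/
theorem liftsFixedPoints_pathProjection : LiftsFixedPoints (pathProjection f) := by
  intro (θ : PathArrow f) β hθ h hβ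
  have hβ₁ : src β = tgt θ.o.h := by simpa [pathProjection] using h
  have ho : θ.o' = θ.o.bar := (congrArg PathArrow.o hθ).symm
  have hm : bar (θ.o.φ⁻¹ * (θ.m * θ.o'.φ)) = θ.m⁻¹ := congrArg PathArrow.m hθ
  have hβ₂ : θ.o.h⁻¹ * (f θ.m * θ.o'.h) * bar β = β := hβ
  have htm : tgt θ.m = bar (tgt θ.o.φ) := by simp [ho]
  have htm' : tgt (f θ.m) = bar (tgt (f θ.o.φ)) := by simp [ho]
  have key : θ.o.φ * (bar θ.m)⁻¹ = θ.m * (bar θ.o.φ)⁻¹ := by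
    rw [← bar_inv, ← hm]
    simp (maxDischargeDepth := 8) [ho, htm]
  have hsβ : src (θ.o.h * β) = f (src (θ.o.φ * (bar θ.m)⁻¹)) := by simp [hβ₁, htm]
  have hβ₃ : θ.o.h * β = f θ.m * ((bar (f θ.o.φ))⁻¹ * (bar θ.o.h * bar β)) := by
    conv_lhs => rw [← hβ₂]
    simp (maxDischargeDepth := 8) [ho, htm', hβ₁]
  -- The path component of the new object is fixed as well, because `β` is compatible with the image
  -- of `θ`.
  have hfix : bar ((f (θ.o.φ * (bar θ.m)⁻¹))⁻¹ * (θ.o.h * β)) = θ.o.h * β := by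
    rw [key]
    conv_rhs => rw [hβ₃]
    simp (maxDischargeDepth := 8) [hβ₃, htm, htm', hβ₁]
  refine ⟨(⟨θ.o, src θ.o.φ, ⟨θ.o.φ * (bar θ.m)⁻¹, θ.o.h * β, hsβ⟩, by simp, by simp [htm]⟩ :
    PathArrow f), rfl, by simp [pathProjection, hβ₁], ?_⟩
  refine (pathSpace_mul ?_).trans ?_
  · simp [ho]
  · refine PathArrow.ext rfl ?_ (PathObject.ext ?_ hfix)
    · simp [htm]
    · change bar (θ.o.φ * (bar θ.m)⁻¹)⁻¹ = θ.o.φ * (bar θ.m)⁻¹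
      rw [key]
      simp [htm, ← key]

theorem fibrations_pathProjection : fibrations (pathProjection f) :=
  fibrations_of_lifts (liftsArrows_pathProjection f) (liftsFixedPoints_pathProjection f)

/-- The injective fibrations are isofibrations. -/
theorem liftsArrows_of_fibrations {p : A ⟶ B} (hp : fibrations p) : LiftsArrows p := by
  have := hp _ (isTrivialCofibration_pathInclusion p)
  -- A lift in this square exhibits `p` as a retract of its path fibration, where arrows lift.
  have sq : CommSq (𝟙 A) (pathInclusion p) p (pathProjection p) :=
    ⟨by rw [pathInclusion_comp_pathProjection, Category.id_comp]⟩
  intro a β h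
  obtain ⟨m, hm, hm'⟩ := liftsArrows_pathProjection p (pathInclusion p a) β
    (by rw [h, ← map_src, ← comp_apply, pathInclusion_comp_pathProjection, map_src])
  refine ⟨sq.lift m, ?_, ?_⟩
  · rw [← map_src, hm, map_src, ← comp_apply, sq.fac_left, id_apply]
  · rw [← comp_apply, sq.fac_right, hm']

end Factorization

section Properties

/-- A retract argument. -/
theorem IsTrivialCofibration.of_comp {E : InvGpd.{u}} {i : A ⟶ B} {j : A ⟶ E}
    (hj : IsTrivialCofibration j) {l : B ⟶ E} {p : E ⟶ B} (h₁ : i ≫ l = j) (h₂ : j ≫ p = i)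
    (h₃ : l ≫ p = 𝟙 B) : IsTrivialCofibration i := by
  replace h₁ := congr_hom h₁
  replace h₂ := congr_hom h₂
  replace h₃ := congr_hom h₃
  simp only [comp_apply, id_apply] at h₁ h₂ h₃
  refine ⟨fun a b h => hj.injective (by rw [← h₁, h, h₁]), ?_, fun y => ?_⟩
  · rintro y ⟨a, ha⟩ ⟨b, hb⟩
    obtain ⟨z, hz⟩ := hj.full (l y) ⟨a, by rw [← h₁, ha, map_src]⟩ ⟨b, by rw [← h₁, hb, map_tgt]⟩
    exact ⟨z, by rw [← h₂, hz, h₃]⟩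
  · obtain ⟨x, ⟨a, ha⟩, hx⟩ := hj.essSurj (l y)
    exact ⟨p x, ⟨a, by rw [← h₂, ha, map_src]⟩, by rw [← map_tgt, hx, map_src, h₃]⟩

theorem mem_range_of_isPullback {T T' S S' : InvGpd.{u}} {j : S ⟶ S'} {i : T ⟶ T'}
    {a : S ⟶ T} {b : S' ⟶ T'} (sq : IsPullback j a b i) {y : S'} :
    y ∈ Set.range j ↔ b y ∈ Set.range i := by
  constructor
  · rintro ⟨x, rfl⟩
    exact ⟨a x, (congr_hom sq.w x).symm⟩
  · rintro ⟨x, hx⟩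
    obtain ⟨z, hz, -⟩ := existsUnique_of_isPullback sq hx.symm
    exact ⟨z, hz.1⟩

theorem IsTrivialCofibration.injective_of_isPullback {T T' S S' : InvGpd.{u}} {j : S ⟶ S'}
    {i : T ⟶ T'} {a : S ⟶ T} {b : S' ⟶ T'} (hi : IsTrivialCofibration i)
    (sq : IsPullback j a b i) : Function.Injective j := fun x y h => by
  have w := congr_hom sq.w
  simp only [comp_apply] at w
  exact (existsUnique_of_isPullback sq (w x)).unique ⟨rfl, rfl⟩
    ⟨h.symm, hi.injective (by rw [← w, ← w, h])⟩

theorem IsTrivialCofibration.full_of_isPullback {T T' S S' : InvGpd.{u}} {j : S ⟶ S'}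
    {i : T ⟶ T'} {a : S ⟶ T} {b : S' ⟶ T'} (hi : IsTrivialCofibration i)
    (sq : IsPullback j a b i) (y : S') (h : src y ∈ Set.range j) (h' : tgt y ∈ Set.range j) :
    y ∈ Set.range j := by
  rw [mem_range_of_isPullback sq] at *
  rw [map_src] at h
  rw [map_tgt] at h'
  exact hi.full _ h h'

/-- Trivial cofibrations are stable under pullback along isofibrations. -/
theorem IsTrivialCofibration.of_isPullback {T T' S S' : InvGpd.{u}} {j : S ⟶ S'} {i : T ⟶ T'}
    {a : S ⟶ T} {b : S' ⟶ T'} (hi : IsTrivialCofibration i) (hb : LiftsArrows b)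
    (sq : IsPullback j a b i) : IsTrivialCofibration j := by
  refine ⟨hi.injective_of_isPullback sq, hi.full_of_isPullback sq, fun y => ?_⟩
  obtain ⟨x, hx, hx'⟩ := hi.essSurj (b y)
  obtain ⟨m, hm, hm'⟩ := hb.exists_tgt y x (by rw [hx', map_src])
  exact ⟨m, by rwa [mem_range_of_isPullback sq, map_src, hm'], hm⟩

/-- Trivial cofibrations between isofibrations over a base are stable under pullback along any
morphism of bases. -/
theorem IsTrivialCofibration.of_isPullback_of_isPullback {X Y Z S : InvGpd.{u}} {j : X ⟶ Y}
    {k : Y ⟶ Z} {a : X ⟶ A} {b : Y ⟶ B} {c : Z ⟶ S} {i : A ⟶ B} {p : B ⟶ S}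
    (hi : IsTrivialCofibration i) (hp : LiftsArrows (i ≫ p)) (sq : IsPullback j a b i)
    (sq' : IsPullback k b c p) : IsTrivialCofibration j := by
  refine ⟨hi.injective_of_isPullback sq, hi.full_of_isPullback sq, fun y => ?_⟩
  have w := congr_hom sq'.w
  simp only [comp_apply] at w
  obtain ⟨x, ⟨t, ht⟩, hx⟩ := hi.essSurj (b y)
  have hsx : i (src t) = src x := by rw [map_src, ht, src_src]
  -- The arrow `x` joins the image of `i` to `b (src y)`, but `p x` need not come from `Z`. Lifting
  -- `p x` to `A` and dividing by the result leaves the vertical arrow `(i m)⁻¹ * x`, which does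
  -- come from `Y`.
  obtain ⟨m, hm, hm'⟩ := hp t (p x) (by rw [comp_apply, hsx, map_src])
  rw [comp_apply] at hm'
  have hxm : src x = src (i m) := by rw [← hsx, ← hm, map_src]
  have h : p ((i m)⁻¹ * x) = p (b (src y)) := by
    rw [map_mul _ (by rw [tgt_inv, hxm]), map_inv, hm', inv_mul_self, ← map_tgt, hx, map_src b]
  obtain ⟨z, ⟨hz, hz'⟩, -⟩ := existsUnique_of_isPullback sq' ((w (src y)).trans h.symm)
  refine ⟨z, ?_, ?_⟩
  · rw [mem_range_of_isPullback sq, map_src, hz', src_mul _ _ (by rw [tgt_inv, hxm]), src_inv,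
      ← map_tgt]
    exact ⟨_, rfl⟩
  · refine (existsUnique_of_isPullback sq' (w (src y))).unique ⟨?_, ?_⟩ ⟨rfl, rfl⟩
    · rw [map_tgt, hz, map_src, tgt_src]
    · rw [map_tgt, hz', tgt_mul _ _ (by rw [tgt_inv, hxm]), hx, map_src]

end Properties

end InvGpd

/-! ### The groupoid of sections -/

namespace InvGpd

variable {A B X : InvGpd.{u}}

/-- The arrows of the dependent product of `f : X ⟶ A` along `g : A ⟶ B`: an arrow above `β : B` is
a functorial section of `f` on the arrows above `β`, given by its image. -/
@[ext]
structure SectionArrow (g : A ⟶ B) (f : X ⟶ A) : Type u where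
  base : B
  carrier : Set X
  map_eq : ∀ x ∈ carrier, g (f x) = base
  exists_mem : ∀ e, g e = base → ∃ x ∈ carrier, f x = e
  inj : ∀ x ∈ carrier, ∀ y ∈ carrier, f x = f y → x = y
  src_eq : ∀ x ∈ carrier, ∀ y ∈ carrier, src (f x) = src (f y) → src x = src y
  tgt_eq : ∀ x ∈ carrier, ∀ y ∈ carrier, tgt (f x) = tgt (f y) → tgt x = tgt y
  -- Functoriality is expressed by closure under the ternary operation `x * (y⁻¹ * z)`, which stays
  -- above `base`. The sections above the source and the target need not be stored: they consist of
  -- the quotients `x * y⁻¹` and `x⁻¹ * y`.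
  mul_inv_mul_mem : ∀ x ∈ carrier, ∀ y ∈ carrier, ∀ z ∈ carrier, tgt x = tgt y → src y = src z →
    x * (y⁻¹ * z) ∈ carrier

namespace SectionArrow

variable {g : A ⟶ B} {f : X ⟶ A}

/-- Both carriers are graphs of functions on the same set, the arrows above `base`, so one inclusion
is enough. -/
theorem eq_of_subset {P Q : SectionArrow g f} (h : P.base = Q.base)
    (h' : ∀ x ∈ P.carrier, x ∈ Q.carrier) : P = Q := by
  refine SectionArrow.ext h (Set.Subset.antisymm h' fun x hx => ?_)
  obtain ⟨y, hy, hy'⟩ := P.exists_mem (f x) ((Q.map_eq x hx).trans h.symm)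
  rwa [Q.inj x hx y (h' y hy) hy'.symm]

@[simps]
def bar (P : SectionArrow g f) : SectionArrow g f where
  base := InvolutiveGroupoid.bar P.base
  carrier := {x | InvolutiveGroupoid.bar x ∈ P.carrier}
  map_eq x hx := by
    rw [← P.map_eq _ hx]
    simp
  exists_mem e he := by
    obtain ⟨x, hx, hx'⟩ := P.exists_mem (InvolutiveGroupoid.bar e) (by simp [he])
    exact ⟨InvolutiveGroupoid.bar x, by simpa using hx, by simp [hx']⟩
  inj x hx y hy h := bar_injective (P.inj _ hx _ hy (by simp [h]))
  src_eq x hx y hy h := by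
    have := P.src_eq _ hx _ hy (by simpa using congrArg InvolutiveGroupoid.bar h)
    simpa using congrArg InvolutiveGroupoid.bar this
  tgt_eq x hx y hy h := by
    have := P.tgt_eq _ hx _ hy (by simpa using congrArg InvolutiveGroupoid.bar h)
    simpa using congrArg InvolutiveGroupoid.bar this
  mul_inv_mul_mem x hx y hy z hz h h' := by
    have := P.mul_inv_mul_mem _ hx _ hy _ hz (by simp [h]) (by simp [h'])
    simpa [h, h'] using this

@[simps]
def inv (P : SectionArrow g f) : SectionArrow g f where
  base := P.base⁻¹
  carrier := {x | x⁻¹ ∈ P.carrier}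
  map_eq x hx := by
    rw [← P.map_eq _ hx]
    simp
  exists_mem e he := by
    obtain ⟨x, hx, hx'⟩ := P.exists_mem e⁻¹ (by simp [he])
    exact ⟨x⁻¹, by simpa using hx, by simp [hx']⟩
  inj x hx y hy h := by
    rw [← inverse_inverse x, P.inj _ hx _ hy (by simp [h]), inverse_inverse]
  src_eq x hx y hy h := by simpa using P.tgt_eq _ hx _ hy (by simpa using h)
  tgt_eq x hx y hy h := by simpa using P.src_eq _ hx _ hy (by simpa using h)
  mul_inv_mul_mem x hx y hy z hz h h' := by
    have := P.mul_inv_mul_mem _ hz _ hy _ hx (by simp [h']) (by simp [h])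
    simpa [h, h'] using this

theorem exists_mem_src (hg : LiftsArrows g) (P : SectionArrow g f) (a : A)
    (h : g (src a) = src P.base) : ∃ x ∈ P.carrier, src (f x) = src a := by
  obtain ⟨m, hm, hm'⟩ := hg a P.base (by simpa using h.symm)
  obtain ⟨x, hx, hx'⟩ := P.exists_mem m hm'
  exact ⟨x, hx, hx' ▸ hm⟩

theorem exists_mem_tgt (hg : LiftsArrows g) (P : SectionArrow g f) (a : A)
    (h : g (src a) = tgt P.base) : ∃ x ∈ P.carrier, tgt (f x) = src a := by
  obtain ⟨x, hx, hx'⟩ := P.inv.exists_mem_src hg a (by simpa using h)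
  exact ⟨x⁻¹, hx, by simpa using hx'⟩

-- That `g` is an isofibration is what makes the quotients reach every arrow `e` above the source:
-- an arrow above `base` starting at the target of `e` is needed to write `e` as a quotient.
@[simps]
def src (hg : LiftsArrows g) (P : SectionArrow g f) : SectionArrow g f where
  base := InvolutiveGroupoid.src P.base
  carrier := {w | ∃ x ∈ P.carrier, ∃ y ∈ P.carrier, tgt x = tgt y ∧ x * y⁻¹ = w}
  map_eq := by
    rintro _ ⟨x, hx, y, hy, h, rfl⟩
    have h' : tgt x = InvolutiveGroupoid.src y⁻¹ := by simpa using h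
    rw [map_mul f h', map_mul g (map_composable f h'), P.map_eq x hx, map_inv, map_inv,
      P.map_eq y hy, mul_inv_self]
  exists_mem e he := by
    obtain ⟨y, hy, hy'⟩ := P.exists_mem_src hg e⁻¹ (by simpa using congrArg tgt he)
    have hy₁ : InvolutiveGroupoid.src (f y) = tgt e := by simpa using hy'
    have hgy := P.map_eq y hy
    obtain ⟨x, hx, hx'⟩ := P.exists_mem (e * f y) (by
      rw [map_mul g hy₁.symm, he, hgy, src_mul_self])
    have ht : tgt x = tgt y := P.tgt_eq x hx y hy (by rw [hx', tgt_mul _ _ hy₁.symm])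
    refine ⟨_, ⟨x, hx, y, hy, ht, rfl⟩, ?_⟩
    rw [map_mul f (by simpa using ht), hx', map_inv, mul_mul_inv hy₁.symm]
  inj := by
    rintro _ ⟨x, hx, y, hy, h, rfl⟩ _ ⟨z, hz, w, hw, h', rfl⟩ e
    have h₁ : tgt (f x) = tgt (f y) := by rw [← map_tgt, h, map_tgt]
    have h₂ : tgt (f z) = tgt (f w) := by rw [← map_tgt, h', map_tgt]
    rw [map_mul f (by simpa using h), map_mul f (by simpa using h')] at e
    have hyw : InvolutiveGroupoid.src y = InvolutiveGroupoid.src w := P.src_eq y hy w hw (by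
      simpa [h₁, h₂] using congrArg tgt e)
    have h₃ : InvolutiveGroupoid.src (f y) = InvolutiveGroupoid.src (f w) := by
      rw [← map_src, hyw, map_src]
    have : x * (y⁻¹ * w) = z := P.inj _ (P.mul_inv_mul_mem x hx y hy w hw h hyw) z hz (by
      have e' := congrArg (· * f w) e
      simpa (maxDischargeDepth := 8) [h, hyw, h₁, h₂, h₃] using e')
    rw [← this]
    simp (maxDischargeDepth := 8) [h, hyw]
  src_eq := by
    rintro _ ⟨x, hx, y, hy, h, rfl⟩ _ ⟨z, hz, w, hw, h', rfl⟩ e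
    rw [← map_src, ← map_src] at e
    simp only [src_mul _ y⁻¹ (h.trans (src_inv y).symm), src_mul _ w⁻¹ (h'.trans (src_inv w).symm)]
      at e ⊢
    exact P.src_eq x hx z hz (by simpa using e)
  tgt_eq := by
    rintro _ ⟨x, hx, y, hy, h, rfl⟩ _ ⟨z, hz, w, hw, h', rfl⟩ e
    rw [← map_tgt, ← map_tgt] at e
    simp only [tgt_mul _ y⁻¹ (h.trans (src_inv y).symm), tgt_mul _ w⁻¹ (h'.trans (src_inv w).symm),
      tgt_inv] at e ⊢
    exact P.src_eq y hy w hw (by simpa using e)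
  mul_inv_mul_mem := by
    rintro _ ⟨x₁, hx₁, y₁, hy₁, h₁, rfl⟩ _ ⟨x₂, hx₂, y₂, hy₂, h₂, rfl⟩ _ ⟨x₃, hx₃, y₃, hy₃, h₃, rfl⟩
      e e'
    have e₁ : InvolutiveGroupoid.src y₁ = InvolutiveGroupoid.src y₂ := by simpa [h₁, h₂] using e
    have e₂ : InvolutiveGroupoid.src x₂ = InvolutiveGroupoid.src x₃ := by simpa [h₂, h₃] using e'
    refine ⟨_, P.mul_inv_mul_mem x₁ hx₁ y₁ hy₁ y₂ hy₂ h₁ e₁, _,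
      P.mul_inv_mul_mem y₃ hy₃ x₃ hx₃ x₂ hx₂ h₃.symm e₂.symm, ?_, ?_⟩
    · simp [h₁, h₂, h₃, e₁, e₂]
    · simp (maxDischargeDepth := 8) [h₁, h₂, h₃, e₁, e₂]

theorem src_mem (hg : LiftsArrows g) (P : SectionArrow g f) {x : X} (hx : x ∈ P.carrier) :
    InvolutiveGroupoid.src x ∈ (P.src hg).carrier :=
  ⟨x, hx, x, hx, rfl, by simp⟩

theorem tgt_mem (hg : LiftsArrows g) (P : SectionArrow g f) {x : X} (hx : x ∈ P.carrier) :
    tgt x ∈ (P.inv.src hg).carrier := by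
  rw [← src_inv]
  exact src_mem hg _ (by simpa using hx)

variable {hg : LiftsArrows g} {P Q : SectionArrow g f}

theorem base_composable (h : P.inv.src hg = Q.src hg) :
    tgt P.base = InvolutiveGroupoid.src Q.base := by
  simpa using congrArg base h

/-- Both endpoints belong to the section shared by `P` and `Q`, which is injective over `A`. -/
theorem composable (h : P.inv.src hg = Q.src hg) {x y : X} (hx : x ∈ P.carrier)
    (hy : y ∈ Q.carrier) (e : tgt (f x) = InvolutiveGroupoid.src (f y)) :
    tgt x = InvolutiveGroupoid.src y :=
  (Q.src hg).inj _ (h ▸ tgt_mem hg P hx) _ (src_mem hg Q hy) (by simpa using e)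

/-- The quotient `x⁻¹ * x'` lies in the shared section, hence is also a quotient `u * v⁻¹` of
elements of `Q`, and `Q` is closed under the ternary operation. This makes composites independent of
the chosen factorization. -/
theorem inv_mul_mul_mem (h : P.inv.src hg = Q.src hg) {x x' y : X} (hx : x ∈ P.carrier)
    (hx' : x' ∈ P.carrier) (hy : y ∈ Q.carrier)
    (e : InvolutiveGroupoid.src x = InvolutiveGroupoid.src x')
    (e' : tgt x' = InvolutiveGroupoid.src y) : x⁻¹ * (x' * y) ∈ Q.carrier := by
  have : x⁻¹ * x' ∈ (Q.src hg).carrier := h ▸ ⟨x⁻¹, by simpa using hx, x'⁻¹, by simpa using hx',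
    by simpa using e, by simp⟩
  obtain ⟨u, hu, v, hv, huv, e''⟩ := this
  have hv' : InvolutiveGroupoid.src v = InvolutiveGroupoid.src y := by
    have := congrArg tgt e''
    simpa [huv, e, e'] using this
  have := Q.mul_inv_mul_mem u hu v hv y hy huv hv'
  rwa [← comp_assoc _ _ _ (by simpa using huv) (by simpa using hv'), e'',
    comp_assoc _ _ _ (by simpa using e) e'] at this

@[simps]
def comp (hg : LiftsArrows g) (P Q : SectionArrow g f) (h : P.inv.src hg = Q.src hg) :
    SectionArrow g f where
  base := P.base * Q.base
  carrier := {w | ∃ x ∈ P.carrier, ∃ y ∈ Q.carrier, tgt x = InvolutiveGroupoid.src y ∧ x * y = w}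
  map_eq := by
    rintro _ ⟨x, hx, y, hy, e, rfl⟩
    rw [map_mul f e, map_mul g (map_composable f e), P.map_eq x hx, Q.map_eq y hy]
  exists_mem e he := by
    have hb := base_composable h
    obtain ⟨m, hm, hm'⟩ := hg e P.base (by rw [map_src, he, src_mul _ _ hb])
    obtain ⟨x, hx, rfl⟩ := P.exists_mem m hm'
    obtain ⟨y, hy, hy'⟩ := Q.exists_mem ((f x)⁻¹ * e) (by
      rw [map_mul g (by simpa using hm), map_inv, hm', he, inv_mul_mul hb])
    have hxy := composable h hx hy (by simp [hy', hm])
    exact ⟨_, ⟨x, hx, y, hy, hxy, rfl⟩, by rw [map_mul f hxy, hy', mul_inv_mul hm]⟩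
  inj := by
    rintro _ ⟨x, hx, y, hy, e₁, rfl⟩ _ ⟨x', hx', y', hy', e₂, rfl⟩ e
    have h₁ := map_composable f e₁
    have h₂ := map_composable f e₂
    rw [map_mul f e₁, map_mul f e₂] at e
    have h₃ : InvolutiveGroupoid.src (f x) = InvolutiveGroupoid.src (f x') := by
      simpa [h₁, h₂] using congrArg InvolutiveGroupoid.src e
    have h₄ := P.src_eq x hx x' hx' h₃
    have : y = x⁻¹ * (x' * y') := Q.inj y hy _ (inv_mul_mul_mem h hx hx' hy' h₄ e₂) (by
      rw [map_mul f (by simp [e₂, h₄]), map_mul f e₂, ← e, map_inv, inv_mul_mul h₁])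
    rw [this, mul_inv_mul (by simp [e₂, h₄])]
  src_eq := by
    rintro _ ⟨x, hx, y, hy, e₁, rfl⟩ _ ⟨x', hx', y', hy', e₂, rfl⟩ e
    rw [← map_src, ← map_src, src_mul _ _ e₁, src_mul _ _ e₂] at e
    rw [src_mul _ _ e₁, src_mul _ _ e₂]
    exact P.src_eq x hx x' hx' (by simpa using e)
  tgt_eq := by
    rintro _ ⟨x, hx, y, hy, e₁, rfl⟩ _ ⟨x', hx', y', hy', e₂, rfl⟩ e
    rw [← map_tgt, ← map_tgt, tgt_mul _ _ e₁, tgt_mul _ _ e₂] at e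
    rw [tgt_mul _ _ e₁, tgt_mul _ _ e₂]
    exact Q.tgt_eq y hy y' hy' (by simpa using e)
  mul_inv_mul_mem := by
    rintro _ ⟨x₁, hx₁, y₁, hy₁, h₁, rfl⟩ _ ⟨x₂, hx₂, y₂, hy₂, h₂, rfl⟩ _ ⟨x₃, hx₃, y₃, hy₃, h₃, rfl⟩
      e e'
    have e₁ : tgt y₁ = tgt y₂ := by simpa [h₁, h₂] using e
    have e₂ : InvolutiveGroupoid.src x₂ = InvolutiveGroupoid.src x₃ := by simpa [h₂, h₃] using e'
    refine ⟨x₁, hx₁, _, Q.mul_inv_mul_mem y₁ hy₁ y₂ hy₂ _ (inv_mul_mul_mem h hx₂ hx₃ hy₃ e₂ h₃) e₁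
      ?_, ?_, ?_⟩
    · simp [h₂, h₃, e₂]
    · simp (maxDischargeDepth := 8) [h₁, h₂, h₃, e₁, e₂]
    · simp (maxDischargeDepth := 8) [h₁, h₂, h₃, e₁, e₂]

theorem inv_inverse (P : SectionArrow g f) : P.inv.inv = P := by ext <;> simp

theorem src_src (hg : LiftsArrows g) (P : SectionArrow g f) : (P.src hg).src hg = P.src hg := by
  refine (eq_of_subset (by simp) ?_).symm
  rintro _ ⟨x, hx, y, hy, h, rfl⟩
  exact ⟨_, ⟨x, hx, y, hy, h, rfl⟩, _, src_mem hg P hy, by simp [h], by simp [h]⟩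

theorem inv_src (hg : LiftsArrows g) (P : SectionArrow g f) : (P.src hg).inv = P.src hg := by
  refine eq_of_subset (by simp) ?_
  rintro w ⟨x, hx, y, hy, h, e⟩
  exact ⟨y, hy, x, hx, h.symm, by rw [← inverse_inverse w, ← e]; simp [h]⟩

theorem src_comp (h : P.inv.src hg = Q.src hg) : (P.comp hg Q h).src hg = P.src hg := by
  refine (eq_of_subset (by simp [base_composable h]) ?_).symm
  rintro _ ⟨x, hx, x', hx', e, rfl⟩
  -- Both factors are extended by the same `y`, which cancels in the quotient.
  obtain ⟨y, hy, hy'⟩ := Q.exists_mem_src hg (tgt (f x)) (by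
    simp [P.map_eq x hx, base_composable h])
  have h₁ := composable h hx hy (by simpa using hy'.symm)
  have h₂ : tgt x' = InvolutiveGroupoid.src y := e ▸ h₁
  exact ⟨_, ⟨x, hx, y, hy, h₁, rfl⟩, _, ⟨x', hx', y, hy, h₂, rfl⟩, by simp [h₁, h₂],
    by simp [h₁, h₂]⟩

theorem src_inv_comp (h : P.inv.src hg = Q.src hg) :
    (P.comp hg Q h).inv.src hg = Q.inv.src hg := by
  refine (eq_of_subset (by simp [base_composable h]) ?_).symm
  rintro _ ⟨y, hy, y', hy', e, rfl⟩
  obtain ⟨x, hx, hx'⟩ := P.exists_mem_tgt hg (tgt (f y)) (by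
    have := congrArg InvolutiveGroupoid.src (Q.map_eq _ hy)
    simp [base_composable h] at this ⊢
    exact this)
  have h₁ := composable h hx hy (by simpa using hx')
  have h₂ : tgt x = InvolutiveGroupoid.src y'⁻¹ := by rw [h₁]; simp [e]
  refine ⟨(x * y⁻¹)⁻¹, ⟨x, hx, _, hy, h₁, by simp⟩, (x * y'⁻¹)⁻¹, ⟨x, hx, _, hy', h₂, by simp⟩,
    ?_, ?_⟩ <;> simp at h₁ h₂ <;> simp [h₁, e]

variable (g f) in
@[reducible]
noncomputable def involutiveGroupoid (hg : LiftsArrows g) :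
    InvolutiveGroupoid (SectionArrow g f) :=
  ofPartial (src := src hg) (tgt := fun P => P.inv.src hg) (bar := bar) (inv := inv)
    (comp := comp hg)
    (src_src := src_src hg) (src_tgt := fun P => src_src hg _)
    (tgt_src := fun P => by rw [inv_src, src_src])
    (tgt_tgt := fun P => by rw [inv_src, src_src])
    (src_comp := fun _ _ h => src_comp h) (tgt_comp := fun _ _ h => src_inv_comp h)
    (comp_assoc := fun P Q S h h' => by
      refine eq_of_subset (by simp [base_composable h, base_composable h']) ?_
      rintro _ ⟨_, ⟨x, hx, y, hy, e, rfl⟩, z, hz, e', rfl⟩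
      rw [tgt_mul _ _ e] at e'
      exact ⟨x, hx, _, ⟨y, hy, z, hz, e', rfl⟩, by simp [e, e'], by simp [e, e']⟩)
    (src_comp_self := fun P => by
      symm
      exact eq_of_subset (by simp) fun x hx =>
      ⟨_, src_mem hg P hx, x, hx, by simp, by simp⟩)
    (comp_tgt_self := fun P => by
      symm
      exact eq_of_subset (by simp) fun x hx =>
      ⟨x, hx, _, tgt_mem hg P hx, by simp, by simp⟩)
    (src_inv := fun _ => rfl) (tgt_inv := fun P => by rw [inv_inverse])
    (comp_inv_self := fun P => by
      symm
      exact eq_of_subset (by simp) fun w ⟨x, hx, y, hy, e, e'⟩ =>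
      ⟨x, hx, y⁻¹, by simpa using hy, by simpa using e, e'⟩)
    (inv_comp_self := fun P => by
      symm
      exact eq_of_subset (by simp) fun w ⟨x, hx, y, hy, e, e'⟩ =>
      ⟨x, hx, y⁻¹, hy, by simpa using e, e'⟩)
    (bar_bar := fun P => by ext <;> simp)
    (src_bar := fun P => eq_of_subset (by simp) fun w ⟨x, hx, y, hy, e, e'⟩ =>
      ⟨_, hx, _, hy, by simp [e], by rw [← e']; simp [e]⟩)
    (tgt_bar := fun P => eq_of_subset (by simp) fun w ⟨x, hx, y, hy, e, e'⟩ =>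
      ⟨InvolutiveGroupoid.bar x, by simpa using hx, InvolutiveGroupoid.bar y, by simpa using hy,
        by simp [e], by rw [← e']; simp [e]⟩)
    (bar_comp := fun P Q h => by
      symm
      refine eq_of_subset (by simp [base_composable h]) ?_
      rintro w ⟨x, hx, y, hy, e, e'⟩
      exact ⟨_, hx, _, hy, by simp [e], by rw [← e']; simp [e]⟩)

end SectionArrow

end InvGpd

/-! ### Dependent products: universal property and construction -/

section

variable {D : Type w} [Category.{v} D]

/-- The universal property of the dependent product `q` of `f` along `g`, in terms of the
evaluation `ε : P ×_B A ⟶ X`. -/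
def IsPi {A B X P : D} (g : A ⟶ B) (f : X ⟶ A) (q : P ⟶ B) : Prop :=
  ∃ (Q : D) (k : Q ⟶ P) (l : Q ⟶ A) (ε : Q ⟶ X), IsPullback k l q g ∧ ε ≫ f = l ∧
    ∀ {Y Z : D} (y : Y ⟶ B) (a : Z ⟶ Y) (b : Z ⟶ A), IsPullback a b y g →
      ∀ m : Z ⟶ X, m ≫ f = b →
        ∃! n : Y ⟶ P, n ≫ q = y ∧ ∀ r : Z ⟶ Q, r ≫ k = a ≫ n → r ≫ l = b → r ≫ ε = m

end

namespace InvGpd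

variable {A B X : InvGpd.{u}} (g : A ⟶ B) (f : X ⟶ A) (hg : LiftsArrows g)

/-- The isofibration hypothesis is an argument of the type because the groupoid structure depends on
it. -/
def PiCarrier (_ : LiftsArrows g) : Type u := SectionArrow g f

noncomputable instance : InvolutiveGroupoid (PiCarrier g f hg) :=
  SectionArrow.involutiveGroupoid g f hg

noncomputable abbrev piObj : InvGpd.{u} := ⟨PiCarrier g f hg⟩

theorem piObj_mul {P Q : PiCarrier g f hg} (h : tgt P = src Q) :
    P * Q = SectionArrow.comp hg P Q h :=
  dif_pos h

def piMap : piObj g f hg ⟶ B :=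
  Hom.mk (A := piObj g f hg) SectionArrow.base (fun _ => rfl)
    (fun P => InvolutiveGroupoid.src_inv (SectionArrow.base P)) (fun _ => rfl) fun _ _ h =>
      congrArg SectionArrow.base (piObj_mul g f hg h)

theorem exists_eval (z : PullbackCarrier (piMap g f hg) g) : ∃ x ∈ z.1.1.carrier, f x = z.1.2 :=
  z.1.1.exists_mem z.1.2 z.2.symm

noncomputable def piEval : pullbackObj (piMap g f hg) g ⟶ X := by
  -- The evaluation of a section at `e` is the only element of its carrier above `e`, so each
  -- compatibility reduces to a membership and an equation in `A`.
  have key : ∀ (z : PullbackCarrier (piMap g f hg) g) (x : X), x ∈ z.1.1.carrier → f x = z.1.2 →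
      (exists_eval g f hg z).choose = x := fun z x hx hx' =>
    z.1.1.inj _ (exists_eval g f hg z).choose_spec.1 _ hx
      ((exists_eval g f hg z).choose_spec.2.trans hx'.symm)
  refine Hom.mk (A := pullbackObj (piMap g f hg) g) (fun z => (exists_eval g f hg z).choose)
    (fun z => ?_) (fun z => ?_) (fun z => ?_) (fun z w h => ?_)
  all_goals
    obtain ⟨h₁, h₂⟩ := (exists_eval g f hg z).choose_spec
    refine key _ _ ?_ ?_
  · exact SectionArrow.src_mem hg _ h₁
  · rw [map_src, h₂]; rfl
  · exact SectionArrow.tgt_mem hg _ h₁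
  · rw [map_tgt, h₂]; rfl
  · change bar (bar (exists_eval g f hg z).choose) ∈ z.1.1.carrier
    rwa [bar_bar]
  · rw [map_bar, h₂]; rfl
  all_goals
    obtain ⟨h₃, h₄⟩ := (exists_eval g f hg w).choose_spec
    have h' : tgt z.1.1 = src w.1.1 := congrArg (fun x => x.1.1) h
    have h'' : tgt z.1.2 = src w.1.2 := congrArg (fun x => x.1.2) h
    have hc := SectionArrow.composable h' h₁ h₃ (by rw [h₂, h₄, h''])
    rw [PullbackCarrier.mul_val _ _ h]
  · dsimp only
    rw [piObj_mul g f hg h']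
    exact ⟨_, h₁, _, h₃, hc, rfl⟩
  · rw [map_mul f hc, h₂, h₄]

theorem piEval_mem (z : PullbackCarrier (piMap g f hg) g) : piEval g f hg z ∈ z.1.1.carrier :=
  (exists_eval g f hg z).choose_spec.1

theorem piEval_comp : piEval g f hg ≫ f = pullbackSnd (piMap g f hg) g :=
  hom_ext fun z => (exists_eval g f hg z).choose_spec.2

section

variable {g f} {Y Z : InvGpd.{u}} {y : Y ⟶ B} {a : Z ⟶ Y} {b : Z ⟶ A} (sq : IsPullback a b y g)
  (m : Z ⟶ X) (hm : m ≫ f = b)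

include sq hm in
theorem isPullback_joint {z w : Z} (h : a z = a w) (h' : f (m z) = f (m w)) : z = w := by
  have hb : ∀ z, f (m z) = b z := congr_hom hm
  exact (existsUnique_of_isPullback sq (congr_hom sq.w w)).unique
    ⟨h, by rw [← hb, h', hb]⟩ ⟨rfl, rfl⟩

include sq hm in
theorem isPullback_composable {z w : Z} (h : tgt (a z) = src (a w))
    (h' : tgt (f (m z)) = src (f (m w))) : tgt z = src w :=
  isPullback_joint sq m hm (by simpa using h) (by simpa using h')

-- The transpose of `m`: the section at `t` is the image under `m` of the fibre of `Z` above `t`.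
@[simps]
def sectionOfMap (t : Y) : SectionArrow g f where
  base := y t
  carrier := {x | ∃ z, a z = t ∧ m z = x}
  map_eq := by
    rintro _ ⟨z, rfl, rfl⟩
    rw [← comp_apply m f, hm]
    exact (congr_hom sq.w z).symm
  exists_mem e he := by
    obtain ⟨z, ⟨hz, hz'⟩, -⟩ := existsUnique_of_isPullback sq he.symm
    exact ⟨_, ⟨z, hz, rfl⟩, by rw [← comp_apply m f, hm, hz']⟩
  inj := by
    rintro _ ⟨z, hz, rfl⟩ _ ⟨w, hw, rfl⟩ h
    rw [isPullback_joint sq m hm (hz.trans hw.symm) h]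
  src_eq := by
    rintro _ ⟨z, hz, rfl⟩ _ ⟨w, hw, rfl⟩ h
    rw [← map_src, ← map_src, isPullback_joint sq m hm (z := src z) (w := src w)
      (by simp [hz, hw]) (by simpa using h)]
  tgt_eq := by
    rintro _ ⟨z, hz, rfl⟩ _ ⟨w, hw, rfl⟩ h
    rw [← map_tgt, ← map_tgt, isPullback_joint sq m hm (z := tgt z) (w := tgt w)
      (by simp [hz, hw]) (by simpa using h)]
  mul_inv_mul_mem := by
    rintro _ ⟨z₁, h₁, rfl⟩ _ ⟨z₂, h₂, rfl⟩ _ ⟨z₃, h₃, rfl⟩ e e'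
    have e₁ : tgt z₁ = src z₂⁻¹ := isPullback_composable sq m hm (by simp [h₁, h₂])
      (by simpa using congrArg f e)
    have e₂ : tgt z₂⁻¹ = src z₃ := isPullback_composable sq m hm (by simp [h₂, h₃])
      (by simpa using congrArg f e')
    refine ⟨z₁ * (z₂⁻¹ * z₃), ?_, ?_⟩
    · simp [e₁, e₂, h₁, h₂, h₃]
    · rw [map_mul m (by simpa [e₂] using e₁), map_mul m e₂, map_inv]

theorem sectionOfMap_src (t : Y) :
    sectionOfMap sq m hm (src t) = (sectionOfMap sq m hm t).src hg := by
  symm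
  refine SectionArrow.eq_of_subset (map_src y t).symm ?_
  rintro _ ⟨_, ⟨z, hz, rfl⟩, _, ⟨w, hw, rfl⟩, e, rfl⟩
  have e₁ : tgt z = src w⁻¹ := isPullback_composable sq m hm (by simp [hz, hw])
    (by simpa using congrArg f e)
  exact ⟨z * w⁻¹, by simp [e₁, hz, hw], by rw [map_mul m e₁, map_inv]⟩

theorem sectionOfMap_inv (t : Y) :
    sectionOfMap sq m hm t⁻¹ = (sectionOfMap sq m hm t).inv := by
  refine SectionArrow.eq_of_subset (map_inv y t) ?_
  rintro _ ⟨z, hz, rfl⟩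
  exact ⟨z⁻¹, by simp [hz], map_inv _ _⟩

theorem sectionOfMap_tgt (t : Y) :
    sectionOfMap sq m hm (tgt t) = (sectionOfMap sq m hm t).inv.src hg := by
  rw [← src_inv, sectionOfMap_src hg, sectionOfMap_inv]

noncomputable def piLift : Y ⟶ piObj g f hg :=
  Hom.mk (B := piObj g f hg) (sectionOfMap sq m hm) (sectionOfMap_src hg sq m hm)
    (sectionOfMap_tgt hg sq m hm)
    (fun t => by
      refine SectionArrow.eq_of_subset (map_bar y t) ?_
      rintro _ ⟨z, hz, rfl⟩
      exact ⟨bar z, by simp [hz], by simp⟩)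
    (fun t t' h => by
      have h' : (sectionOfMap sq m hm t).inv.src hg = (sectionOfMap sq m hm t').src hg := by
        rw [← sectionOfMap_tgt, ← sectionOfMap_src, h]
      refine Eq.trans ?_ (piObj_mul g f hg h').symm
      symm
      refine SectionArrow.eq_of_subset (map_mul y h).symm ?_
      rintro _ ⟨_, ⟨z, hz, rfl⟩, _, ⟨w, hw, rfl⟩, e, rfl⟩
      have e₁ : tgt z = src w := isPullback_composable sq m hm (by simp [hz, hw, h])
        (by simpa using congrArg f e)
      exact ⟨z * w, by simp [e₁, hz, hw], by rw [map_mul m e₁]⟩)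

end

/-- The dependent products along isofibrations. -/
theorem isPi_piMap : IsPi g f (piMap g f hg) := by
  refine ⟨_, _, _, piEval g f hg, isPullback_pullbackObj _ _, piEval_comp g f hg,
    fun {Y Z} y a b sq m hm => ⟨piLift hg sq m hm, ⟨rfl, fun r h₁ h₂ => ?_⟩, ?_⟩⟩
  · ext z
    have h₁' : (r z).1.1 = sectionOfMap sq m hm (a z) := congr_hom h₁ z
    have h₂' : (r z).1.2 = b z := congr_hom h₂ z
    refine (r z).1.1.inj _ (piEval_mem g f hg (r z)) _ ?_ ?_
    · rw [h₁']
      exact ⟨z, rfl, rfl⟩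
    · refine (congr_hom (piEval_comp g f hg) (r z)).trans ?_
      rw [← comp_apply m f, hm]
      exact h₂'
  · rintro n ⟨rfl, h⟩
    ext t
    symm
    refine SectionArrow.eq_of_subset rfl ?_
    rintro _ ⟨z, rfl, rfl⟩
    let r := (isPullback_pullbackObj (piMap g f hg) g).lift (a ≫ n) b (by simpa using sq.w)
    have hr : r ≫ pullbackFst _ _ = a ≫ n := IsPullback.lift_fst _ _ _ _
    have hr' := h r hr (IsPullback.lift_snd _ _ _ _)
    rw [← hr', ← comp_apply a n, ← hr]
    exact piEval_mem g f hg (r z)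

end InvGpd

/-! ### Comparison with representability -/

section IsPi

variable {D : Type w} [Category.{v} D]

theorem IsPi.of_iso {A B X P P' : D} {g : A ⟶ B} {f : X ⟶ A} {q : P ⟶ B} (h : IsPi g f q)
    (e : P' ≅ P) : IsPi g f (e.hom ≫ q) := by
  obtain ⟨Q, k, l, ε, sq, hε, H⟩ := h
  refine ⟨Q, k ≫ e.inv, l, ε, sq.of_iso (Iso.refl _) e.symm (Iso.refl _) (Iso.refl _) (by simp)
    (by simp) (by simp) (by simp), hε, fun {Y Z} y a b sq' m hm => ?_⟩
  obtain ⟨n, ⟨hn, hn'⟩, huniq⟩ := H y a b sq' m hm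
  refine ⟨n ≫ e.inv, ⟨by simp [hn], fun r h₁ h₂ => hn' r ?_ h₂⟩, fun n' ⟨h₁, h₂⟩ => ?_⟩
  · simpa [← Category.assoc] using h₁
  · rw [← huniq (n' ≫ e.hom) ⟨by simpa using h₁, fun r h₃ h₄ => h₂ r ?_ h₄⟩]
    · simp
    · simp [reassoc_of% h₃]

/-- The representing bijection sends `n` to the pullback of `n` followed by evaluation. `IsPi`
refers to arbitrary pullback squares; here they are specialised to the chosen ones. -/
theorem IsPi.isDependentProduct {A B X P : D} {g : A ⟶ B} [HasPullbacksAlong g] {f : X ⟶ A}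
    {q : P ⟶ B} (h : IsPi g f q) : IsDependentProduct g f q := by
  obtain ⟨Q, k, l, ε, sq, hε, H⟩ := h
  let e : pullback q g ⟶ Q := sq.lift (pullback.fst q g) (pullback.snd q g) pullback.condition
  have he₁ : e ≫ k = pullback.fst q g := sq.lift_fst _ _ _
  have he₂ : e ≫ l = pullback.snd q g := sq.lift_snd _ _ _
  let ev : (Over.pullback g).obj (Over.mk q) ⟶ Over.mk f :=
    Over.homMk (e ≫ ε) (by simpa [hε] using he₂)
  have key : ∀ {Y : Over B} (n : Y ⟶ Over.mk q) (r : pullback Y.hom g ⟶ Q),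
      r ≫ k = pullback.fst _ _ ≫ n.left → r ≫ l = pullback.snd _ _ →
      ((Over.pullback g).map n ≫ ev).left = r ≫ ε := fun n r h₁ h₂ => by
    have : ((Over.pullback g).map n).left ≫ e = r := by
      apply sq.hom_ext
      · rw [Category.assoc, he₁, h₁]
        exact pullback.lift_fst _ _ _
      · rw [Category.assoc, he₂, h₂]
        exact pullback.lift_snd _ _ _
    rw [← this, Over.comp_left, Category.assoc]
    rfl
  have exr : ∀ {Y : Over B} (n : Y ⟶ Over.mk q), ∃ r : pullback Y.hom g ⟶ Q,
      r ≫ k = pullback.fst _ _ ≫ n.left ∧ r ≫ l = pullback.snd _ _ := fun n =>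
    ⟨sq.lift (pullback.fst _ _ ≫ n.left) (pullback.snd _ _) (by
      have := Over.w n
      dsimp at this
      rw [Category.assoc, this, pullback.condition]), sq.lift_fst _ _ _, sq.lift_snd _ _ _⟩
  have bij : ∀ Y : Over B, Function.Bijective
      (fun n : Y ⟶ Over.mk q => (Over.pullback g).map n ≫ ev) := fun Y => by
    constructor
    · intro n n' hnn
      dsimp only at hnn
      obtain ⟨r, hr, hr'⟩ := exr n
      obtain ⟨s, hs, hs'⟩ := exr n'
      have hrs : r ≫ ε = s ≫ ε := by rw [← key n r hr hr', ← key n' s hs hs', hnn]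
      obtain ⟨n₀, -, huniq⟩ := H Y.hom _ _ (IsPullback.of_hasPullback Y.hom g) (r ≫ ε)
        (by rw [Category.assoc, hε, hr'])
      ext
      rw [huniq n.left ⟨Over.w n, fun t ht ht' => by
          rw [sq.hom_ext (ht.trans hr.symm) (ht'.trans hr'.symm)]⟩,
        huniq n'.left ⟨Over.w n', fun t ht ht' => by
          rw [hrs, sq.hom_ext (ht.trans hs.symm) (ht'.trans hs'.symm)]⟩]
    · intro m
      obtain ⟨n, ⟨hn, hn'⟩, -⟩ := H Y.hom _ _ (IsPullback.of_hasPullback Y.hom g) m.left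
        (Over.w m)
      refine ⟨Over.homMk n hn, ?_⟩
      obtain ⟨r, hr, hr'⟩ := exr (Over.homMk n hn : Y ⟶ Over.mk q)
      ext
      exact (key _ r hr hr').trans (hn' r hr hr')
  exact ⟨{ homEquiv := fun {Y} => Equiv.ofBijective _ (bij Y)
           homEquiv_comp := fun n n' => by
             change (Over.pullback g).map (n ≫ n') ≫ ev = (Over.pullback g).map n ≫ _ ≫ ev
             rw [Functor.map_comp, Category.assoc] }⟩

/-- The dependent product is unique up to isomorphism. -/
theorem IsDependentProduct.exists_iso {A B X P P' : D} {g : A ⟶ B} [HasPullbacksAlong g]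
    {f : X ⟶ A} {q : P ⟶ B} {q' : P' ⟶ B} (h : IsDependentProduct g f q)
    (h' : IsDependentProduct g f q') : ∃ e : P ≅ P', e.hom ≫ q' = q := by
  obtain ⟨h⟩ := h
  obtain ⟨h'⟩ := h'
  let e := h.uniqueUpToIso h'
  exact ⟨(Over.forget B).mapIso e, Over.w e.hom⟩

end IsPi

/-! ### Fibrancy of dependent products, and transfer to the fibrant objects -/

namespace InvGpd

/-- A lifting problem of `i` against `q` transposes to one of `j` against `f`, where `j` is the
pullback of `i` along a base change of the fibration `g`. Such a `j` is again a trivial cofibration.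
-/
theorem fibrations_of_isPi {A B X P : InvGpd.{u}} {g : A ⟶ B} {f : X ⟶ A} {q : P ⟶ B}
    (hg : fibrations g) (hf : fibrations f) (h : IsPi g f q) : fibrations q := by
  obtain ⟨Q, k, l, ε, sq, hε, H⟩ := h
  refine fun T T' i hi => ⟨fun {s t} comm => ?_⟩
  let a' := pullback.fst t g
  let b' := pullback.snd t g
  let j := pullback.snd i a'
  let c := pullback.fst i a'
  have sq' : IsPullback a' b' t g := IsPullback.of_hasPullback _ _
  have sq₁ : IsPullback c j i a' := IsPullback.of_hasPullback _ _
  have sq₂ : IsPullback c (j ≫ b') (i ≫ t) g := sq₁.paste_vert sq'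
  have ha' : fibrations a' := MorphismProperty.of_isPullback sq'.flip hg
  have hj : trivialCofibrations j :=
    IsTrivialCofibration.of_isPullback hi (liftsArrows_of_fibrations ha') sq₁.flip
  let r := sq.lift (c ≫ s) (j ≫ b') (by rw [Category.assoc, comm.w, sq₂.w])
  have hr₁ : r ≫ k = c ≫ s := sq.lift_fst _ _ _
  have hr₂ : r ≫ l = j ≫ b' := sq.lift_snd _ _ _
  have comm' : CommSq (r ≫ ε) j f b' := ⟨by rw [Category.assoc, hε, hr₂]⟩
  have := hf _ hj
  obtain ⟨n, ⟨hn, hn'⟩, -⟩ := H t a' b' sq' comm'.lift comm'.fac_right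
  obtain ⟨n₀, -, huniq⟩ := H (i ≫ t) c (j ≫ b') sq₂ (r ≫ ε) (by rw [Category.assoc, hε, hr₂])
  let r' := sq.lift (a' ≫ n) b' (by rw [Category.assoc, hn, sq'.w])
  have hr'₁ : r' ≫ k = a' ≫ n := sq.lift_fst _ _ _
  have hr'₂ : r' ≫ l = b' := sq.lift_snd _ _ _
  refine ⟨⟨⟨n, ?_, hn⟩⟩⟩
  -- The upper triangle holds because both sides have the same transpose `r ≫ ε`.
  rw [huniq (i ≫ n) ⟨by rw [Category.assoc, hn], fun x h₁ h₂ => ?_⟩,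
    huniq s ⟨comm.w, fun x h₁ h₂ => ?_⟩]
  · rw [sq.hom_ext (h₁.trans hr₁.symm) (h₂.trans hr₂.symm)]
  · have : x = j ≫ r' := sq.hom_ext
      (by rw [h₁, Category.assoc, hr'₁, reassoc_of% sq₁.w])
      (by rw [h₂, Category.assoc, hr'₂])
    rw [this, Category.assoc, hn' r' hr'₁ hr'₂, comm'.fac_left]

theorem IsTrivialCofibration.comp_of_isIso {A B B' : InvGpd.{u}} {i : A ⟶ B}
    (hi : IsTrivialCofibration i) (e : B ⟶ B') [IsIso e] : IsTrivialCofibration (i ≫ e) := by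
  obtain ⟨he, he'⟩ := bijective_of_isIso e
  have mem : ∀ y, e y ∈ Set.range (i ≫ e) ↔ y ∈ Set.range i := fun y =>
    ⟨fun ⟨x, hx⟩ => ⟨x, he hx⟩, fun ⟨x, hx⟩ => ⟨x, congrArg e hx⟩⟩
  refine ⟨he.comp hi.injective, fun y => ?_, fun y => ?_⟩ <;> obtain ⟨y, rfl⟩ := he' y
  · rw [← map_src, ← map_tgt, mem, mem, mem]
    exact hi.full y
  · obtain ⟨x, hx, hx'⟩ := hi.essSurj y
    exact ⟨e x, by rwa [← map_src, mem], by rw [← map_tgt, ← map_src, hx']⟩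

theorem IsTrivialCofibration.isIso_comp {A A' B : InvGpd.{u}} {i : A ⟶ B}
    (hi : IsTrivialCofibration i) (e : A' ⟶ A) [IsIso e] : IsTrivialCofibration (e ≫ i) := by
  obtain ⟨he, he'⟩ := bijective_of_isIso e
  have range : Set.range (e ≫ i) = Set.range i := he'.range_comp i
  exact ⟨hi.injective.comp he, by rw [range]; exact hi.full, by rw [range]; exact hi.essSurj⟩

/-- The objects `X` for which the morphism to the terminal object is an injective fibration. -/
def IsFibrant (X : InvGpd.{u}) : Prop := fibrations (isTerminalPUnit.from X)

theorem IsFibrant.of_fibrations {X Y : InvGpd.{u}} {f : X ⟶ Y} (hf : fibrations f)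
    (hY : IsFibrant Y) : IsFibrant X := by
  unfold IsFibrant at *
  rw [← isTerminalPUnit.comp_from f]
  exact MorphismProperty.comp_mem _ _ _ hf hY

section Transfer

variable {C : Type w} [Category.{v} C] (Ψ : C ⥤ InvGpd.{u})

/-- `Ψ` identifies `C` with the full subcategory of fibrant objects. -/
structure IsFibrantInclusion : Prop where
  full : Ψ.Full
  faithful : Ψ.Faithful
  isFibrant : ∀ X, IsFibrant (Ψ.obj X)
  exists_iso : ∀ X, IsFibrant X → ∃ Y, Nonempty (Ψ.obj Y ≅ X)

variable {Ψ} (hΨ : IsFibrantInclusion Ψ)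
include hΨ

/-- The pullback formed in `InvGpd` is a fibration over a fibrant object, hence fibrant, hence in
the image of `Ψ` up to isomorphism. -/
theorem IsFibrantInclusion.exists_isPullback {A B X : C} (h : X ⟶ B) (g : A ⟶ B)
    (hg : fibrations (Ψ.map g)) : ∃ (P : C) (a : P ⟶ X) (b : P ⟶ A), IsPullback a b h g ∧
      IsPullback (Ψ.map a) (Ψ.map b) (Ψ.map h) (Ψ.map g) := by
  have := hΨ.full
  have := hΨ.faithful
  have sq := IsPullback.of_hasPullback (Ψ.map h) (Ψ.map g)
  obtain ⟨P, ⟨e⟩⟩ := hΨ.exists_iso _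
    ((hΨ.isFibrant X).of_fibrations (MorphismProperty.of_isPullback sq.flip hg))
  have sq' : IsPullback (Ψ.map (Ψ.preimage (e.hom ≫ pullback.fst _ _)))
      (Ψ.map (Ψ.preimage (e.hom ≫ pullback.snd _ _))) (Ψ.map h) (Ψ.map g) :=
    sq.of_iso e.symm (Iso.refl _) (Iso.refl _) (Iso.refl _) (by simp) (by simp) (by simp) (by simp)
  refine ⟨P, _, _, IsPullback.of_map Ψ ?_ sq', sq'⟩
  apply Ψ.map_injective
  simpa using sq'.w

theorem IsFibrantInclusion.map_isPullback {A B X P : C} {a : P ⟶ X} {b : P ⟶ A} {h : X ⟶ B}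
    {g : A ⟶ B} (sq : IsPullback a b h g) (hg : fibrations (Ψ.map g)) :
    IsPullback (Ψ.map a) (Ψ.map b) (Ψ.map h) (Ψ.map g) := by
  obtain ⟨P', a', b', sq', sq''⟩ := hΨ.exists_isPullback h g hg
  exact sq''.of_iso (Ψ.mapIso (sq'.isoIsPullback _ _ sq)) (Iso.refl _) (Iso.refl _) (Iso.refl _)
    (by simp [← Functor.map_comp]) (by simp [← Functor.map_comp]) (by simp) (by simp)

theorem IsFibrantInclusion.isPi {A B X P : C} {g : A ⟶ B} {f : X ⟶ A} {q : P ⟶ B}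
    (hg : fibrations (Ψ.map g)) (h : IsPi (Ψ.map g) (Ψ.map f) (Ψ.map q)) : IsPi g f q := by
  have := hΨ.full
  have := hΨ.faithful
  obtain ⟨Q, k, l, ε, sq, hε, H⟩ := h
  obtain ⟨Q', k', l', sq₁, sq₂⟩ := hΨ.exists_isPullback q g hg
  let e := sq₂.isoIsPullback _ _ sq
  have he₁ : e.hom ≫ k = Ψ.map k' := sq₂.isoIsPullback_hom_fst _ _ sq
  have he₂ : e.hom ≫ l = Ψ.map l' := sq₂.isoIsPullback_hom_snd _ _ sq
  refine ⟨Q', k', l', Ψ.preimage (e.hom ≫ ε), sq₁, Ψ.map_injective (by simp [hε, he₂]),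
    fun {Y Z} y a b sq₃ m hm => ?_⟩
  obtain ⟨n, ⟨hn, hn'⟩, huniq⟩ := H _ _ _ (hΨ.map_isPullback sq₃ hg) (Ψ.map m)
    (by rw [← Functor.map_comp, hm])
  refine ⟨Ψ.preimage n, ⟨Ψ.map_injective (by simp [hn]), fun r h₁ h₂ => Ψ.map_injective ?_⟩,
    fun n' ⟨h₁, h₂⟩ => Ψ.map_injective ?_⟩
  · have := hn' (Ψ.map r ≫ e.hom) (by rw [Category.assoc, he₁, ← Ψ.map_comp, h₁]; simp)
      (by rw [Category.assoc, he₂, ← Ψ.map_comp, h₂])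
    simpa using this
  · rw [Ψ.map_preimage]
    refine huniq _ ⟨by rw [← Ψ.map_comp, h₁], fun r h₃ h₄ => ?_⟩
    have hr₁ : e.inv ≫ Ψ.map k' = k := by rw [← he₁, e.inv_hom_id_assoc]
    have hr₂ : e.inv ≫ Ψ.map l' = l := by rw [← he₂, e.inv_hom_id_assoc]
    have := h₂ (Ψ.preimage (r ≫ e.inv)) (Ψ.map_injective (by simp [hr₁, h₃]))
      (Ψ.map_injective (by simp [hr₂, h₄]))
    simpa using congrArg Ψ.map this

theorem IsFibrantInclusion.llp_of_isTrivialCofibration {A B : C} {i : A ⟶ B}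
    (hi : IsTrivialCofibration (Ψ.map i)) : (fibrations.inverseImage Ψ).llp i := by
  have := hΨ.full
  have := hΨ.faithful
  refine fun X Y p hp => ⟨fun {s t} comm => ?_⟩
  have := hp _ hi
  have comm' : CommSq (Ψ.map s) (Ψ.map i) (Ψ.map p) (Ψ.map t) := comm.map Ψ
  exact ⟨⟨⟨Ψ.preimage comm'.lift, Ψ.map_injective (by simp), Ψ.map_injective (by simp)⟩⟩⟩

theorem IsFibrantInclusion.exists_factorization {A B : C} (f : A ⟶ B) :
    ∃ (E : C) (i : A ⟶ E) (p : E ⟶ B), IsTrivialCofibration (Ψ.map i) ∧ fibrations (Ψ.map p) ∧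
      i ≫ p = f := by
  have := hΨ.full
  have := hΨ.faithful
  have hp := fibrations_pathProjection (Ψ.map f)
  obtain ⟨E, ⟨e⟩⟩ := hΨ.exists_iso _ ((hΨ.isFibrant B).of_fibrations hp)
  refine ⟨E, Ψ.preimage (pathInclusion _ ≫ e.inv), Ψ.preimage (e.hom ≫ pathProjection _), ?_, ?_,
    Ψ.map_injective (by simp [pathInclusion_comp_pathProjection])⟩
  · rw [Ψ.map_preimage]
    exact (isTrivialCofibration_pathInclusion _).comp_of_isIso _
  · rw [Ψ.map_preimage]
    exact (MorphismProperty.cancel_left_of_respectsIso _ _ _).2 hp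

/-- Factoring `i` as a trivial cofibration `j` and a fibration, and lifting `i` against the latter,
makes `i` a retract of `j`. The factorization stays among fibrant objects, so lifting against
fibrations between these is enough. -/
theorem IsFibrantInclusion.isTrivialCofibration_of_llp {A B : C} {i : A ⟶ B}
    (hi : (fibrations.inverseImage Ψ).llp i) : IsTrivialCofibration (Ψ.map i) := by
  obtain ⟨E, j, p, hj, hp, rfl⟩ := hΨ.exists_factorization i
  have := hi _ hp
  have comm : CommSq j (j ≫ p) p (𝟙 B) := ⟨by simp⟩
  refine hj.of_comp (l := Ψ.map comm.lift) (p := Ψ.map p) ?_ ?_ ?_ <;>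
    rw [← Ψ.map_comp]
  · rw [comm.fac_left]
  · rw [comm.fac_right, Ψ.map_id]

/-- The comparison with `piObj` is kept in the conclusion: it is used to see that dependent products
of small fibrations are small. -/
theorem IsFibrantInclusion.exists_isPi {A B X : C} {g : A ⟶ B} {f : X ⟶ A}
    (hg : fibrations (Ψ.map g)) (hf : fibrations (Ψ.map f)) :
    ∃ (P : C) (q : P ⟶ B) (e : Ψ.obj P ≅ piObj (Ψ.map g) (Ψ.map f) (liftsArrows_of_fibrations hg)),
      Ψ.map q = e.hom ≫ piMap _ _ _ ∧ fibrations (Ψ.map q) ∧ IsPi g f q := by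
  have := hΨ.full
  have hpi := isPi_piMap (Ψ.map g) (Ψ.map f) (liftsArrows_of_fibrations hg)
  have hq := fibrations_of_isPi hg hf hpi
  obtain ⟨P, ⟨e⟩⟩ := hΨ.exists_iso _ ((hΨ.isFibrant B).of_fibrations hq)
  have h := (Ψ.map_preimage (e.hom ≫ piMap _ _ _))
  refine ⟨P, Ψ.preimage (e.hom ≫ piMap _ _ _), e, h, ?_, hΨ.isPi hg ?_⟩
  · rw [h]
    exact (MorphismProperty.cancel_left_of_respectsIso _ _ _).2 hq
  · rw [h]
    exact hpi.of_iso e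

theorem IsFibrantInclusion.isTypeTheoreticFibrationCategory :
    IsTypeTheoreticFibrationCategory (fibrations.inverseImage Ψ) := by
  have := hΨ.full
  have := hΨ.faithful
  obtain ⟨T, ⟨e⟩⟩ := hΨ.exists_iso punit (by
    unfold IsFibrant
    rw [isTerminalPUnit.hom_ext (isTerminalPUnit.from punit) (𝟙 _)]
    exact MorphismProperty.id_mem _ _)
  have hT : IsTerminal T := IsTerminal.isTerminalOfObj Ψ T (isTerminalPUnit.ofIso e.symm)
  exact
    { hasTerminal := hT.hasTerminal
      isMultiplicative := inferInstance
      of_isIso := fun f hf => MorphismProperty.rlp_of_isIso _ (Ψ.map f)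
      of_isTerminal := fun {A T'} f hT' => by
        let e' : Ψ.obj T' ≅ punit := Ψ.mapIso (hT'.uniqueUpToIso hT) ≪≫ e
        have : fibrations (Ψ.map f ≫ e'.hom) := by
          rw [isTerminalPUnit.hom_ext (Ψ.map f ≫ e'.hom) (isTerminalPUnit.from _)]
          exact hΨ.isFibrant A
        exact (MorphismProperty.cancel_right_of_respectsIso fibrations (Ψ.map f) e'.hom).1 this
      hasPullbacksAlong := fun g hg X h => by
        obtain ⟨_, _, _, sq, _⟩ := hΨ.exists_isPullback h g hg
        exact sq.hasPullback
      isStableUnderBaseChange := ⟨fun sq hg =>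
        MorphismProperty.of_isPullback (P := fibrations) (hΨ.map_isPullback sq.flip hg).flip hg⟩
      exists_dependentProduct := fun g _ f hg hf => by
        obtain ⟨P, q, -, -, hq, h⟩ := hΨ.exists_isPi hg hf
        exact ⟨P, q, hq, h.isDependentProduct⟩
      exists_factorization := fun f => by
        obtain ⟨E, i, p, hi, hp, h⟩ := hΨ.exists_factorization f
        exact ⟨E, i, p, hΨ.llp_of_isTrivialCofibration hi, hp, h⟩
      llp_of_isPullback := fun {X Y Z A B S j k a b c i p} hp hip hi sq sq' => by
        have h₁ := hΨ.map_isPullback sq' hp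
        -- `Ψ` is known to preserve pullbacks along fibrations only, and `i` is not one. Its square
        -- is recovered by cancelling the square of `p` from that of `i ≫ p`.
        have h₂ := hΨ.map_isPullback (sq.paste_horiz sq') hip
        rw [Ψ.map_comp, Ψ.map_comp] at h₂
        exact hΨ.llp_of_isTrivialCofibration
          (IsTrivialCofibration.of_isPullback_of_isPullback (hΨ.isTrivialCofibration_of_llp hi)
            (liftsArrows_of_fibrations (by rw [← Ψ.map_comp]; exact hip))
            (IsPullback.of_right h₂ (sq.toCommSq.map Ψ).w h₁) h₁) }

end Transfer

end InvGpd

/-! The equivalence between `Gpd^G` and the category of one-sorted groupoids with an involution. -/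

/-- The arrows of a category. -/
structure Arr (X : Type u) [Category.{u} X] : Type u where
  dom : X
  cod : X
  hom : dom ⟶ cod

namespace Arr

variable {X Y Z : Type u} [Category.{u} X] [Category.{u} Y] [Category.{u} Z]

def map (F : X ⥤ Y) (a : Arr X) : Arr Y := ⟨_, _, F.map a.hom⟩

theorem mk_injective {x y : X} {f g : x ⟶ y} (h : mk x y f = mk x y g) : f = g := by
  injection h

theorem dom_eq_cod {a b : Arr X} (h : mk a.cod a.cod (𝟙 _) = mk b.dom b.dom (𝟙 _)) :
    a.cod = b.dom := congrArg dom h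

/-- Equality of functors becomes equality of functions on arrows, which is what makes the passage to
`InvGpd` faithful. -/
theorem functor_ext {F G : X ⥤ Y} (h : ∀ a, map F a = map G a) : F = G := by
  refine CategoryTheory.Functor.ext (fun x => congrArg dom (h ⟨x, x, 𝟙 x⟩)) fun x y k => ?_
  have key : ∀ {x y x' y' : Y} (k : x ⟶ y) (k' : x' ⟶ y') (hx : x = x') (hy : y = y'),
      mk _ _ k = mk _ _ k' → k = eqToHom hx ≫ k' ≫ eqToHom hy.symm := by
    rintro _ _ _ _ k k' rfl rfl h
    simpa using mk_injective h
  exact key _ _ _ (congrArg dom (h ⟨y, y, 𝟙 y⟩)) (h ⟨x, y, k⟩)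

def comp (a b : Arr X) (h : mk a.cod a.cod (𝟙 _) = mk b.dom b.dom (𝟙 _)) : Arr X :=
  ⟨a.dom, b.cod, a.hom ≫ eqToHom (dom_eq_cod h) ≫ b.hom⟩

theorem comp_mk {x y z : X} (f : x ⟶ y) (g : y ⟶ z) (h) :
    comp (mk x y f) (mk y z g) h = ⟨x, z, f ≫ g⟩ := by simp [comp]

/-- The arrows of a groupoid with an involution. -/
@[reducible]
noncomputable def involutiveGroupoid (X : Type u) [Groupoid.{u} X] (α : X ⥤ X)
    (hα : α ⋙ α = 𝟭 X) : InvolutiveGroupoid (Arr X) :=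
  ofPartial
    (src := fun a => ⟨a.dom, a.dom, 𝟙 _⟩)
    (tgt := fun a => ⟨a.cod, a.cod, 𝟙 _⟩)
    (bar := map α)
    (inv := fun a => ⟨a.cod, a.dom, Groupoid.inv a.hom⟩)
    (comp := comp)
    (src_src := fun _ => rfl) (src_tgt := fun _ => rfl)
    (tgt_src := fun _ => rfl) (tgt_tgt := fun _ => rfl)
    (src_comp := fun _ _ _ => rfl) (tgt_comp := fun _ _ _ => rfl)
    (comp_assoc := fun _ _ _ _ _ => by simp [comp])
    (src_comp_self := fun _ => by simp [comp]) (comp_tgt_self := fun _ => by simp [comp])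
    (src_inv := fun _ => rfl) (tgt_inv := fun _ => rfl)
    (comp_inv_self := fun _ => by simp [comp]) (inv_comp_self := fun _ => by simp [comp])
    (bar_bar := fun a => by
      change map (α ⋙ α) a = a
      rw [hα]
      rfl)
    (src_bar := fun _ => by simp [map]) (tgt_bar := fun _ => by simp [map])
    (bar_comp := fun a b h => by
      obtain ⟨x, y, f⟩ := a
      obtain ⟨y', z, g⟩ := b
      obtain rfl : y = y' := dom_eq_cod h
      simp [comp, map])

end Arr

namespace GpdG

def generator : (Opposite.op (SingleObj.star (Multiplicative (ZMod 2)))) ⟶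
    (Opposite.op (SingleObj.star (Multiplicative (ZMod 2)))) :=
  Quiver.Hom.op (show SingleObj.star _ ⟶ SingleObj.star _ from Multiplicative.ofAdd (1 : ZMod 2))

/-- The underlying groupoid. -/
abbrev groupoid (A : GpdG.{u}) : Grpd.{u, u} := A.obj (Opposite.op (SingleObj.star _))

def involution (A : GpdG.{u}) : A.groupoid ⥤ A.groupoid := A.map generator

theorem generator_comp_generator : generator ≫ generator = 𝟙 _ :=
  Quiver.Hom.unop_inj (by
    change (Multiplicative.ofAdd (1 : ZMod 2)) * (Multiplicative.ofAdd (1 : ZMod 2)) = 1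
    decide)

theorem eq_id_or_eq_generator (g : Opposite.op (SingleObj.star (Multiplicative (ZMod 2))) ⟶
    Opposite.op (SingleObj.star (Multiplicative (ZMod 2)))) : g = 𝟙 _ ∨ g = generator := by
  have : ∀ h : Multiplicative (ZMod 2), h = 1 ∨ h = Multiplicative.ofAdd 1 := by decide
  exact (this g.unop).imp (congrArg Quiver.Hom.op) (congrArg Quiver.Hom.op)

theorem involution_comp_involution (A : GpdG.{u}) : A.involution ⋙ A.involution = 𝟭 _ := by
  change A.map generator ≫ A.map generator = 𝟙 _
  rw [← A.map_comp, generator_comp_generator, A.map_id]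

theorem involution_ofInvolution (A : Grpd.{u, u}) (α : A ⟶ A) (hα : α ≫ α = 𝟙 A) :
    involution (ofInvolution A α hα) = α :=
  if_neg (t := 𝟙 A) (show ¬ (Multiplicative.ofAdd (1 : ZMod 2)) = 1 by decide)

noncomputable instance (A : GpdG.{u}) : InvolutiveGroupoid (Arr A.groupoid) :=
  Arr.involutiveGroupoid A.groupoid A.involution A.involution_comp_involution

noncomputable abbrev arrows (A : GpdG.{u}) : InvGpd.{u} := ⟨Arr A.groupoid⟩

theorem arrows_mul {A : GpdG.{u}} {a b : arrows A} (h : tgt a = src b) :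
    a * b = Arr.comp a b h := dif_pos h

theorem arrows_mk_mul_mk {A : GpdG.{u}} {x y z : A.groupoid} (f : x ⟶ y) (g : y ⟶ z) :
    (⟨x, y, f⟩ : arrows A) * (⟨y, z, g⟩ : arrows A) = (⟨x, z, f ≫ g⟩ : arrows A) :=
  (arrows_mul rfl).trans (Arr.comp_mk f g rfl)

abbrev functor {A B : GpdG.{u}} (f : A ⟶ B) : A.groupoid ⥤ B.groupoid :=
  f.app (Opposite.op (SingleObj.star _))

theorem involution_comp_functor {A B : GpdG.{u}} (f : A ⟶ B) :
    A.involution ⋙ functor f = functor f ⋙ B.involution := f.naturality generator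

noncomputable def mapArrows {A B : GpdG.{u}} (f : A ⟶ B) : arrows A ⟶ arrows B :=
  InvGpd.Hom.mk (A := arrows A) (B := arrows B) (Arr.map (functor f))
    (fun a => by
      change Arr.mk _ _ ((functor f).map (𝟙 _)) = Arr.mk _ _ (𝟙 _)
      rw [(functor f).map_id]
      rfl)
    (fun a => by
      change Arr.mk _ _ ((functor f).map (𝟙 _)) = Arr.mk _ _ (𝟙 _)
      rw [(functor f).map_id]
      rfl)
    (fun a => by
      change Arr.map (A.involution ⋙ functor f) a = Arr.map (functor f ⋙ B.involution) a
      rw [involution_comp_functor])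
    (fun a b h => by
      obtain ⟨x, y, g⟩ := a
      obtain ⟨y', z, g'⟩ := b
      obtain rfl : y = y' := Arr.dom_eq_cod h
      rw [arrows_mk_mul_mk]
      refine Eq.trans ?_ (arrows_mk_mul_mk _ _).symm
      change Arr.mk _ _ ((functor f).map (g ≫ g')) = _
      rw [(functor f).map_comp])

/-- The functor to one-sorted groupoids with an involution. -/
noncomputable def toInvGpd : GpdG.{u} ⥤ InvGpd.{u} where
  obj := arrows
  map := mapArrows
  map_id _ := rfl
  map_comp _ _ := rfl

theorem hom_ext_of_functor {A B : GpdG.{u}} {f g : A ⟶ B} (h : functor f = functor g) : f = g :=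
  NatTrans.ext (funext fun _ => h)

instance : toInvGpd.{u}.Faithful where
  map_injective {A B f g} h := by
    replace h : ∀ a, Arr.map (functor f) a = Arr.map (functor g) a := InvGpd.congr_hom h
    exact hom_ext_of_functor (Arr.functor_ext h)

instance : toInvGpd.{u}.Full where
  map_surjective {A B} φ := by
    change arrows A ⟶ arrows B at φ
    -- The action on objects is read off from the images of the identity arrows.
    let F : A.groupoid → B.groupoid := fun x => Arr.dom (φ (⟨x, x, 𝟙 x⟩ : Arr A.groupoid))
    have hF : ∀ x, φ (⟨x, x, 𝟙 x⟩ : Arr A.groupoid) = (⟨F x, F x, 𝟙 _⟩ : Arr B.groupoid) :=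
      fun x => InvGpd.map_src φ (⟨x, x, 𝟙 x⟩ : Arr A.groupoid)
    have ex : ∀ {x y} (f : x ⟶ y), ∃ g : F x ⟶ F y, (⟨_, _, g⟩ : Arr B.groupoid) =
        φ (⟨x, y, f⟩ : Arr A.groupoid) := fun {x y} f => by
      have h₁ : F x = _ :=
        congrArg (Arr.dom (X := B.groupoid)) (InvGpd.map_src φ (⟨x, y, f⟩ : Arr A.groupoid))
      have h₂ : F y = _ :=
        congrArg (Arr.dom (X := B.groupoid)) (InvGpd.map_tgt φ (⟨x, y, f⟩ : Arr A.groupoid))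
      rw [h₁, h₂]
      exact ⟨_, rfl⟩
    choose F' hF' using @ex
    let f₀ : A.groupoid ⥤ B.groupoid :=
      { obj := F
        map := F'
        map_id := fun x => Arr.mk_injective ((hF' _).trans (hF x))
        map_comp := fun {x y z} f g => Arr.mk_injective (by
          rw [hF', ← arrows_mk_mul_mk, InvGpd.map_mul φ rfl, ← hF', ← hF']
          exact arrows_mk_mul_mk _ _) }
    have hφ : ∀ a, φ a = Arr.map f₀ a := fun a => (hF' a.hom).symm
    have hf₀ : A.involution ⋙ f₀ = f₀ ⋙ B.involution := Arr.functor_ext fun a =>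
      (hφ _).symm.trans ((InvGpd.map_bar φ a).trans (congrArg (bar (α := Arr B.groupoid)) (hφ a)))
    refine ⟨{ app := fun _ => f₀, naturality := fun x y g => ?_ },
      InvGpd.hom_ext fun a => (hφ a).symm⟩
    obtain rfl | rfl := eq_id_or_eq_generator g
    · exact (congrArg (fun k : A.groupoid ⥤ A.groupoid => k ⋙ f₀) (A.map_id _)).trans
        (congrArg (fun k : B.groupoid ⥤ B.groupoid => f₀ ⋙ k) (B.map_id _)).symm
    · exact hf₀

section Realization

variable (D : InvGpd.{u})

/-- The objects of a one-sorted groupoid. -/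
def Objects : Type u := {x : D // src x = x}

noncomputable instance : Groupoid (Objects D) where
  Hom x y := {a : D // src a = x.1 ∧ tgt a = y.1}
  id x := ⟨x.1, x.2, tgt_eq_of_src_eq x.2⟩
  comp f g := ⟨f.1 * g.1, by rw [src_mul _ _ (f.2.2.trans g.2.1.symm), f.2.1],
    by rw [tgt_mul _ _ (f.2.2.trans g.2.1.symm), g.2.2]⟩
  inv f := ⟨f.1⁻¹, by rw [src_inv, f.2.2], by rw [tgt_inv, f.2.1]⟩
  id_comp f := Subtype.ext ((congrArg (· * f.1) f.2.1.symm).trans (src_mul_self _))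
  comp_id f := Subtype.ext ((congrArg (f.1 * ·) f.2.2.symm).trans (mul_tgt_self _))
  assoc f g h := Subtype.ext (comp_assoc _ _ _ (f.2.2.trans g.2.1.symm) (g.2.2.trans h.2.1.symm))
  inv_comp f := Subtype.ext ((inv_mul_self _).trans f.2.2)
  comp_inv f := Subtype.ext ((mul_inv_self _).trans f.2.1)

noncomputable def barFunctor : Objects D ⥤ Objects D where
  obj x := ⟨bar x.1, by rw [src_bar, x.2]⟩
  map f := ⟨bar f.1, by rw [src_bar, f.2.1], by rw [tgt_bar, f.2.2]⟩
  map_id _ := rfl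
  map_comp f g := Subtype.ext (bar_mul _ _ (f.2.2.trans g.2.1.symm))

theorem barFunctor_comp_barFunctor : barFunctor D ⋙ barFunctor D = 𝟭 _ := by
  refine Arr.functor_ext ?_
  have key : ∀ {x y x' y' : Objects D} (k : x ⟶ y) (k' : x' ⟶ y'), x = x' → y = y' →
      k.1 = k'.1 → Arr.mk _ _ k = Arr.mk _ _ k' := by
    rintro _ _ _ _ k k' rfl rfl h
    rw [Subtype.ext h]
  exact fun a => key _ _ (Subtype.ext (bar_bar _)) (Subtype.ext (bar_bar _)) (bar_bar _)

noncomputable def realization : GpdG.{u} :=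
  ofInvolution (Grpd.of (Objects D)) (barFunctor D) (barFunctor_comp_barFunctor D)

noncomputable def arrowsRealization : arrows (realization D) ⟶ D :=
  InvGpd.Hom.mk (A := arrows (realization D)) (fun a => Subtype.val (Arr.hom a))
    (fun a => (Subtype.property (Arr.hom a)).1.symm)
    (fun a => (Subtype.property (Arr.hom a)).2.symm)
    (fun a => by
      change Subtype.val (Arr.map (realization D).involution a).hom = _
      have h : (realization D).involution = barFunctor D := involution_ofInvolution _ _ _
      rw [h]
      rfl)
    (fun a b h => by
      obtain ⟨x, y, f⟩ := a
      obtain ⟨y', z, g⟩ := b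
      obtain rfl : y = y' := Arr.dom_eq_cod h
      rw [arrows_mk_mul_mk]
      rfl)

theorem bijective_arrowsRealization : Function.Bijective (arrowsRealization D) := by
  refine ⟨?_, fun x => ⟨(⟨⟨src x, src_src x⟩, ⟨tgt x, src_tgt x⟩, ⟨x, rfl, rfl⟩⟩ :
    Arr (Objects D)), rfl⟩⟩
  rintro ⟨⟨x, hx⟩, ⟨y, hy⟩, ⟨f, hf, hf'⟩⟩ ⟨⟨x', hx'⟩, ⟨y', hy'⟩, ⟨g, hg, hg'⟩⟩ (rfl : f = g)
  obtain rfl : x = x' := hf.symm.trans hg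
  obtain rfl : y = y' := hf'.symm.trans hg'
  rfl

instance : toInvGpd.{u}.EssSurj where
  mem_essImage D := ⟨realization D, ⟨InvGpd.isoOfBijective _ (bijective_arrowsRealization D)⟩⟩

end Realization

instance : toInvGpd.{u}.IsEquivalence where

theorem isTrivialCofibration_toInvGpd_map_iff {A B : GpdG.{u}} (i : A ⟶ B) :
    InvGpd.IsTrivialCofibration (toInvGpd.map i) ↔ injTrivialCofibrations i := by
  have range : ∀ a : Arr B.groupoid, a ∈ Set.range (toInvGpd.map i) ↔
      ∃ b, Arr.map (functor i) b = a := fun a => Iff.rfl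
  constructor
  · intro h
    have inj : ∀ a b, Arr.map (functor i) a = Arr.map (functor i) b → a = b :=
      fun a b => @h.injective a b
    have hobj : Function.Injective (functor i).obj := fun x y hxy => by
      have := inj ⟨x, x, 𝟙 x⟩ ⟨y, y, 𝟙 y⟩ (by
        simp only [Arr.map, CategoryTheory.Functor.map_id]
        rw [hxy])
      exact congrArg Arr.dom this
    refine ⟨fun _ => ?_, fun _ => hobj⟩
    exact
      { faithful := ⟨fun {x y} f g hfg =>
          Arr.mk_injective (inj ⟨x, y, f⟩ ⟨x, y, g⟩ (congrArg (Arr.mk _ _) hfg))⟩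
        full := ⟨fun {x y} g => by
          obtain ⟨⟨x', y', f⟩, hf⟩ := h.full (⟨_, _, g⟩ : Arr B.groupoid)
            ⟨(⟨x, x, 𝟙 x⟩ : Arr A.groupoid), congrArg (Arr.mk _ _) ((functor i).map_id x)⟩
            ⟨(⟨y, y, 𝟙 y⟩ : Arr A.groupoid), congrArg (Arr.mk _ _) ((functor i).map_id y)⟩
          obtain rfl : x' = x := hobj (congrArg Arr.dom hf)
          obtain rfl : y' = y := hobj (congrArg Arr.cod hf)
          exact ⟨f, Arr.mk_injective hf⟩⟩
        essSurj := ⟨fun y => by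
          obtain ⟨⟨x, y', f⟩, ⟨⟨z, z', k⟩, hz⟩, hy⟩ := h.essSurj (⟨y, y, 𝟙 y⟩ : Arr B.groupoid)
          obtain rfl : y' = y := congrArg Arr.dom hy
          obtain rfl : (functor i).obj z = x := congrArg Arr.dom hz
          exact ⟨z, ⟨asIso f⟩⟩⟩ }
  · rintro ⟨h, h'⟩
    have hobj : Function.Injective (functor i).obj := h' _
    have hF : (functor i).IsEquivalence := h _
    refine ⟨?_, ?_, ?_⟩
    · rintro ⟨x, y, f⟩ ⟨x', y', f'⟩ hf
      obtain rfl : x = x' := hobj (congrArg Arr.dom hf)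
      obtain rfl : y = y' := hobj (congrArg Arr.cod hf)
      exact congrArg (Arr.mk x y) ((functor i).map_injective (Arr.mk_injective hf))
    · rintro ⟨x, y, f⟩ ⟨⟨x', _, _⟩, hx⟩ ⟨⟨y', _, _⟩, hy⟩
      obtain rfl : (functor i).obj x' = x := congrArg Arr.dom hx
      obtain rfl : (functor i).obj y' = y := congrArg Arr.dom hy
      obtain ⟨g, rfl⟩ := (functor i).map_surjective f
      exact ⟨(⟨_, _, g⟩ : Arr A.groupoid), rfl⟩
    · rintro ⟨x, y, f⟩
      exact ⟨(⟨_, _, ((functor i).objObjPreimageIso x).hom⟩ : Arr B.groupoid),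
        ⟨(⟨_, _, 𝟙 _⟩ : Arr A.groupoid), congrArg (Arr.mk _ _) ((functor i).map_id _)⟩, rfl⟩

/-- An equivalence of categories preserves and reflects lifting properties; a trivial cofibration of
`InvGpd` is first replaced by an isomorphic one in the image. -/
theorem fibrations_toInvGpd_map_iff {A B : GpdG.{u}} (p : A ⟶ B) :
    InvGpd.fibrations (toInvGpd.map p) ↔ injFibrations p := by
  constructor
  · intro h X Y i hi
    exact (toInvGpd.hasLiftingProperty_iff_of_isEquivalence i p).1
      (h _ ((isTrivialCofibration_toInvGpd_map_iff i).2 hi))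
  · intro h X Y i hi
    let e₁ := toInvGpd.objObjPreimageIso X
    let e₂ := toInvGpd.objObjPreimageIso Y
    let i' := toInvGpd.preimage (e₁.hom ≫ i ≫ e₂.inv)
    have hi' : toInvGpd.map i' = e₁.hom ≫ i ≫ e₂.inv := toInvGpd.map_preimage _
    have e : Arrow.mk (toInvGpd.map i') ≅ Arrow.mk i := Arrow.isoMk e₁ e₂ (by simp [hi'])
    have h₁ := (HasLiftingProperty.iff_of_arrow_iso_left e (toInvGpd.map p)).1
    refine h₁ ((toInvGpd.hasLiftingProperty_iff_of_isEquivalence i' p).2 (h _ ?_))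
    rw [← isTrivialCofibration_toInvGpd_map_iff, hi']
    exact (InvGpd.IsTrivialCofibration.comp_of_isIso hi e₂.inv).isIso_comp e₁.hom

/-- The terminal object. -/
theorem exists_terminal : ∃ (T : GpdG.{u}) (_ : toInvGpd.obj T ≅ InvGpd.punit),
    Nonempty (IsTerminal T) := by
  let e := toInvGpd.{u}.objObjPreimageIso InvGpd.punit
  exact ⟨_, e, ⟨IsTerminal.isTerminalOfObj toInvGpd _ (InvGpd.isTerminalPUnit.ofIso e.symm)⟩⟩

theorem isInjFibrant_iff (A : GpdG.{u}) : IsInjFibrant A ↔ InvGpd.IsFibrant (toInvGpd.obj A) := by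
  obtain ⟨T, e, ⟨hT⟩⟩ := exists_terminal.{u}
  have key : ∀ {T' : GpdG.{u}} (f : A ⟶ T') (e' : toInvGpd.obj T' ≅ InvGpd.punit),
      injFibrations f ↔ InvGpd.IsFibrant (toInvGpd.obj A) := fun f e' => by
    unfold InvGpd.IsFibrant
    rw [← fibrations_toInvGpd_map_iff, InvGpd.isTerminalPUnit.hom_ext
      (InvGpd.isTerminalPUnit.from _) (toInvGpd.map f ≫ e'.hom),
      MorphismProperty.cancel_right_of_respectsIso InvGpd.fibrations]
  exact ⟨fun h => (key (hT.from A) e).1 (h _ _ hT), fun h T' f hT' =>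
    (key f (toInvGpd.mapIso (hT'.uniqueUpToIso hT) ≪≫ e)).2 h⟩

theorem isFibrantInclusion :
    InvGpd.IsFibrantInclusion (IsInjFibrant.{u}.ι ⋙ toInvGpd) where
  full := inferInstance
  faithful := inferInstance
  isFibrant X := (isInjFibrant_iff _).1 X.property
  exists_iso X hX := by
    let e := toInvGpd.objObjPreimageIso X
    refine ⟨⟨toInvGpd.objPreimage X,
      (isInjFibrant_iff _).2 (hX.of_fibrations (f := e.hom) ?_)⟩, ⟨e⟩⟩
    exact MorphismProperty.rlp_of_isIso _ _

theorem fibrantInjFibrations_eq : fibrantInjFibrations.{u} =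
    InvGpd.fibrations.inverseImage (IsInjFibrant.{u}.ι ⋙ toInvGpd) := by
  ext A B f
  exact (fibrations_toInvGpd_map_iff _).symm

end GpdG

/-! ### Discrete fibrations with small fibres -/

namespace InvGpd

variable {A B X : InvGpd.{u}} {κ : Cardinal.{u}}

/-- The discrete fibrations with `κ`-small fibres. -/
structure IsSmallDiscrete (κ : Cardinal.{u}) (f : A ⟶ B) : Prop where
  existsUnique : ∀ a β, src β = f (src a) → ∃! m, src m = src a ∧ f m = β
  mk_lt : ∀ β, Cardinal.mk {m // f m = β} < κ

namespace IsSmallDiscrete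

theorem ext {f : A ⟶ B} (hf : IsSmallDiscrete κ f) {m m' : A} (h : src m = src m')
    (h' : f m = f m') : m = m' :=
  (hf.existsUnique m' (f m') (map_src f m').symm).unique ⟨h, h'⟩ ⟨rfl, rfl⟩

theorem src_eq {f : A ⟶ B} (hf : IsSmallDiscrete κ f) {m : A} (h : src (f m) = f m) : src m = m :=
  hf.ext (src_src m) ((map_src f m).trans h)

theorem liftsArrows {f : A ⟶ B} (hf : IsSmallDiscrete κ f) : LiftsArrows f := fun a β h =>
  (hf.existsUnique a β h).exists

/-- If `m` lifts `β` from the source of `θ`, then so does `θ * bar m`; uniqueness of lifts gives the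
fixed point condition. -/
theorem fibrations {f : A ⟶ B} (hf : IsSmallDiscrete κ f) : fibrations f := by
  refine fibrations_of_lifts hf.liftsArrows fun θ β hθ hβ hβ' => ?_
  obtain ⟨m, hm, hm'⟩ := hf.liftsArrows θ β hβ
  have h : tgt θ = src (bar m) := by rw [src_bar, hm, ← src_bar, hθ, src_inv]
  exact ⟨m, hm, hm', hf.ext (by rw [src_mul _ _ h, hm]) (by rw [map_mul f h, map_bar, hm', hβ'])⟩

theorem id (A : InvGpd.{u}) (hκ : 1 < κ) : IsSmallDiscrete κ (𝟙 A) where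
  existsUnique a β h := ⟨β, ⟨h, rfl⟩, fun _ h => h.2⟩
  mk_lt β := by
    refine lt_of_le_of_lt (Cardinal.mk_le_one_iff_set_subsingleton.2 ?_) hκ
    rintro x (rfl : x = β) y (rfl : y = x)
    rfl

theorem comp {f : X ⟶ A} {g : A ⟶ B} (hf : IsSmallDiscrete κ f) (hg : IsSmallDiscrete κ g)
    (hκ : κ.IsRegular) : IsSmallDiscrete κ (f ≫ g) where
  existsUnique a β h := by
    obtain ⟨m, hm, hm'⟩ := hg.liftsArrows (f a) β (h.trans (congrArg g (map_src f a)))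
    obtain ⟨n, hn, hn'⟩ := hf.liftsArrows a m (hm.trans (map_src f a).symm)
    refine ⟨n, ⟨hn, by simp [hn', hm']⟩, fun n' ⟨h₁, h₂⟩ => hf.ext (h₁.trans hn.symm) ?_⟩
    refine hg.ext ?_ (by rw [hn', hm']; exact h₂)
    rw [← map_src, ← map_src, h₁, hn]
  mk_lt β := by
    let F : {m // (f ≫ g) m = β} → Σ a : {a // g a = β}, {m // f m = a.1} := fun m =>
      ⟨⟨f m.1, m.2⟩, ⟨m.1, rfl⟩⟩
    have hF : Function.Injective F := fun m m' h =>
      Subtype.ext (congrArg (fun z : Σ a : {a // g a = β}, {m // f m = a.1} => z.2.1) h)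
    refine (Cardinal.mk_le_of_injective hF).trans_lt ?_
    rw [Cardinal.mk_sigma]
    exact Cardinal.sum_lt_of_isRegular hκ (hg.mk_lt β) fun a => hf.mk_lt _

/-- This cancellation property is what makes the factorization axiom of the universe trivial. -/
theorem of_comp {f : X ⟶ A} {g : A ⟶ B} (hf : IsSmallDiscrete κ (f ≫ g))
    (hg : IsSmallDiscrete κ g) : IsSmallDiscrete κ f where
  existsUnique a β h := by
    obtain ⟨m, hm, hm'⟩ := hf.liftsArrows a (g β) (by rw [← map_src, h]; rfl)
    exact ⟨m, ⟨hm, hg.ext (by rw [← map_src, hm, h]) hm'⟩,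
      fun m' ⟨h₁, h₂⟩ => hf.ext (h₁.trans hm.symm) ((congrArg g h₂).trans hm'.symm)⟩
  mk_lt β := (Cardinal.mk_le_of_injective (f := fun m : {m // f m = β} =>
      (⟨m.1, congrArg g m.2⟩ : {m // (f ≫ g) m = g β})) fun m m' h =>
        Subtype.ext (congrArg (fun z : {m // (f ≫ g) m = g β} => z.1) h)).trans_lt (hf.mk_lt _)

theorem of_isPullback {P : InvGpd.{u}} {a : P ⟶ A} {b : P ⟶ X} {f : A ⟶ B} {g : X ⟶ B}
    (hf : IsSmallDiscrete κ f) (sq : IsPullback a b f g) : IsSmallDiscrete κ b where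
  existsUnique z β h := by
    have w := congr_hom sq.w
    simp only [comp_apply] at w
    obtain ⟨m, ⟨hm, hm'⟩, hu⟩ := hf.existsUnique (a z) (g β) (by
      rw [← map_src, ← map_src, w, h])
    obtain ⟨n, ⟨hn, hn'⟩, hu'⟩ := existsUnique_of_isPullback sq (x := m) (y := β) hm'
    refine ⟨n, ⟨(existsUnique_of_isPullback sq (w (src n))).unique ⟨rfl, rfl⟩ ⟨?_, ?_⟩, hn'⟩,
      fun n' ⟨h₁, h₂⟩ => hu' _ ⟨hu _ ⟨?_, ?_⟩, h₂⟩⟩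
    · rw [map_src a n, hn, hm, map_src]
    · rw [map_src b n, hn', h]
    · rw [← map_src, h₁, map_src]
    · rw [w, h₂]
  mk_lt β := by
    refine (Cardinal.mk_le_of_injective (f := fun m : {m // b m = β} =>
      (⟨a m.1, (congr_hom sq.w m.1).trans (congrArg g m.2)⟩ : {m // f m = g β}))
        fun m m' h => Subtype.ext ?_).trans_lt (hf.mk_lt _)
    have h : a m.1 = a m'.1 := congrArg Subtype.val h
    exact (existsUnique_of_isPullback sq (congr_hom sq.w m'.1)).unique ⟨h, m.2.trans m'.2.symm⟩
      ⟨rfl, rfl⟩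

theorem of_iso {f : A ⟶ B} (hf : IsSmallDiscrete κ f) (e : X ≅ A) :
    IsSmallDiscrete κ (e.hom ≫ f) :=
  hf.of_isPullback (IsPullback.of_horiz_isIso ⟨by simp⟩ : IsPullback e.hom (e.hom ≫ f) f (𝟙 B))

/-- Elements of two sections above the same arrow of `A` agree once their sources do, since `f` is
discrete; so a section arrow is determined by its source and base. Section arrows above `β` are
subsets of the fibre of `f ≫ g` above `β`, so the strong limit property bounds their number. -/
theorem piMap {f : X ⟶ A} {g : A ⟶ B} (hf : IsSmallDiscrete κ f) (hg : IsSmallDiscrete κ g)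
    (hκ : κ.IsInaccessible) : IsSmallDiscrete κ (piMap g f hg.liftsArrows) where
  existsUnique P β h := by
    obtain ⟨Q, hQ, hQ'⟩ := liftsArrows_of_fibrations (fibrations_of_isPi hg.fibrations hf.fibrations
      (isPi_piMap g f hg.liftsArrows)) P β h
    refine ⟨Q, ⟨hQ, hQ'⟩, fun R ⟨hR, hR'⟩ => SectionArrow.eq_of_subset (hR'.trans hQ'.symm)
      fun x hx => ?_⟩
    obtain ⟨y, hy, hy'⟩ := SectionArrow.exists_mem Q (f x)
      ((SectionArrow.map_eq R x hx).trans (hR'.trans hQ'.symm))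
    have h₁ : src x ∈ (src Q : PiCarrier g f hg.liftsArrows).carrier := by
      rw [hQ, ← hR]
      exact SectionArrow.src_mem _ _ hx
    have h₂ := SectionArrow.inj _ _ h₁ _ (SectionArrow.src_mem hg.liftsArrows _ hy)
      (by rw [map_src, map_src, hy'])
    rwa [hf.ext h₂ hy'.symm]
  mk_lt β := by
    refine (Cardinal.mk_le_of_injective
      (f := fun P : {P // InvGpd.piMap g f hg.liftsArrows P = β} =>
      ({x | x.1 ∈ P.1.carrier} : Set {x // (f ≫ g) x = β})) fun P Q h => Subtype.ext
        (SectionArrow.eq_of_subset (P.2.trans Q.2.symm) fun x hx => ?_)).trans_lt ?_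
    · exact (Set.ext_iff.1 h ⟨x, (SectionArrow.map_eq _ x hx).trans P.2⟩).1 hx
    · rw [Cardinal.mk_set]
      exact hκ.isStrongLimit.isStrongPrelimit ((hf.comp hg hκ.isRegular).mk_lt β)

end IsSmallDiscrete

end InvGpd

/-! ### Sets in the cumulative hierarchy, and fibrancy of the universe -/

namespace GpdG

variable {κ : Cardinal.{u}}

/-- A set of rank `α` is contained in `V_α`, whose cardinality `preBeth α` is less than `preBeth
κ.ord = κ`. -/
theorem SmallSet.mk_El_lt (hκ : κ.IsInaccessible) (N : SmallSet κ) : Cardinal.mk N.El < κ := by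
  have h := ((equivShrink (ZFSet.vonNeumann κ.ord)).symm N).2
  rw [← SetLike.mem_coe] at h
  conv_rhs => rw [← hκ.preBeth_ord]
  refine (ZFSet.card_mono (ZFSet.subset_vonNeumann_self _)).trans_lt ?_
  rw [ZFSet.card_vonNeumann, Cardinal.preBeth_lt_preBeth]
  exact ZFSet.mem_vonNeumann.1 h

theorem SmallSet.exists_equiv {F : Type u} (hF : Cardinal.mk F < κ) :
    ∃ N : SmallSet κ, Nonempty (F ≃ N.El) := by
  -- The initial ordinal of the cardinality of `F` is its own rank, hence lies in `V_κ`.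
  have h : (Cardinal.mk F).ord.toZFSet ∈ ZFSet.vonNeumann κ.ord := by
    rw [ZFSet.mem_vonNeumann, Ordinal.rank_toZFSet]
    exact Cardinal.ord_lt_ord.2 hF
  have h' := (equivShrink (ZFSet.vonNeumann κ.ord)).symm_apply_apply ⟨_, h⟩
  exact ⟨equivShrink (ZFSet.vonNeumann κ.ord) ⟨_, h⟩, Cardinal.eq.1
    ((congrArg (fun z : ZFSet.vonNeumann κ.ord => ZFSet.card z.1) h').trans
      ((Ordinal.card_toZFSet _).trans (Cardinal.card_ord _))).symm⟩

theorem involution_UDelta (κ : Cardinal.{u}) : (UDelta κ).involution = uInvolution κ :=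
  involution_ofInvolution _ _ _

theorem involution_UTildeDelta (κ : Cardinal.{u}) :
    (UTildeDelta κ).involution = uTildeInvolution κ :=
  involution_ofInvolution _ _ _

/-- The arrows of `U_Δ`. -/
noncomputable abbrev uArrows (κ : Cardinal.{u}) : InvGpd.{u} := arrows (UDelta κ)

noncomputable abbrev uTildeArrows (κ : Cardinal.{u}) : InvGpd.{u} := arrows (UTildeDelta κ)

noncomputable abbrev pArrows (κ : Cardinal.{u}) : uTildeArrows κ ⟶ uArrows κ :=
  toInvGpd.map (pDelta κ)

theorem bar_uArrows {A B : UObj κ} (ρ : A ⟶ B) : bar (⟨A, B, ρ⟩ : uArrows κ) =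
    (⟨(uInvolution κ).obj A, (uInvolution κ).obj B, (uInvolution κ).map ρ⟩ : Arr (UObj κ)) := by
  change Arr.map (UDelta κ).involution _ = _
  rw [involution_UDelta]
  rfl

theorem bar_uTildeArrows {A B : UTildeObj κ} (ρ : A ⟶ B) : bar (⟨A, B, ρ⟩ : uTildeArrows κ) =
    (⟨(uTildeInvolution κ).obj A, (uTildeInvolution κ).obj B, (uTildeInvolution κ).map ρ⟩ :
      Arr (UTildeObj κ)) := by
  change Arr.map (UTildeDelta κ).involution _ = _
  rw [involution_UTildeDelta]
  rfl

/-- The objects of `Ũ_Δ` above an object of `U_Δ`. -/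
def UObj.point (A : UObj κ) (a : A.A₀.El) : UTildeObj κ := ⟨A.A₀, A.A₁, a, A.φ⟩

/-- The arrows of `Ũ_Δ` above an arrow of `U_Δ`. -/
def pointArrow (β : Arr (UObj κ)) (a : β.dom.A₀.El) : Arr (UTildeObj κ) :=
  ⟨β.dom.point a, β.cod.point (UObj.Hom.ρ₀ β.hom a),
    ⟨UObj.Hom.ρ₀ β.hom, UObj.Hom.ρ₁ β.hom, rfl, UObj.Hom.comm β.hom⟩⟩

theorem exists_eq_pointArrow (m : uTildeArrows κ) (β : uArrows κ) (h : pArrows κ m = β) :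
    ∃ a, m = pointArrow β a := by
  subst h
  obtain ⟨⟨A₀, A₁, a, φ⟩, ⟨B₀, B₁, b, ψ⟩, ⟨ρ₀, ρ₁, pt, h⟩⟩ := m
  change A₀.El ≃ B₀.El at ρ₀
  change A₁.El ≃ B₁.El at ρ₁
  change ∀ x, ψ (ρ₀ x) = ρ₁ (φ x) at h
  change ρ₀ a = b at pt
  subst pt
  exact ⟨a, rfl⟩

theorem UObj.point_injective (A : UObj κ) : Function.Injective A.point := fun _ _ h => by
  injection h

theorem pointArrow_injective (β : Arr (UObj κ)) : Function.Injective (pointArrow β) :=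
  fun _ _ h =>
  β.dom.point_injective (congrArg Arr.dom h)

theorem isSmallDiscrete_pArrows (hκ : κ.IsInaccessible) :
    InvGpd.IsSmallDiscrete κ (pArrows κ) where
  existsUnique m β h := by
    obtain ⟨a, ha⟩ := exists_eq_pointArrow (src m) (src β) h.symm
    refine ⟨pointArrow β a, ⟨ha.symm, rfl⟩, fun m' ⟨h₁, h₂⟩ => ?_⟩
    obtain ⟨a', rfl⟩ := exists_eq_pointArrow m' β h₂
    exact congrArg (pointArrow β) (pointArrow_injective (@src (uArrows κ) _ β) (h₁.trans ha))
  mk_lt β := by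
    refine (Cardinal.mk_le_of_surjective (f := fun a : β.dom.A₀.El =>
      (⟨pointArrow β a, rfl⟩ : {m // pArrows κ m = β})) fun m => ?_).trans_lt
        (SmallSet.mk_El_lt hκ _)
    obtain ⟨a, ha⟩ := exists_eq_pointArrow m.1 β m.2
    exact ⟨a, Subtype.ext ha.symm⟩

/-- The hypothesis makes `ρ₁` inverse to `ρ₀`, and naturality of `ρ` then makes `ψ = ρ₁ ∘ φ` an
involution of `A₀`. Hence `(A₀, A₀, ψ)` is a strict fixed point, reached from `A` by `(id, ρ₁)`. -/
theorem exists_comp_uInvolution_map_eq (A : UObj κ) (ρ : UObj.Hom A ((uInvolution κ).obj A))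
    (h₁ : ∀ x, ρ.ρ₁ (ρ.ρ₀ x) = x) : ∃ (F : UObj κ) (m : A ⟶ F),
      Arr.mk A _ ((show A ⟶ (uInvolution κ).obj A from ρ) ≫ (uInvolution κ).map m) =
        Arr.mk A F m := by
  let ψ : A.A₀.El ≃ A.A₀.El := A.φ.trans ρ.ρ₁
  have hψ : ψ.symm = ψ := Equiv.ext fun x => ψ.injective (by
    rw [Equiv.apply_symm_apply]
    change x = ρ.ρ₁ (A.φ (ρ.ρ₁ (A.φ x)))
    have h₂ : ρ.ρ₁ (A.φ x) = A.φ.symm (ρ.ρ₀ x) := (ρ.comm x).symm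
    rw [h₂]
    exact ((congrArg ρ.ρ₁ (A.φ.apply_symm_apply (ρ.ρ₀ x))).trans (h₁ x)).symm)
  let F : UObj κ := ⟨A.A₀, A.A₀, ψ⟩
  let m : A ⟶ F := (⟨Equiv.refl _, ρ.ρ₁, fun x => rfl⟩ : UObj.Hom A F)
  have key : ∀ (ψ' : A.A₀.El ≃ A.A₀.El) (m' : A ⟶ (⟨A.A₀, A.A₀, ψ'⟩ : UObj κ)), ψ' = ψ →
      UObj.Hom.ρ₀ m' = Equiv.refl _ → UObj.Hom.ρ₁ m' = ρ.ρ₁ → Arr.mk A _ m' = Arr.mk A F m := by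
    rintro _ m' rfl h h'
    exact congrArg (Arr.mk A F) (UObj.Hom.ext h h')
  exact ⟨F, m, key _ _ hψ (Equiv.ext h₁) (Equiv.ext fun x => rfl)⟩

theorem liftsFixedPoints_uArrows :
    InvGpd.LiftsFixedPoints (InvGpd.isTerminalPUnit.from (uArrows κ)) := by
  intro θ β hθ _ _
  obtain ⟨A, A', ρ⟩ := θ
  replace hθ := (bar_uArrows ρ).symm.trans hθ
  have hA : (uInvolution κ).obj A = A' := congrArg (Arr.dom (X := UObj κ)) hθ
  subst hA
  have hρ : (uInvolution κ).map ρ = Groupoid.inv ρ := Arr.mk_injective hθ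
  obtain ⟨F, m, hm⟩ := exists_comp_uInvolution_map_eq A ρ fun x => by
    have : UObj.Hom.ρ₁ ρ = (UObj.Hom.ρ₀ ρ).symm := congrArg UObj.Hom.ρ₀ hρ
    rw [this]
    exact Equiv.symm_apply_apply _ x
  exact ⟨(⟨A, F, m⟩ : Arr (UObj κ)), rfl, rfl,
    (congrArg (fun z : uArrows κ => (⟨A, _, ρ⟩ : uArrows κ) * z) (bar_uArrows m)).trans
      ((arrows_mk_mul_mk (A := UDelta κ) ρ ((uInvolution κ).map m)).trans hm)⟩

theorem isInjFibrant_UDelta : IsInjFibrant (UDelta κ) := by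
  rw [isInjFibrant_iff]
  exact InvGpd.fibrations_of_lifts (fun a β h => ⟨src a, src_src a, rfl⟩) liftsFixedPoints_uArrows

end GpdG

/-! The classifying map of a discrete fibration with small fibres. -/

namespace InvGpd.IsSmallDiscrete

variable {X Y : InvGpd.{u}} {f : X ⟶ Y} {κ : Cardinal.{u}} (hf : IsSmallDiscrete κ f)
include hf

theorem exists_lift {y b : Y} (h : src y = b) (x : {x // f x = b}) :
    ∃ m, src m = x.1 ∧ f m = y := by
  have hx := hf.src_eq (m := x.1) (by rw [x.2, ← h, src_src])
  obtain ⟨m, hm, hm'⟩ := hf.liftsArrows x.1 y (by rw [hx, x.2, h])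
  exact ⟨m, hm.trans hx, hm'⟩

/-- The target of the lift of an arrow with a given source. -/
noncomputable def transportFun {y b b' : Y} (h : src y = b) (h' : tgt y = b')
    (x : {x // f x = b}) : {x // f x = b'} :=
  ⟨tgt (hf.exists_lift h x).choose, by rw [map_tgt, (hf.exists_lift h x).choose_spec.2, h']⟩

theorem transportFun_eq {y b b' : Y} (h : src y = b) (h' : tgt y = b') {m : X} (hm : f m = y)
    {x : {x // f x = b}} (hx : src m = x.1) : (hf.transportFun h h' x).1 = tgt m := by
  obtain ⟨h₁, h₂⟩ := (hf.exists_lift h x).choose_spec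
  exact congrArg tgt (hf.ext (h₁.trans hx.symm) (h₂.trans hm.symm))

/-- The action of an arrow on the fibres. -/
noncomputable def transport {y b b' : Y} (h : src y = b) (h' : tgt y = b') :
    {x // f x = b} ≃ {x // f x = b'} where
  toFun := hf.transportFun h h'
  invFun := hf.transportFun ((src_inv y).trans h') ((tgt_inv y).trans h)
  left_inv x := Subtype.ext (by
    obtain ⟨m, hm, hm'⟩ := hf.exists_lift h x
    rw [hf.transportFun_eq _ _ (m := m⁻¹) (by rw [map_inv, hm'])
      (by rw [hf.transportFun_eq h h' hm' hm, src_inv]), tgt_inv, hm])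
  right_inv x := Subtype.ext (by
    obtain ⟨m, hm, hm'⟩ := hf.exists_lift ((src_inv y).trans h') x
    rw [hf.transportFun_eq _ _ (m := m⁻¹) (by rw [map_inv, hm', inverse_inverse])
      (by rw [hf.transportFun_eq _ _ hm' hm, src_inv]), tgt_inv, hm])

theorem transport_apply {y b b' : Y} (h : src y = b) (h' : tgt y = b') {m : X} (hm : f m = y)
    (hb : f (src m) = b) :
    hf.transport h h' ⟨src m, hb⟩ = ⟨tgt m, by rw [map_tgt, hm, h']⟩ :=
  Subtype.ext (hf.transportFun_eq h h' hm rfl)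

theorem exists_eq {y b : Y} (h : src y = b) (x : {x // f x = b}) :
    ∃ (m : X) (hm : f m = y), x = ⟨src m, by rw [map_src, hm, h]⟩ := by
  obtain ⟨m, hm, hm'⟩ := hf.exists_lift h x
  exact ⟨m, hm', Subtype.ext hm.symm⟩

end InvGpd.IsSmallDiscrete

namespace InvGpd

variable {X Y : InvGpd.{u}} {f : X ⟶ Y} {κ : Cardinal.{u}}

/-- The involution on the fibres. -/
noncomputable def barFibre {b c : Y} (h : bar b = c) : {x // f x = b} ≃ {x // f x = c} where
  toFun x := ⟨bar x.1, by rw [map_bar, x.2, h]⟩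
  invFun x := ⟨bar x.1, by rw [map_bar, x.2, ← h, bar_bar]⟩
  left_inv x := Subtype.ext (bar_bar _)
  right_inv x := Subtype.ext (bar_bar _)

open GpdG

section Classify

variable (hf : IsSmallDiscrete κ f) {N : Y → SmallSet κ} (e : ∀ b, {x // f x = b} ≃ (N b).El)

/-- The object `c` equal to `bar b` is a separate parameter, so that endpoints agreeing only
propositionally can be substituted, as in `classifyFun_eq`. -/
noncomputable def classifyObj {b c : Y} (h : bar b = c) : UObj κ :=
  ⟨N b, N c, (e b).symm.trans ((barFibre h).trans (e c))⟩

noncomputable def classifyHom {y z b b' c c' : Y} (hb : bar b = c) (hb' : bar b' = c')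
    (hz : bar y = z) (hs : src y = b) (ht : tgt y = b') (hs' : src z = c) (ht' : tgt z = c') :
    classifyObj e hb ⟶ classifyObj e hb' :=
  (⟨(e b).symm.trans ((hf.transport hs ht).trans (e b')),
    (e c).symm.trans ((hf.transport hs' ht').trans (e c')), fun a => by
      obtain ⟨x, rfl⟩ := (e b).surjective a
      obtain ⟨m, hm, rfl⟩ := hf.exists_eq hs x
      have hm' : f (bar m) = z := by rw [map_bar, hm, hz]
      have h₁ := hf.transport_apply hs ht hm (by rw [map_src, hm, hs])
      have h₂ := hf.transport_apply hs' ht' hm' (by rw [map_src, hm', hs'])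
      simp only [src_bar, tgt_bar] at h₂
      change e c' (barFibre hb' ((e b').symm (e b' (hf.transport hs ht ((e b).symm (e b _)))))) =
        e c' (hf.transport hs' ht' ((e c).symm (e c (barFibre hb ((e b).symm (e b _))))))
      simp only [Equiv.symm_apply_apply, h₁]
      exact congrArg (e c') h₂.symm⟩ : UObj.Hom _ _)

/-- The action of the classifying map on arrows. -/
noncomputable def classifyFun (y : Y) : Arr (UObj κ) :=
  ⟨_, _, classifyHom hf e (b := src y) (b' := tgt y) rfl rfl rfl rfl rfl (src_bar y) (tgt_bar y)⟩

theorem classifyFun_eq {y z b b' c c' : Y} (hb : bar b = c) (hb' : bar b' = c')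
    (hz : bar y = z) (hs : src y = b) (ht : tgt y = b') (hs' : src z = c) (ht' : tgt z = c') :
    classifyFun hf e y = ⟨_, _, classifyHom hf e hb hb' hz hs ht hs' ht'⟩ := by
  subst hb hb' hz hs ht
  rfl

theorem transport_of_src_eq {y : Y} {b : Y} (h : src y = b) (h' : tgt y = b) (hy : src y = y) :
    hf.transport h h' = Equiv.refl _ := by
  ext x
  obtain ⟨m, hm, rfl⟩ := hf.exists_eq h x
  have hm' : src m = m := hf.src_eq (by rw [hm, hy])
  rw [hf.transport_apply h h' hm]
  exact (tgt_eq_of_src_eq hm').trans hm'.symm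

theorem transport_mul {y z b b' b'' : Y} (h : src y = b) (h' : tgt y = b') (k : src z = b')
    (k' : tgt z = b'') (l : src (y * z) = b) (l' : tgt (y * z) = b'') :
    hf.transport l l' = (hf.transport h h').trans (hf.transport k k') := by
  ext x
  obtain ⟨m, hm, rfl⟩ := hf.exists_eq h x
  obtain ⟨n, hn, hn'⟩ := hf.exists_eq k ⟨tgt m, by rw [map_tgt, hm, h']⟩
  have hmn : tgt m = src n := congrArg Subtype.val hn'
  have h₁ := hf.transport_apply l l' (m := m * n) (by rw [map_mul f hmn, hm, hn])
    (by rw [src_mul _ _ hmn, map_src, hm, h])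
  simp only [src_mul _ _ hmn, tgt_mul _ _ hmn] at h₁
  rw [h₁, Equiv.trans_apply, hf.transport_apply h h' hm, hn', hf.transport_apply k k' hn]

/-- The classifying map. -/
noncomputable def classify : Y ⟶ uArrows κ :=
  Hom.mk (B := uArrows κ) (classifyFun hf e)
    (fun y => by
      rw [classifyFun_eq hf e (y := src y) rfl rfl rfl (src_src y) (tgt_src y)
        (by simp) (by simp)]
      refine congrArg (Arr.mk _ _) (UObj.Hom.ext ?_ ?_) <;> dsimp only [classifyHom] <;>
      rw [transport_of_src_eq _ _ _ (by simp)] <;> exact Equiv.symm_trans_self _)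
    (fun y => by
      rw [classifyFun_eq hf e (y := tgt y) rfl rfl rfl (src_tgt y) (tgt_tgt y)
        (by simp) (by simp)]
      refine congrArg (Arr.mk _ _) (UObj.Hom.ext ?_ ?_) <;> dsimp only [classifyHom] <;>
      rw [transport_of_src_eq _ _ _ (by simp)] <;> exact Equiv.symm_trans_self _)
    (fun y => by
      rw [classifyFun_eq hf e (y := bar y) (z := y) (b := bar (src y)) (b' := bar (tgt y))
        (bar_bar _) (bar_bar _) (bar_bar _) (src_bar y) (tgt_bar y) rfl rfl]
      exact (bar_uArrows (classifyHom hf e (b := src y) (b' := tgt y) rfl rfl rfl rfl rfl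
        (src_bar y) (tgt_bar y))).symm)
    (fun y z h => by
      rw [classifyFun_eq hf e (y := y * z) (b := src y) (b' := tgt z) rfl rfl rfl
        (src_mul _ _ h) (tgt_mul _ _ h) (by simp [h]) (by simp [h]),
        classifyFun_eq hf e (y := z) (b := tgt y) (b' := tgt z) rfl rfl rfl h.symm rfl
        (by simp [h]) (by simp)]
      refine Eq.trans ?_ (arrows_mk_mul_mk (A := UDelta κ) _ _).symm
      refine congrArg (Arr.mk _ _) (UObj.Hom.ext ?_ ?_)
      · dsimp only [classifyHom]
        rw [transport_mul hf rfl rfl h.symm rfl]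
        ext a
        exact congrArg (fun x => e _ (hf.transport _ _ x)) (Equiv.symm_apply_apply _ _).symm
      · have h' : tgt (bar y) = src (bar z) := by simp [h]
        have key : ∀ (w : Y) (hw : bar y * bar z = w) (k : src w = bar (src y))
            (k' : tgt w = bar (tgt z)), hf.transport k k' =
              (hf.transport (src_bar y) (tgt_bar y)).trans
                (hf.transport (by simp [h]) (tgt_bar z)) := by
          rintro _ rfl k k'
          exact transport_mul hf _ _ _ _ _ _
        dsimp only [classifyHom]
        rw [key _ (bar_mul _ _ h).symm]
        ext a
        exact congrArg (fun x => e _ (hf.transport _ _ x)) (Equiv.symm_apply_apply _ _).symm)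

end Classify

end InvGpd

namespace InvGpd

open GpdG

variable {X Y : InvGpd.{u}} {f : X ⟶ Y} {κ : Cardinal.{u}}

section Classify

variable (hf : IsSmallDiscrete κ f) {N : Y → SmallSet κ} (e : ∀ b, {x // f x = b} ≃ (N b).El)

/-- Each functoriality equation for `classifyLift` is reduced by this to an equation of sources and
one that already holds for `classify`. -/
theorem pointArrow_ext (hκ : κ.IsInaccessible) {m m' : uTildeArrows κ} (h : src m = src m')
    (h' : pArrows κ m = pArrows κ m') : m = m' :=
  (isSmallDiscrete_pArrows hκ).ext h h'

/-- The object of `Ũ_Δ` classifying an object of `X`. -/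
noncomputable def classifyPoint {b c : Y} (h : bar b = c) (x : {x // f x = b}) : uTildeArrows κ :=
  (⟨_, _, 𝟙 ((classifyObj e h).point (e b x))⟩ : Arr (UTildeObj κ))

noncomputable def classifyLiftFun (x : X) : uTildeArrows κ :=
  pointArrow (classifyFun hf e (f x)) (e (src (f x)) ⟨src x, map_src f x⟩)

theorem src_classifyLiftFun {m : X} {b c : Y} (h : bar b = c) (x : {x // f x = b})
    (hm : src m = x.1) : src (classifyLiftFun hf e m) = classifyPoint e h x := by
  obtain ⟨x, rfl⟩ := x
  subst h
  change src m = x at hm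
  subst hm
  have key : ∀ (b : Y) (hb : f (src m) = b),
      (⟨_, _, 𝟙 ((classifyObj e (rfl : bar b = _)).point (e b ⟨src m, hb⟩))⟩ : Arr (UTildeObj κ)) =
        classifyPoint e rfl ⟨src m, rfl⟩ := by
    rintro _ rfl
    rfl
  exact key _ (map_src f m)

theorem tgt_classifyLiftFun {m : X} {b c : Y} (h : bar b = c) (x : {x // f x = b})
    (hm : tgt m = x.1) : tgt (classifyLiftFun hf e m) = classifyPoint e h x := by
  obtain ⟨x, rfl⟩ := x
  subst h
  change tgt m = x at hm
  subst hm
  have key : ∀ (b : Y) (hb : f (tgt m) = b) (ht : tgt (f m) = b),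
      (⟨_, _, 𝟙 ((classifyObj e (rfl : bar b = _)).point (e b (hf.transport rfl ht ((e _).symm
        (e (src (f m)) ⟨src m, map_src f m⟩)))))⟩ : Arr (UTildeObj κ)) =
        classifyPoint e rfl ⟨tgt m, rfl⟩ := by
    rintro _ rfl ht
    rw [Equiv.symm_apply_apply, hf.transport_apply rfl ht rfl]
    rfl
  exact key _ (map_tgt f m) rfl

theorem bar_classifyPoint {b c : Y} (h : bar b = c) (h' : bar c = b) (x : {x // f x = b}) :
    bar (classifyPoint e h x) = classifyPoint e h' (barFibre h x) := by
  refine (bar_uTildeArrows _).trans ?_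
  have key : ∀ a : (N c).El, a = e c (barFibre h x) →
      (⟨_, _, 𝟙 ((classifyObj e h').point a)⟩ : Arr (UTildeObj κ)) =
        classifyPoint e h' (barFibre h x) := by
    rintro _ rfl
    rfl
  exact key (e c (barFibre h ((e b).symm (e b x)))) (by rw [Equiv.symm_apply_apply])

noncomputable def classifyLift (hκ : κ.IsInaccessible) : X ⟶ uTildeArrows κ :=
  Hom.mk (B := uTildeArrows κ) (classifyLiftFun hf e)
    (fun x => by
      refine pointArrow_ext hκ ?_ ?_
      · rw [src_src, src_classifyLiftFun hf e rfl ⟨src x, rfl⟩ rfl,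
          src_classifyLiftFun hf e rfl ⟨src x, rfl⟩ (src_src x)]
      · rw [map_src]
        change classify hf e (f (src x)) = src (classify hf e (f x))
        rw [map_src, map_src])
    (fun x => by
      refine pointArrow_ext hκ ?_ ?_
      · rw [src_tgt, tgt_classifyLiftFun hf e rfl ⟨tgt x, rfl⟩ rfl,
          src_classifyLiftFun hf e rfl ⟨tgt x, rfl⟩ (src_tgt x)]
      · rw [map_tgt]
        change classify hf e (f (tgt x)) = tgt (classify hf e (f x))
        rw [map_tgt, map_tgt])
    (fun x => by
      refine pointArrow_ext hκ ?_ ?_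
      · rw [src_bar, src_classifyLiftFun hf e rfl ⟨src x, rfl⟩ rfl,
          bar_classifyPoint e rfl (bar_bar _),
          src_classifyLiftFun hf e _ (barFibre rfl ⟨src x, rfl⟩) (src_bar x)]
      · rw [map_bar]
        change classify hf e (f (bar x)) = bar (classify hf e (f x))
        rw [map_bar, map_bar])
    (fun x y h => by
      have h' : tgt (classifyLiftFun hf e x) = src (classifyLiftFun hf e y) := by
        rw [tgt_classifyLiftFun hf e rfl ⟨tgt x, rfl⟩ rfl,
          src_classifyLiftFun hf e rfl ⟨tgt x, rfl⟩ h.symm]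
      refine pointArrow_ext hκ ?_ ?_
      · rw [src_mul _ _ h', src_classifyLiftFun hf e rfl ⟨src x, rfl⟩ rfl,
          src_classifyLiftFun hf e rfl ⟨src x, rfl⟩ (src_mul _ _ h)]
      · rw [map_mul _ h']
        change classify hf e (f (x * y)) = classify hf e (f x) * classify hf e (f y)
        rw [map_mul f h, map_mul _ (map_composable f h)])

/-- An arrow of `Ũ_Δ` above the class of `y` is a point of the fibre of `f` at the source of `y`,
and `y` has a unique lift starting there. -/
theorem isPullback_classify (hκ : κ.IsInaccessible) :
    IsPullback (classifyLift hf e hκ) f (pArrows κ) (classify hf e) := by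
  refine isPullback_of_existsUnique (hom_ext fun x => rfl) fun m y h => ?_
  obtain ⟨a, rfl⟩ := exists_eq_pointArrow m (classifyFun hf e y) h
  obtain ⟨x, rfl⟩ := (e (src y)).surjective a
  obtain ⟨n, hn, rfl⟩ := hf.exists_eq rfl x
  subst hn
  refine ⟨n, ⟨rfl, rfl⟩, fun n' ⟨h₁, h₂⟩ => hf.ext ?_ h₂⟩
  have h₃ : ∀ (y : Y) (hy : f n' = y), classifyLiftFun hf e n' =
      pointArrow (classifyFun hf e y) (e (src y) ⟨src n', by rw [map_src, hy]⟩) := by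
    rintro _ rfl
    rfl
  have h₄ := (e _).injective (pointArrow_injective _ ((h₃ _ h₂).symm.trans h₁))
  exact congrArg Subtype.val h₄

end Classify

/-- Fibres smaller than `κ` are in bijection with sets in `V_κ`; any choice of such bijections
yields a classifying map. -/
theorem isSmallDiscrete_iff (hκ : κ.IsInaccessible) :
    IsSmallDiscrete κ f ↔ ∃ (k : X ⟶ uTildeArrows κ) (l : Y ⟶ uArrows κ),
      IsPullback k f (pArrows κ) l := by
  refine ⟨fun hf => ?_, fun ⟨k, l, sq⟩ => (isSmallDiscrete_pArrows hκ).of_isPullback sq⟩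
  choose N e using fun b => SmallSet.exists_equiv (hf.mk_lt b)
  exact ⟨_, _, isPullback_classify hf (fun b => (e b).some) hκ⟩

end InvGpd

/-! ### The universe axioms -/

namespace GpdG

variable {κ : Cardinal.{u}}

theorem injFibrations_pDelta (hκ : κ.IsInaccessible) : injFibrations (pDelta κ) :=
  (fibrations_toInvGpd_map_iff _).1 (isSmallDiscrete_pArrows hκ).fibrations

theorem isInjFibrant_UTildeDelta (hκ : κ.IsInaccessible) : IsInjFibrant (UTildeDelta κ) :=
  (isInjFibrant_iff _).2 (((isInjFibrant_iff _).1 isInjFibrant_UDelta).of_fibrations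
    (isSmallDiscrete_pArrows hκ).fibrations)

theorem isSmallFibration_iff (hκ : κ.IsInaccessible) (hE : IsInjFibrant (UTildeDelta κ))
    (hU : IsInjFibrant (UDelta κ)) {A B : Fibrant.{u}} (f : A ⟶ B) :
    IsSmallFibration (ObjectProperty.homMk (pDelta κ) :
      (⟨UTildeDelta κ, hE⟩ : Fibrant.{u}) ⟶ ⟨UDelta κ, hU⟩) f ↔
      InvGpd.IsSmallDiscrete κ ((IsInjFibrant.{u}.ι ⋙ toInvGpd).map f) := by
  have := isFibrantInclusion.{u}.full
  have := isFibrantInclusion.{u}.faithful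
  let p : (⟨UTildeDelta κ, hE⟩ : Fibrant.{u}) ⟶ ⟨UDelta κ, hU⟩ := ObjectProperty.homMk (pDelta κ)
  refine Iff.trans ?_ (InvGpd.isSmallDiscrete_iff hκ).symm
  constructor
  · rintro ⟨k, l, sq⟩
    exact ⟨_, _, (isFibrantInclusion.map_isPullback sq.flip
      (isSmallDiscrete_pArrows hκ).fibrations).flip⟩
  · rintro ⟨k, l, sq⟩
    let k' : A ⟶ ⟨UTildeDelta κ, hE⟩ := (IsInjFibrant.{u}.ι ⋙ toInvGpd).preimage k
    let l' : B ⟶ ⟨UDelta κ, hU⟩ := (IsInjFibrant.{u}.ι ⋙ toInvGpd).preimage l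
    have hk : (IsInjFibrant.{u}.ι ⋙ toInvGpd).map k' = k := Functor.map_preimage _ _
    have hl : (IsInjFibrant.{u}.ι ⋙ toInvGpd).map l' = l := Functor.map_preimage _ _
    have sq' : IsPullback ((IsInjFibrant.{u}.ι ⋙ toInvGpd).map k')
      ((IsInjFibrant.{u}.ι ⋙ toInvGpd).map f) ((IsInjFibrant.{u}.ι ⋙ toInvGpd).map p)
      ((IsInjFibrant.{u}.ι ⋙ toInvGpd).map l') := by
      rw [hk, hl]
      exact sq
    refine ⟨k', l', IsPullback.of_map (IsInjFibrant.{u}.ι ⋙ toInvGpd) ?_ sq'⟩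
    apply (IsInjFibrant.{u}.ι ⋙ toInvGpd).map_injective
    exact (Functor.map_comp _ k' p).trans (sq'.w.trans (Functor.map_comp _ f l').symm)

theorem isTypeTheoreticUniverse_pDelta (hκ : κ.IsInaccessible) (hE : IsInjFibrant (UTildeDelta κ))
    (hU : IsInjFibrant (UDelta κ)) :
    IsTypeTheoreticUniverse fibrantInjFibrations.{u} (ObjectProperty.homMk (pDelta κ) :
      (⟨UTildeDelta κ, hE⟩ : Fibrant.{u}) ⟶ ⟨UDelta κ, hU⟩) where
  fibration := injFibrations_pDelta hκ
  id A := by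
    rw [isSmallFibration_iff hκ, CategoryTheory.Functor.map_id]
    exact .id _ (hκ.nat_lt 1 |>.trans_eq' (by simp))
  comp f g := by
    simp only [isSmallFibration_iff hκ, CategoryTheory.Functor.map_comp]
    exact fun hf hg => hf.comp hg hκ.isRegular
  dependentProduct g _ f q := by
    simp only [isSmallFibration_iff hκ]
    intro hf hg hq
    obtain ⟨P, q', e, he, -, hq'⟩ := isFibrantInclusion.exists_isPi hg.fibrations hf.fibrations
    -- Dependent products are unique up to isomorphism, so only the groupoid of sections has to be
    -- small.
    obtain ⟨e', rfl⟩ := hq.exists_iso hq'.isDependentProduct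
    rw [CategoryTheory.Functor.map_comp, he]
    exact ((hf.piMap hg hκ).of_iso e).of_iso ((IsInjFibrant.{u}.ι ⋙ toInvGpd).mapIso e')
  factorization {A B S} f b := by
    simp only [isSmallFibration_iff hκ, CategoryTheory.Functor.map_comp]
    intro h hb
    -- By cancellation `f` is already a small fibration, so the acyclic cofibration can be the
    -- identity.
    exact ⟨A, 𝟙 A, f, MorphismProperty.llp_of_isIso _ _, h.of_comp hb, Category.id_comp f⟩

end GpdG

theorem mainTheorem11 :
    IsTypeTheoreticFibrationCategory GpdG.fibrantInjFibrations.{u} ∧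
    ∀ κ : Cardinal.{u}, κ.IsInaccessible →
      GpdG.injFibrations (GpdG.pDelta κ) ∧
      ∃ (hE : GpdG.IsInjFibrant (GpdG.UTildeDelta κ)) (hU : GpdG.IsInjFibrant (GpdG.UDelta κ)),
        IsTypeTheoreticUniverse GpdG.fibrantInjFibrations.{u}
          (ObjectProperty.homMk (GpdG.pDelta κ) :
            (⟨GpdG.UTildeDelta κ, hE⟩ : GpdG.Fibrant.{u}) ⟶ ⟨GpdG.UDelta κ, hU⟩) := by
  refine ⟨?_, fun κ hκ => ⟨GpdG.injFibrations_pDelta hκ, GpdG.isInjFibrant_UTildeDelta hκ,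
    GpdG.isInjFibrant_UDelta, GpdG.isTypeTheoreticUniverse_pDelta hκ _ _⟩⟩
  rw [GpdG.fibrantInjFibrations_eq]
  exact GpdG.isFibrantInclusion.isTypeTheoreticFibrationCategory
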